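/- Let $R$ be a commutative ring with unit and let $r\ge 0$ be an integer. For $k\ge 0$, a $k$-bigraded complex $A$ is a family of $R$-modules $A^{p,n}$ ($p,n\in\mathbb Z$) with $R$-linear maps $d_k\colon A^{p,n}\to A^{p-k,n+1-k}$ such that $d_k^2=0$; its homology $H(A)=\ker d_k/\operatorname{im} d_k$ is a bigraded $R$-module, and a morphism is a quasi-isomorphism if it induces an isomorphism on homology. An extended spectral sequence $X$ consists of $k$-bigraded complexes $(X_k,d_k)$, $k\ge 0$, and morphisms of bigraded modules $\varphi_{k+1}\colon X_{k+1}\to H(X_k)$; morphisms are families of morphisms of $k$-bigraded complexes compatible with the $\varphi_{k}$. Their category is denoted $\mathrm{eSpSe}$. A linear witness book $L$ consists of $k$-bigraded complexes $(L_k,d_k)$, $k\ge 0$, with $R$-linear maps $w_{k+1}\colon L_{k+1}\to L_k$ of bidegree $(0,0)$ and $s_k\colon L_k\to L_{k+1}$ of bidegree $(1,1)$ such that $w_{k+1}s_k=0$, $s_kw_{k+1}=0$ and $d_k=w_{k+1}d_{k+1}s_k$; morphisms are families of morphisms of $k$-bigraded complexes compatible with the $w$ and $s$. Their category is denoted $\mathrm{LWB}$,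 and $\mathcal U_{[r]}$ denotes the functor $L\mapsto (L_r,d_r)$ from $\mathrm{LWB}$ to $r$-bigraded complexes. Given an extended spectral sequence $X$, a sequence $(x_0,\dots,x_k)$ with $x_i\in X_i^{p,n}$ is compatible if for all $0\le i<k$ one has $d_ix_i=0$ and $\varphi_{i+1}(x_{i+1})=[x_i]$. The nerve $N\colon\mathrm{eSpSe}\to\mathrm{LWB}$ sends $X$ to the linear witness book for which $N(X)_k^{p,n}$ is the module of pairs $(x;y)$ of compatible sequences $x=(x_0,\dots,x_k)$ in bidegree $(p,n)$ and $y=(y_0,\dots,y_k)$ in bidegree $(p-k,n+1-k)$ with $d_kx_k=y_k$, with $d_k(x;y)=(y;0)$, $w_k(x;y)=((x_0,\dots,x_{k-1});0)$ and $s_k(x;y)=(0;(y_0,\dots,y_k,0))$. Then the following hold. 1. The category of $r$-bigraded complexes has a cofibrantly generated model structure (the projective one) whose fibrations are the bidegreewise surjections and whose weak equivalences are the quasi-isomorphisms. The category $\mathrm{LWB}$ has a cofibrantly generated model structure $\mathrm{LWB}_r$ whose fibrations are the maps $f$ such that $f_i$ is bidegreewise surjective for $0\le i\le r$ and whose weak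 equivalences are the maps $f$ such that $f_r$ is a quasi-isomorphism. 2. The category $\mathrm{eSpSe}$ has a cofibrantly generated model structure $\mathrm{eSpSe}_r$ whose fibrations are the maps $f$ such that $f_i$ is bidegreewise surjective for $0\le i\le r$ and whose weak equivalences are the maps $f$ such that $f_r$ is a quasi-isomorphism. 3. The functor $N$ has a left adjoint $Q$, and $\mathrm{eSpSe}_r$ is right-transferred from $\mathrm{LWB}_r$ along $Q\dashv N$: a map $f$ of extended spectral sequences is a fibration, respectively a weak equivalence, in $\mathrm{eSpSe}_r$ if and only if $N(f)$ is one in $\mathrm{LWB}_r$. 4. The adjunction $Q\dashv N$ is a Quillen equivalence between $\mathrm{LWB}_r$ and $\mathrm{eSpSe}_r$. The functor $\mathcal U_{[r]}$ has a left adjoint $\mathcal F_{[r]}$, the adjunction $\mathcal F_{[r]}\dashv\mathcal U_{[r]}$ is a Quillen equivalence between the projective model structure on $r$-bigraded complexes and $\mathrm{LWB}_r$, and hence the composite $Q\mathcal F_{[r]}\dashv\mathcal U_{[r]}N$ is a Quillen equivalence between the projective model structure on $r$-bigraded complexes and $\mathrm{eSpSe}_r$. -/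

import Mathlib

open CategoryTheory Limits HomotopicalAlgebra

universe w v v' u u'

/-! ### Generalities on model categories -/

section ModelCategories

/-- The set of morphisms `I` permits the small object argument (at the universe level of the
morphisms of `C`): `I` is essentially small, the colimits used in the small object argument exist,
and there is a cardinal `κ₀` such that, for every regular cardinal `κ ≥ κ₀`, the functors
`Hom(A, -)`, for `A` the source of a map in `I`, commute with the colimits of the sequences of
length `κ` which define relative `I`-cell complexes. -/
def PermitsSmallObjectArgument {C : Type u} [Category.{v} C] (I : MorphismProperty C) : Prop :=
  ∃ κ₀ : Cardinal.{v}, ∀ (κ : Cardinal.{v}) [Fact κ.IsRegular] [OrderBot κ.ord.ToType],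
    κ₀ ≤ κ → I.IsCardinalForSmallObjectArgument κ

/-- A cofibrantly generated model category: it has all small limits and colimits, and there are
sets of morphisms `I` and `J` which permit the small object argument and such that the trivial
fibrations (resp. the fibrations) are the maps with the right lifting property with respect to `I`
(resp. to `J`). -/
structure IsCofibrantlyGenerated (C : Type u) [Category.{v} C] [ModelCategory C] : Prop where
  hasLimits : HasLimits C
  hasColimits : HasColimits C
  exists_generators : ∃ I J : MorphismProperty C,
    PermitsSmallObjectArgument I ∧ PermitsSmallObjectArgument J ∧
      trivialFibrations C = I.rlp ∧ fibrations C = J.rlp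

/-- An adjunction between model categories is a Quillen equivalence: the right adjoint preserves
fibrations and trivial fibrations, and for `X` cofibrant and `Y` fibrant, a map `F X ⟶ Y` is a
weak equivalence if and only if its adjunct `X ⟶ G Y` is a weak equivalence. -/
structure IsQuillenEquivalence {C : Type u} [Category.{v} C] [ModelCategory C]
    {D : Type u'} [Category.{v'} D] [ModelCategory D] {F : C ⥤ D} {G : D ⥤ C}
    (adj : F ⊣ G) : Prop where
  fibration_map {X Y : D} (f : X ⟶ Y) : fibrations D f → fibrations C (G.map f)
  trivialFibration_map {X Y : D} (f : X ⟶ Y) :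
    trivialFibrations D f → trivialFibrations C (G.map f)
  weakEquivalence_iff {X : C} {Y : D} (f : F.obj X ⟶ Y) :
    IsCofibrant X → IsFibrant Y →
      (weakEquivalences D f ↔ weakEquivalences C (adj.homEquiv X Y f))

end ModelCategories

/-! ### Bigraded complexes -/

/-- The shape of `r`-bigraded complexes: the differential has bidegree `(-r, 1-r)`. -/
abbrev pageShape (r : ℕ) : ComplexShape (ℤ × ℤ) :=
  ComplexShape.up' ((-(r : ℤ), 1 - (r : ℤ)) : ℤ × ℤ)

/-- The category of `r`-bigraded complexes of `R`-modules. -/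
abbrev RBC (R : Type u) [CommRing R] (r : ℕ) : Type (u + 1) :=
  HomologicalComplex (ModuleCat.{u} R) (pageShape r)

/-- A morphism of bigraded complexes which is surjective in every bidegree. -/
def RBC.Surj {R : Type u} [CommRing R] {r : ℕ} {A B : RBC R r} (f : A ⟶ B) : Prop :=
  ∀ i : ℤ × ℤ, Function.Surjective (f.f i)

/-- The class of bidegreewise surjections of `r`-bigraded complexes. -/
def RBC.fib (R : Type u) [CommRing R] (r : ℕ) : MorphismProperty (RBC R r) :=
  fun _ _ f => RBC.Surj f

/-- The class of quasi-isomorphisms of `r`-bigraded complexes. -/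
def RBC.weq (R : Type u) [CommRing R] (r : ℕ) : MorphismProperty (RBC R r) :=
  HomologicalComplex.quasiIso (ModuleCat.{u} R) (pageShape r)

/-! ### Extended spectral sequences -/

/-- An extended spectral sequence: an `r`-bigraded complex for each `r`, and characteristic maps
from each page to the homology of the previous one. -/
structure ESpSe (R : Type u) [CommRing R] : Type (u + 1) where
  page (r : ℕ) : RBC R r
  φ (r : ℕ) (i : ℤ × ℤ) : (page (r + 1)).X i ⟶ (page r).homology i

namespace ESpSe

variable {R : Type u} [CommRing R]

/-- Morphisms of extended spectral sequences: they are compatible with the characteristic maps. -/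
@[ext]
structure Hom (X Y : ESpSe R) : Type u where
  page (r : ℕ) : X.page r ⟶ Y.page r
  comm (r : ℕ) (i : ℤ × ℤ) :
    X.φ r i ≫ HomologicalComplex.homologyMap (page r) i = (page (r + 1)).f i ≫ Y.φ r i

instance : Category.{u} (ESpSe R) where
  Hom := Hom
  id X := { page := fun r => 𝟙 (X.page r), comm := by intro r i; simp }
  comp f g :=
    { page := fun r => f.page r ≫ g.page r
      comm := by
        intro r i
        rw [HomologicalComplex.homologyMap_comp, ← Category.assoc, f.comm, Category.assoc, g.comm,
          HomologicalComplex.comp_f, Category.assoc] }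

@[simp] lemma id_page (X : ESpSe R) (r : ℕ) : Hom.page (𝟙 X) r = 𝟙 (X.page r) := rfl

@[simp] lemma comp_page {X Y Z : ESpSe R} (f : X ⟶ Y) (g : Y ⟶ Z) (r : ℕ) :
    Hom.page (f ≫ g) r = Hom.page f r ≫ Hom.page g r := rfl

variable (R) in
/-- The maps which are bidegreewise surjective on the pages `0, …, r`. -/
def fib (r : ℕ) : MorphismProperty (ESpSe R) :=
  fun _ _ f => ∀ k ≤ r, RBC.Surj (Hom.page f k)

variable (R) in
/-- The maps which are a quasi-isomorphism on page `r`. -/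
def weq (r : ℕ) : MorphismProperty (ESpSe R) :=
  fun _ _ f => RBC.weq R r (Hom.page f r)

end ESpSe

/-! ### Linear witness books -/

/-- A linear witness book: a linear presheaf on the linear category with objects `(r, p, n)`
generated by the co-witness, co-differential and co-degeneracy maps and their relations; that is,
an `r`-bigraded complex for each `r`, with witness maps `w` of bidegree `(0, 0)` and degeneracy
maps `s` of bidegree `(1, 1)`, such that `w s = 0`, `s w = 0` and `d = w d s`. In the last
relation, for `j = i + (-r, 1-r)` one also has `j = i + (1, 1) + (-(r+1), 1-(r+1))`, and for every
other `j` both sides vanish. -/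
structure LWB (R : Type u) [CommRing R] : Type (u + 1) where
  page (r : ℕ) : RBC R r
  w (r : ℕ) (i : ℤ × ℤ) : (page (r + 1)).X i ⟶ (page r).X i
  s (r : ℕ) (i : ℤ × ℤ) : (page r).X i ⟶ (page (r + 1)).X (i + (1, 1))
  s_w (r : ℕ) (i : ℤ × ℤ) : s r i ≫ w r (i + (1, 1)) = 0
  w_s (r : ℕ) (i : ℤ × ℤ) : w r i ≫ s r i = 0
  s_d_w (r : ℕ) (i j : ℤ × ℤ) :
    (page r).d i j = s r i ≫ (page (r + 1)).d (i + (1, 1)) j ≫ w r j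

namespace LWB

variable {R : Type u} [CommRing R]

/-- Morphisms of linear witness books: morphisms of bigraded complexes on each page, compatible
with the witness maps and the degeneracy maps. -/
@[ext]
structure Hom (K L : LWB R) : Type u where
  page (r : ℕ) : K.page r ⟶ L.page r
  comm_w (r : ℕ) (i : ℤ × ℤ) : K.w r i ≫ (page r).f i = (page (r + 1)).f i ≫ L.w r i
  comm_s (r : ℕ) (i : ℤ × ℤ) :
    K.s r i ≫ (page (r + 1)).f (i + (1, 1)) = (page r).f i ≫ L.s r i

instance : Category.{u} (LWB R) where
  Hom := Hom
  id X := { page := fun r => 𝟙 (X.page r), comm_w := by intros; simp, comm_s := by intros; simp }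
  comp f g :=
    { page := fun r => f.page r ≫ g.page r
      comm_w := by
        intro r i
        rw [HomologicalComplex.comp_f, HomologicalComplex.comp_f, ← Category.assoc, f.comm_w,
          Category.assoc, g.comm_w, Category.assoc]
      comm_s := by
        intro r i
        rw [HomologicalComplex.comp_f, HomologicalComplex.comp_f, ← Category.assoc, f.comm_s,
          Category.assoc, g.comm_s, Category.assoc] }

@[simp] lemma id_page (X : LWB R) (r : ℕ) : Hom.page (𝟙 X) r = 𝟙 (X.page r) := rfl

@[simp] lemma comp_page {X Y Z : LWB R} (f : X ⟶ Y) (g : Y ⟶ Z) (r : ℕ) :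
    Hom.page (f ≫ g) r = Hom.page f r ≫ Hom.page g r := rfl

variable (R) in
/-- The functor sending a linear witness book to its `r`-page. -/
def pageFunctor (r : ℕ) : LWB R ⥤ RBC R r where
  obj L := L.page r
  map f := Hom.page f r

variable (R) in
/-- The maps which are bidegreewise surjective on the pages `0, …, r`. -/
def fib (r : ℕ) : MorphismProperty (LWB R) :=
  fun _ _ f => ∀ k ≤ r, RBC.Surj (Hom.page f k)

variable (R) in
/-- The maps which are a quasi-isomorphism on page `r`. -/
def weq (r : ℕ) : MorphismProperty (LWB R) :=
  fun _ _ f => RBC.weq R r (Hom.page f r)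

end LWB

/-! ### The nerve of an extended spectral sequence -/

namespace ESpSe

variable {R : Type u} [CommRing R]

/-- For `a` on page `k + 1` and `b` on page `k`: `b` is a cycle and `φ a = [b]`. -/
def IsWitness (X : ESpSe R) (k : ℕ) (i : ℤ × ℤ) (a : (X.page (k + 1)).X i)
    (b : (X.page k).X i) : Prop :=
  ∃ z : (X.page k).cycles i, (X.page k).iCycles i z = b ∧ (X.page k).homologyπ i z = X.φ k i a

/-- The sequence `(x 0, …, x r)` in bidegree `i` is compatible. -/
def IsCompatible (X : ESpSe R) (r : ℕ) (i : ℤ × ℤ) (x : ∀ k : ℕ, (X.page k).X i) : Prop :=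
  ∀ k < r, X.IsWitness k i (x (k + 1)) (x k)

lemma IsWitness.zero (X : ESpSe R) (k : ℕ) (i : ℤ × ℤ) : X.IsWitness k i 0 0 :=
  ⟨0, by simp, by simp⟩

lemma IsWitness.add {X : ESpSe R} {k : ℕ} {i : ℤ × ℤ} {a a' : (X.page (k + 1)).X i}
    {b b' : (X.page k).X i} (h : X.IsWitness k i a b) (h' : X.IsWitness k i a' b') :
    X.IsWitness k i (a + a') (b + b') := by
  obtain ⟨z, h₁, h₂⟩ := h
  obtain ⟨z', h₁', h₂'⟩ := h'
  exact ⟨z + z', by simp [h₁, h₁'], by simp [h₂, h₂']⟩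

lemma IsWitness.smul {X : ESpSe R} {k : ℕ} {i : ℤ × ℤ} {a : (X.page (k + 1)).X i}
    {b : (X.page k).X i} (c : R) (h : X.IsWitness k i a b) :
    X.IsWitness k i (c • a) (c • b) := by
  obtain ⟨z, h₁, h₂⟩ := h
  exact ⟨c • z, by simp [h₁], by simp [h₂]⟩

lemma IsWitness.map {X Y : ESpSe R} (f : X ⟶ Y) {k : ℕ} {i : ℤ × ℤ} {a : (X.page (k + 1)).X i}
    {b : (X.page k).X i} (h : X.IsWitness k i a b) :
    Y.IsWitness k i ((Hom.page f (k + 1)).f i a) ((Hom.page f k).f i b) := by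
  obtain ⟨z, h₁, h₂⟩ := h
  refine ⟨HomologicalComplex.cyclesMap (Hom.page f k) i z, ?_, ?_⟩
  · rw [← h₁, ← ConcreteCategory.comp_apply, ← ConcreteCategory.comp_apply,
      HomologicalComplex.cyclesMap_i]
  · have h₃ := ConcreteCategory.congr_hom (Hom.comm f k i) a
    rw [ConcreteCategory.comp_apply, ConcreteCategory.comp_apply, ← h₂] at h₃
    rw [← h₃, ← ConcreteCategory.comp_apply, ← ConcreteCategory.comp_apply,
      HomologicalComplex.homologyπ_naturality]

/-- The module `N(X)_r` in bidegree `i`: pairs `((x 0, …, x r); (y 0, …, y r))` of compatible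
sequences, `x` in bidegree `i` and `y` in bidegree `j = i + (-r, 1-r)`, such that
`d (x r) = y r`. Finite sequences are extended by zero to all `k`, and the bidegree `j` (which is
unique) is kept as an index. -/
def nerveModule (X : ESpSe R) (r : ℕ) (i : ℤ × ℤ) :
    Submodule R ((∀ k : ℕ, (X.page k).X i) ×
      (∀ (j : {j : ℤ × ℤ // (pageShape r).Rel i j}) (k : ℕ), (X.page k).X j.1)) where
  carrier := {p | (∀ k, r < k → p.1 k = 0) ∧ (∀ j k, r < k → p.2 j k = 0) ∧
    X.IsCompatible r i p.1 ∧ (∀ j, X.IsCompatible r j.1 (p.2 j)) ∧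
    ∀ j, (X.page r).d i j.1 (p.1 r) = p.2 j r}
  zero_mem' := ⟨fun _ _ => rfl, fun _ _ _ => rfl, fun _ _ => IsWitness.zero _ _ _,
    fun _ _ _ => IsWitness.zero _ _ _, fun _ => by simp⟩
  add_mem' := by
    rintro p q ⟨h₁, h₂, h₃, h₄, h₅⟩ ⟨h₁', h₂', h₃', h₄', h₅'⟩
    refine ⟨fun k hk => ?_, fun j k hk => ?_, fun k hk => (h₃ k hk).add (h₃' k hk),
      fun j k hk => (h₄ j k hk).add (h₄' j k hk), fun j => ?_⟩
    · simp [h₁ k hk, h₁' k hk]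
    · simp [h₂ j k hk, h₂' j k hk]
    · simp [h₅ j, h₅' j]
  smul_mem' := by
    rintro c p ⟨h₁, h₂, h₃, h₄, h₅⟩
    refine ⟨fun k hk => ?_, fun j k hk => ?_, fun k hk => (h₃ k hk).smul c,
      fun j k hk => (h₄ j k hk).smul c, fun j => ?_⟩
    · simp [h₁ k hk]
    · simp [h₂ j k hk]
    · simp [h₅ j]

lemma nerve_ext {X : ESpSe R} {r : ℕ} {i : ℤ × ℤ} {p q : X.nerveModule r i}
    (h₁ : ∀ k, p.1.1 k = q.1.1 k) (h₂ : ∀ j k, p.1.2 j k = q.1.2 j k) : p = q :=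
  Subtype.ext (Prod.ext (funext h₁) (funext fun j => funext (h₂ j)))

/-- The differential `(x; y) ↦ (y; 0)` from bidegree `i` to bidegree `j = i + (-r, 1-r)`. -/
def nerveD (X : ESpSe R) (r : ℕ) (i j : ℤ × ℤ) (h : (pageShape r).Rel i j) :
    X.nerveModule r i →ₗ[R] X.nerveModule r j where
  toFun p := ⟨(p.1.2 ⟨j, h⟩, 0), fun k hk => p.2.2.1 ⟨j, h⟩ k hk, fun _ _ _ => rfl,
    p.2.2.2.2.1 ⟨j, h⟩, fun _ _ _ => IsWitness.zero _ _ _, fun l => by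
      have := p.2.2.2.2.2 ⟨j, h⟩
      dsimp only at this ⊢
      rw [← this, ← ConcreteCategory.comp_apply, HomologicalComplex.d_comp_d]
      rfl⟩
  map_add' _ _ := Subtype.ext (Prod.ext rfl (add_zero _).symm)
  map_smul' _ _ := Subtype.ext (Prod.ext rfl (smul_zero _).symm)

/-- The witness map `(x; y) ↦ ((x 0, …, x r); 0)` from page `r + 1` to page `r`. -/
def nerveW (X : ESpSe R) (r : ℕ) (i : ℤ × ℤ) :
    X.nerveModule (r + 1) i →ₗ[R] X.nerveModule r i where
  toFun p := ⟨(fun k => if k ≤ r then p.1.1 k else 0, 0), fun k hk => if_neg (by omega),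
    fun _ _ _ => rfl, fun k hk => by
      have := p.2.2.2.1 k (by omega)
      simpa only [if_pos (show k ≤ r by omega), if_pos (show k + 1 ≤ r by omega)] using this,
    fun _ _ _ => IsWitness.zero _ _ _, fun l => by
      obtain ⟨z, hz, -⟩ := p.2.2.2.1 r (by omega)
      simp only [le_refl, if_true]
      rw [← hz, ← ConcreteCategory.comp_apply, HomologicalComplex.iCycles_d]
      rfl⟩
  map_add' p q := by
    refine Subtype.ext (Prod.ext (funext fun k => ?_) (add_zero _).symm)
    by_cases hk : k ≤ r <;> simp [hk]
  map_smul' c p := by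
    refine Subtype.ext (Prod.ext (funext fun k => ?_) (smul_zero _).symm)
    by_cases hk : k ≤ r <;> simp [hk]

lemma rel_of_rel_succ {r : ℕ} {i j : ℤ × ℤ} (h : (pageShape (r + 1)).Rel (i + (1, 1)) j) :
    (pageShape r).Rel i j := by
  obtain ⟨i₁, i₂⟩ := i
  obtain ⟨j₁, j₂⟩ := j
  simp only [ComplexShape.up'_Rel, Prod.mk_add_mk, Prod.mk.injEq] at h ⊢
  push_cast at h
  omega

/-- The degeneracy map `(x; y) ↦ (0; (y 0, …, y r, 0))` from page `r` in bidegree `i` to page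
`r + 1` in bidegree `i + (1, 1)`. -/
def nerveS (X : ESpSe R) (r : ℕ) (i : ℤ × ℤ) :
    X.nerveModule r i →ₗ[R] X.nerveModule (r + 1) (i + (1, 1)) where
  toFun p := ⟨(0, fun j => p.1.2 ⟨j.1, rel_of_rel_succ j.2⟩), fun _ _ => rfl,
    fun j k hk => p.2.2.1 ⟨j.1, rel_of_rel_succ j.2⟩ k (by omega),
    fun _ _ => IsWitness.zero _ _ _, fun j k hk => by
      let j' : {j : ℤ × ℤ // (pageShape r).Rel i j} := ⟨j.1, rel_of_rel_succ j.2⟩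
      change X.IsWitness k j'.1 (p.1.2 j' (k + 1)) (p.1.2 j' k)
      obtain hk' | rfl : k < r ∨ k = r := by omega
      · exact p.2.2.2.2.1 j' k hk'
      · rw [p.2.2.1 j' (k + 1) (by omega), ← p.2.2.2.2.2 j']
        refine ⟨(X.page k).toCycles i j'.1 (p.1.1 k), ?_, ?_⟩
        · rw [← ConcreteCategory.comp_apply, HomologicalComplex.toCycles_i]
        · rw [← ConcreteCategory.comp_apply, HomologicalComplex.toCycles_comp_homologyπ, map_zero]
          rfl,
    fun j => by
      have := p.2.2.1 ⟨j.1, rel_of_rel_succ j.2⟩ (r + 1) (by omega)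
      dsimp only at this ⊢
      rw [this]
      exact map_zero _⟩
  map_add' _ _ := Subtype.ext (Prod.ext (add_zero _).symm rfl)
  map_smul' _ _ := Subtype.ext (Prod.ext (smul_zero _).symm rfl)

open Classical in
/-- The `r`-page of the nerve. -/
noncomputable def nervePage (X : ESpSe R) (r : ℕ) : RBC R r where
  X i := ModuleCat.of R (X.nerveModule r i)
  d i j := if h : (pageShape r).Rel i j then ModuleCat.ofHom (X.nerveD r i j h) else 0
  shape i j h := dif_neg h
  d_comp_d' i j k hij hjk := by
    rw [dif_pos hij, dif_pos hjk]
    rfl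

/-- The linear witness book `N(X)` associated with an extended spectral sequence `X`. -/
noncomputable def nerve (X : ESpSe R) : LWB R where
  page := X.nervePage
  w r i := ModuleCat.ofHom (X.nerveW r i)
  s r i := ModuleCat.ofHom (X.nerveS r i)
  s_w r i := by
    refine ModuleCat.hom_ext (LinearMap.ext fun p => nerve_ext (fun k => ?_) fun _ _ => rfl)
    exact ite_self _
  w_s r i := ModuleCat.hom_ext (LinearMap.ext fun p => nerve_ext (fun _ => rfl) fun _ _ => rfl)
  s_d_w r i j := by
    by_cases h : (pageShape r).Rel i j
    · have h' : (pageShape (r + 1)).Rel (i + (1, 1)) j := by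
        obtain ⟨i₁, i₂⟩ := i
        obtain ⟨j₁, j₂⟩ := j
        simp only [ComplexShape.up'_Rel, Prod.mk_add_mk, Prod.mk.injEq] at h ⊢
        push_cast
        omega
      simp only [nervePage, dif_pos h, dif_pos h']
      refine ModuleCat.hom_ext (LinearMap.ext fun p => nerve_ext (fun k => ?_) fun _ _ => rfl)
      change p.1.2 ⟨j, h⟩ k = if k ≤ r then p.1.2 ⟨j, h⟩ k else 0
      by_cases hk : k ≤ r
      · rw [if_pos hk]
      · rw [if_neg hk, p.2.2.1 ⟨j, h⟩ k (by omega)]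
    · have h' : ¬ (pageShape (r + 1)).Rel (i + (1, 1)) j := fun h' => h (rel_of_rel_succ h')
      simp only [nervePage, dif_neg h, dif_neg h']
      exact ModuleCat.hom_ext (LinearMap.ext fun p => (map_zero (X.nerveW r j)).symm)

/-- The map `N(X)_r ⟶ N(Y)_r` in bidegree `i` induced by a morphism `X ⟶ Y`. -/
def nerveModuleMap {X Y : ESpSe R} (f : X ⟶ Y) (r : ℕ) (i : ℤ × ℤ) :
    X.nerveModule r i →ₗ[R] Y.nerveModule r i where
  toFun p := ⟨(fun k => (Hom.page f k).f i (p.1.1 k), fun j k => (Hom.page f k).f j.1 (p.1.2 j k)),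
    fun k hk => by
      dsimp only
      rw [p.2.1 k hk, map_zero],
    fun j k hk => by
      dsimp only
      rw [p.2.2.1 j k hk, map_zero],
    fun k hk => (p.2.2.2.1 k hk).map f, fun j k hk => (p.2.2.2.2.1 j k hk).map f, fun j => by
      dsimp only
      rw [← p.2.2.2.2.2 j, ← ConcreteCategory.comp_apply, ← ConcreteCategory.comp_apply,
        HomologicalComplex.Hom.comm]⟩
  map_add' _ _ := nerve_ext (fun _ => map_add _ _ _) fun _ _ => map_add _ _ _
  map_smul' _ _ := nerve_ext (fun _ => LinearMap.map_smul _ _ _) fun _ _ => LinearMap.map_smul _ _ _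

/-- The map of `r`-bigraded complexes `N(X)_r ⟶ N(Y)_r` induced by a morphism `X ⟶ Y`. -/
noncomputable def nervePageMap {X Y : ESpSe R} (f : X ⟶ Y) (r : ℕ) :
    X.nervePage r ⟶ Y.nervePage r where
  f i := ModuleCat.ofHom (nerveModuleMap f r i)
  comm' i j hij := by
    simp only [nervePage, dif_pos hij]
    exact ModuleCat.hom_ext (LinearMap.ext fun p =>
      nerve_ext (fun _ => rfl) fun _ _ => (map_zero _).symm)

variable (R) in
/-- The functor `N` from extended spectral sequences to linear witness books. -/
noncomputable def nerveFunctor : ESpSe R ⥤ LWB R where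
  obj X := X.nerve
  map f :=
    { page := fun r => nervePageMap f r
      comm_w := by
        intro r i
        refine ModuleCat.hom_ext (LinearMap.ext fun p =>
          nerve_ext (fun k => ?_) fun _ _ => map_zero _)
        change (Hom.page f k).f i (if k ≤ r then p.1.1 k else 0) =
          if k ≤ r then (Hom.page f k).f i (p.1.1 k) else 0
        by_cases hk : k ≤ r
        · simp only [if_pos hk]
        · simp only [if_neg hk, map_zero]
      comm_s := fun r i => ModuleCat.hom_ext (LinearMap.ext fun p =>
        nerve_ext (fun _ => map_zero _) fun _ _ => rfl) }
  map_id X := LWB.Hom.ext (funext fun r => HomologicalComplex.hom_ext _ _ fun i =>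
    ModuleCat.hom_ext (LinearMap.ext fun p => nerve_ext (fun _ => rfl) fun _ _ => rfl))
  map_comp f g := LWB.Hom.ext (funext fun r => HomologicalComplex.hom_ext _ _ fun i =>
    ModuleCat.hom_ext (LinearMap.ext fun p => nerve_ext (fun _ => rfl) fun _ _ => rfl))

end ESpSe

/-!
# Model structures on linear witness books and extended spectral sequences

All three model structures arise in the same way. There is a family of right adjoint functors to
categories of bigraded complexes, the fibrations are the maps which all of them send to
surjections, and the weak equivalences are the maps which one of them sends to a
quasi-isomorphism. The right lifting properties with respect to the images of `0 ⟶ disk` and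
`sphere ⟶ disk` describe the fibrations and the trivial fibrations. Therefore, apart from the
smallness of the spheres, only a factorization of every map as a weak equivalence followed by a
fibration is needed (`exists_modelCategory_of_adjunctions`); the acyclicity condition follows by
the retract argument.

For linear witness books, the functors are the pages `0, …, r`. Their left adjoints `LWB.free` are
constructed explicitly: below page `k` the free book on a `k`-bigraded complex `A` consists of
copies of `A` connected by `w`, and above page `k` it consists of two copies of `A / im d`, the
iterated degeneracies and their differentials. A map `K ⟶ L` is factored by adding to `K` the free
books on acyclic complexes which cover the pages `0, …, r` of `L`
(`LWB.exists_factorization`). Bigraded complexes inherit the factorization from page `r`.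

For extended spectral sequences, the functors are the pages of the nerve `N`. The projection
`(x; y) ↦ x k` from `N(X) k` to `X k` is a surjective quasi-isomorphism (`ESpSe.weq_nerveπ`), and
compatible sequences lift along fibrations, so that a map `f` is a fibration or a weak equivalence
if and only if `N(f)` is one (`ESpSe.fib_iff_nerve`, `ESpSe.weq_iff_nerve`). The left adjoint
`LWB.quot` of `N` divides each page by the subcomplex generated by the degeneracies, with the
witness maps inducing the characteristic maps. The counit is an isomorphism
(`ESpSe.isIso_quotDesc`), so extended spectral sequences form a reflective subcategory of linear
witness books and have limits; colimits are computed pagewise.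

The quotient map `L r ⟶ quot L r` is a quasi-isomorphism if every degeneracy on page `r` which is
a cycle is the boundary of a degeneracy (`LWB.IsDegenerateExact`,
`LWB.IsDegenerateExact.weq_quotπ`). This condition holds for nerves and free books, and is
inherited by direct sums and retracts. It therefore holds for the middle object of the factorization
of `N(f)`, to which one applies `quot` in order to factor `f`. It also holds for cofibrant books:
the sub-book of the elements killed by the degeneracies out of the pages below `r` satisfies it and
has the same page `r`, and factoring its inclusion into `L` yields a trivial fibration onto `L` from
a book which satisfies it, of which `L` is a retract
(`LWB.isDegenerateExact_of_exists_section`). Hence the unit of `Q ⊣ N` is a weak equivalence at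
cofibrant objects. As the unit of `F ⊣ U` is an isomorphism and the right adjoints `N` and `U`
preserve and reflect weak equivalences, all three adjunctions are Quillen equivalences
(`IsQuillenEquivalence.of_unit`).
-/

/-! ### Model structures from generating sets -/

section ModelStructures

variable {C : Type u} [Category.{v} C]

/-- The smallness condition holds as soon as the sources of the maps are finitely presentable. -/
lemma permitsSmallObjectArgument_of_preservesColimits [HasColimits C] (I : MorphismProperty C)
    [MorphismProperty.IsSmall.{v} I]
    (h : ∀ ⦃A B : C⦄ (i : A ⟶ B), I i → ∀ (J : Type v) [SmallCategory J] [IsFiltered J],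
      PreservesColimitsOfShape J (coyoneda.obj (Opposite.op A))) :
    PermitsSmallObjectArgument I := by
  refine ⟨0, fun κ _ _ _ => ?_⟩
  have : IsFiltered κ.ord.ToType := inferInstance
  refine { preservesColimit := fun i hi f hf => ?_ }
  have := h i hi κ.ord.ToType
  infer_instance

lemma PermitsSmallObjectArgument.hasSmallObjectArgument {I : MorphismProperty C}
    (hI : PermitsSmallObjectArgument I) : MorphismProperty.HasSmallObjectArgument.{v} I := by
  obtain ⟨κ₀, h⟩ := hI
  obtain ⟨κ, hκ, hκ₀⟩ : ∃ κ : Cardinal.{v}, κ.IsRegular ∧ κ₀ ≤ κ :=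
    ⟨Order.succ (max κ₀ Cardinal.aleph0), Cardinal.isRegular_succ (le_max_right _ _),
      (le_max_left _ _).trans (Order.le_succ _)⟩
  have : Fact κ.IsRegular := ⟨hκ⟩
  have : Nonempty κ.ord.ToType := Ordinal.nonempty_toType_iff.2 hκ.ord_pos.ne'
  let := WellFoundedLT.toOrderBot κ.ord.ToType
  exact ⟨κ, inferInstance, inferInstance, h κ hκ₀⟩

/-- A recognition theorem for cofibrantly generated model categories. Instead of the usual
condition that relative `J`-cell complexes are weak equivalences, it suffices to have some
factorization of every map as a weak equivalence followed by a fibration: a map with the left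
lifting property with respect to fibrations is a retract of the first map of its factorization. -/
theorem exists_modelCategory [HasLimits C] [HasColimits C] (W Fib I J : MorphismProperty C)
    [W.HasTwoOutOfThreeProperty] [W.IsStableUnderRetracts]
    (hI : PermitsSmallObjectArgument I) (hJ : PermitsSmallObjectArgument J)
    (hIW : I.rlp = Fib ⊓ W) (hJF : J.rlp = Fib)
    (hfac : ∀ ⦃X Y : C⦄ (f : X ⟶ Y), ∃ (Z : C) (j : X ⟶ Z) (p : Z ⟶ Y), j ≫ p = f ∧ W j ∧ Fib p) :
    ∃ _ : ModelCategory C, IsCofibrantlyGenerated C ∧ fibrations C = Fib ∧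
      weakEquivalences C = W := by
  have hW : J.rlp.llp ≤ W := by
    intro X Y f hf
    obtain ⟨Z, j, p, fac, hj, hp⟩ := hfac f
    have := hf p (hJF ▸ hp)
    exact MorphismProperty.of_retract (RetractArrow.ofLeftLiftingProperty fac) hj
  have hJI : J.rlp.llp ≤ I.rlp.llp := by
    refine MorphismProperty.antitone_llp ?_
    rw [hIW, hJF]
    exact inf_le_left
  have := hI.hasSmallObjectArgument
  have := hJ.hasSmallObjectArgument
  let : CategoryWithFibrations C := ⟨Fib⟩
  let : CategoryWithCofibrations C := ⟨I.rlp.llp⟩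
  let : CategoryWithWeakEquivalences C := ⟨W⟩
  have hF : fibrations C = Fib := rfl
  have hw : weakEquivalences C = W := rfl
  have hC : cofibrations C = I.rlp.llp := rfl
  have hTF : trivialFibrations C = I.rlp := hIW.symm
  have : (weakEquivalences C).HasTwoOutOfThreeProperty := inferInstanceAs W.HasTwoOutOfThreeProperty
  have : MorphismProperty.IsWeakFactorizationSystem (cofibrations C) (trivialFibrations C) := by
    rw [hC, hTF]
    exact ⟨MorphismProperty.rlp_llp_rlp _, rfl, inferInstance⟩
  have hTC : trivialCofibrations C = J.rlp.llp := by
    refine le_antisymm ?_ fun _ _ f hf => ⟨hJI _ hf, hW _ hf⟩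
    rintro X Y f ⟨hf, hf'⟩
    have h := MorphismProperty.factorizationData J.rlp.llp J.rlp f
    have hp : I.rlp h.p := by
      rw [hIW, ← hJF]
      refine ⟨h.hp, W.of_precomp h.i h.p (hW _ h.hi) ?_⟩
      rw [h.fac]
      exact hf'
    have := hf _ hp
    exact MorphismProperty.of_retract (RetractArrow.ofLeftLiftingProperty h.fac) h.hi
  have : MorphismProperty.IsWeakFactorizationSystem (trivialCofibrations C) (fibrations C) := by
    rw [hTC, hF, ← hJF]
    exact ⟨MorphismProperty.rlp_llp_rlp _, rfl, inferInstance⟩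
  let M : ModelCategory C := ModelCategory.mk' C
  exact ⟨M, ⟨inferInstance, inferInstance, I, J, hI, hJ, hTF, hJF.symm⟩, rfl, rfl⟩

end ModelStructures

/-! ### Elements of bigraded complexes -/

namespace RBC

variable {R : Type u} [CommRing R] {k : ℕ}

/-- The bidegree of the differential out of bidegree `i`. -/
abbrev succDeg (k : ℕ) (i : ℤ × ℤ) : ℤ × ℤ := i + (-(k : ℤ), 1 - (k : ℤ))

/-- The source bidegree of the differential into bidegree `i`. -/
abbrev predDeg (k : ℕ) (i : ℤ × ℤ) : ℤ × ℤ := i - (-(k : ℤ), 1 - (k : ℤ))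

lemma rel_iff {i j : ℤ × ℤ} :
    (pageShape k).Rel i j ↔ j.1 = i.1 - k ∧ j.2 = i.2 + 1 - k := by
  obtain ⟨i₁, i₂⟩ := i
  obtain ⟨j₁, j₂⟩ := j
  simp only [ComplexShape.up'_Rel, Prod.mk_add_mk, Prod.mk.injEq]
  omega

lemma rel_succDeg (i : ℤ × ℤ) : (pageShape k).Rel i (succDeg k i) := rfl

lemma predDeg_rel (i : ℤ × ℤ) : (pageShape k).Rel (predDeg k i) i := by
  simp [ComplexShape.up'_Rel]

lemma rel_ne {i j : ℤ × ℤ} (h : (pageShape k).Rel i j) : i ≠ j := by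
  rintro rfl
  rw [rel_iff] at h
  omega

@[simp]
lemma d_d_apply (A : RBC R k) (i j l : ℤ × ℤ) (x : A.X i) : A.d j l (A.d i j x) = 0 := by
  rw [← ConcreteCategory.comp_apply, HomologicalComplex.d_comp_d]
  rfl

lemma d_apply_of_not_rel (A : RBC R k) {i j : ℤ × ℤ} (h : ¬ (pageShape k).Rel i j) (x : A.X i) :
    A.d i j x = 0 := by
  rw [A.shape _ _ h]
  rfl

lemma comm_apply {A B : RBC R k} (f : A ⟶ B) (i j : ℤ × ℤ) (x : A.X i) :
    f.f j (A.d i j x) = B.d i j (f.f i x) := by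
  rw [← ConcreteCategory.comp_apply, ← ConcreteCategory.comp_apply, f.comm]

lemma hom_ext_apply {A B : RBC R k} {f g : A ⟶ B} (h : ∀ i x, f.f i x = g.f i x) : f = g :=
  HomologicalComplex.hom_ext _ _ fun i => ConcreteCategory.hom_ext _ _ (h i)

lemma comp_f_apply {A B D : RBC R k} (f : A ⟶ B) (g : B ⟶ D) (i : ℤ × ℤ) (x : A.X i) :
    (f ≫ g).f i x = g.f i (f.f i x) := rfl

/-- `x` is killed by the differential. -/
def IsCycle (A : RBC R k) (i : ℤ × ℤ) (x : A.X i) : Prop := ∀ j, A.d i j x = 0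

/-- `x` is in the image of the differential. -/
def IsBdry (A : RBC R k) (i : ℤ × ℤ) (x : A.X i) : Prop := ∃ j y, A.d j i y = x

variable {A B : RBC R k} {i j : ℤ × ℤ}

lemma isCycle_of_rel (h : (pageShape k).Rel i j) {x : A.X i} (hx : A.d i j x = 0) :
    A.IsCycle i x := by
  intro l
  by_cases hl : (pageShape k).Rel i l
  · obtain rfl := (pageShape k).next_eq h hl
    exact hx
  · exact A.d_apply_of_not_rel hl x

lemma IsBdry.exists_of_rel {x : A.X i} (hx : A.IsBdry i x) (h : (pageShape k).Rel j i) :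
    ∃ y, A.d j i y = x := by
  obtain ⟨l, y, rfl⟩ := hx
  by_cases hl : (pageShape k).Rel l i
  · obtain rfl := (pageShape k).prev_eq h hl
    exact ⟨y, rfl⟩
  · exact ⟨0, by rw [map_zero, A.d_apply_of_not_rel hl]⟩

lemma isBdry_d (y : A.X j) : A.IsBdry i (A.d j i y) := ⟨j, y, rfl⟩

lemma isBdry_zero : A.IsBdry i 0 := ⟨i, 0, map_zero _⟩

lemma IsBdry.isCycle {x : A.X i} (hx : A.IsBdry i x) : A.IsCycle i x := by
  obtain ⟨_, y, rfl⟩ := hx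
  exact fun l => A.d_d_apply _ _ _ y

lemma IsCycle.sub {x y : A.X i} (hx : A.IsCycle i x) (hy : A.IsCycle i y) :
    A.IsCycle i (x - y) := fun j => by rw [map_sub, hx, hy, sub_zero]

lemma IsCycle.map {x : A.X i} (hx : A.IsCycle i x) (f : A ⟶ B) : B.IsCycle i (f.f i x) :=
  fun j => by rw [← comm_apply, hx, map_zero]

lemma IsBdry.map {x : A.X i} (hx : A.IsBdry i x) (f : A ⟶ B) : B.IsBdry i (f.f i x) := by
  obtain ⟨j, y, rfl⟩ := hx
  exact ⟨j, f.f j y, (comm_apply f j i y).symm⟩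

lemma iCycles_injective (A : RBC R k) (i : ℤ × ℤ) : Function.Injective (A.iCycles i) :=
  (ModuleCat.mono_iff_injective _).1 inferInstance

lemma homologyπ_surjective (A : RBC R k) (i : ℤ × ℤ) : Function.Surjective (A.homologyπ i) :=
  (ModuleCat.epi_iff_surjective _).1 inferInstance

lemma isCycle_iCycles (z : A.cycles i) : A.IsCycle i (A.iCycles i z) := fun j => by
  rw [← ConcreteCategory.comp_apply, HomologicalComplex.iCycles_d]
  rfl

lemma IsCycle.exists_cycles {x : A.X i} (hx : A.IsCycle i x) :
    ∃ z : A.cycles i, A.iCycles i z = x := by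
  refine ⟨A.liftCycles (ModuleCat.ofHom (LinearMap.toSpanSingleton R _ x)) _ rfl ?_ (1 : R), ?_⟩
  · refine ModuleCat.hom_ext (LinearMap.ext_ring ?_)
    change A.d i _ ((1 : R) • x) = 0
    rw [one_smul, hx]
  · rw [← ConcreteCategory.comp_apply, HomologicalComplex.liftCycles_i]
    exact one_smul _ _

/-- The homology class of a cycle. -/
noncomputable def cls (x : A.X i) (hx : A.IsCycle i x) : A.homology i :=
  A.homologyπ i hx.exists_cycles.choose

lemma homologyπ_eq_cls (z : A.cycles i) :
    A.homologyπ i z = cls (A.iCycles i z) (isCycle_iCycles z) := by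
  rw [cls]
  congr 1
  exact (A.iCycles_injective i (isCycle_iCycles z).exists_cycles.choose_spec).symm

lemma exists_cls (h : A.homology i) : ∃ (x : A.X i) (hx : A.IsCycle i x), cls x hx = h := by
  obtain ⟨z, rfl⟩ := A.homologyπ_surjective i h
  exact ⟨_, _, (homologyπ_eq_cls z).symm⟩

lemma homologyπ_eq_zero_iff (z : A.cycles i) : A.homologyπ i z = 0 ↔ A.IsBdry i (A.iCycles i z) := by
  have hprev := (pageShape k).prev_eq' (predDeg_rel (k := k) i)
  constructor
  · intro h
    have hex : (ShortComplex.mk (A.toCycles (predDeg k i) i) (A.homologyπ i)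
        (by simp)).Exact :=
      ShortComplex.exact_of_g_is_cokernel _ (A.homologyIsCokernel _ _ hprev)
    obtain ⟨y, hy⟩ := (ShortComplex.moduleCat_exact_iff _).1 hex z h
    refine ⟨_, y, ?_⟩
    rw [← hy]
    change _ = A.iCycles i (A.toCycles _ i y)
    rw [← ConcreteCategory.comp_apply, HomologicalComplex.toCycles_i]
  · rintro ⟨j, y, hy⟩
    have : A.toCycles j i y = z := A.iCycles_injective i (by
      rw [← ConcreteCategory.comp_apply, HomologicalComplex.toCycles_i, hy])
    rw [← this, ← ConcreteCategory.comp_apply, HomologicalComplex.toCycles_comp_homologyπ]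
    rfl

lemma cls_eq_iff {x y : A.X i} (hx : A.IsCycle i x) (hy : A.IsCycle i y) :
    cls x hx = cls y hy ↔ A.IsBdry i (x - y) := by
  rw [cls, cls, ← sub_eq_zero, ← map_sub, homologyπ_eq_zero_iff, map_sub,
    hx.exists_cycles.choose_spec, hy.exists_cycles.choose_spec]

lemma cls_eq_zero_iff {x : A.X i} (hx : A.IsCycle i x) : cls x hx = 0 ↔ A.IsBdry i x := by
  rw [cls, homologyπ_eq_zero_iff, hx.exists_cycles.choose_spec]

lemma homologyMap_cls (f : A ⟶ B) (x : A.X i) (hx : A.IsCycle i x) :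
    HomologicalComplex.homologyMap f i (cls x hx) = cls (f.f i x) (hx.map f) := by
  rw [cls, ← ConcreteCategory.comp_apply, HomologicalComplex.homologyπ_naturality,
    ConcreteCategory.comp_apply, homologyπ_eq_cls]
  congr 1
  rw [← ConcreteCategory.comp_apply, HomologicalComplex.cyclesMap_i, ConcreteCategory.comp_apply,
    hx.exists_cycles.choose_spec]

/-- A quasi-isomorphism in terms of elements. -/
lemma weq_iff (f : A ⟶ B) : RBC.weq R k f ↔
    (∀ i b, B.IsCycle i b → ∃ a, A.IsCycle i a ∧ B.IsBdry i (f.f i a - b)) ∧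
      ∀ i a, A.IsCycle i a → B.IsBdry i (f.f i a) → A.IsBdry i a := by
  change QuasiIso f ↔ _
  simp only [quasiIso_iff, quasiIsoAt_iff_isIso_homologyMap]
  rw [← forall_and]
  refine forall_congr' fun i => ?_
  rw [ConcreteCategory.isIso_iff_bijective, and_comm]
  refine and_congr ?_ ?_
  · rw [injective_iff_map_eq_zero]
    constructor
    · intro h a ha hb
      rw [← cls_eq_zero_iff ha]
      apply h
      rwa [homologyMap_cls, cls_eq_zero_iff]
    · intro h a ha
      obtain ⟨x, hx, rfl⟩ := exists_cls a
      rw [homologyMap_cls, cls_eq_zero_iff] at ha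
      rw [cls_eq_zero_iff]
      exact h x hx ha
  · constructor
    · intro h b hb
      obtain ⟨a, ha⟩ := h (cls b hb)
      obtain ⟨x, hx, rfl⟩ := exists_cls a
      rw [homologyMap_cls, cls_eq_iff] at ha
      exact ⟨x, hx, ha⟩
    · intro h b
      obtain ⟨y, hy, rfl⟩ := exists_cls b
      obtain ⟨a, ha, hab⟩ := h y hy
      exact ⟨cls a ha, by rwa [homologyMap_cls, cls_eq_iff]⟩

lemma weq_of_isIso (f : A ⟶ B) [IsIso f] : RBC.weq R k f :=
  inferInstanceAs (QuasiIso f)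

/-- A surjection is a quasi-isomorphism if and only if cycles of the source can be completed to
preimages of chains in the target. -/
lemma weq_iff_of_surj {f : A ⟶ B} (hf : RBC.Surj f) : RBC.weq R k f ↔
    ∀ i j (_ : (pageShape k).Rel i j) (x : A.X j) (y : B.X i), A.IsCycle j x →
      B.d i j y = f.f j x → ∃ x', A.d i j x' = x ∧ f.f i x' = y := by
  rw [weq_iff]
  constructor
  · rintro ⟨h₁, h₂⟩ i j hij x y hx hy
    obtain ⟨x', rfl⟩ := (h₂ j x hx ⟨i, y, hy⟩).exists_of_rel hij
    have hc : B.IsCycle i (y - f.f i x') :=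
      isCycle_of_rel hij (by rw [map_sub, hy, comm_apply, sub_self])
    obtain ⟨a, ha, hb⟩ := h₁ i _ hc
    obtain ⟨c, hc⟩ := hb.exists_of_rel (predDeg_rel i)
    obtain ⟨c, rfl⟩ := hf _ c
    refine ⟨x' + a - A.d _ i c, ?_, ?_⟩
    · rw [map_sub, map_add, ha j, d_d_apply, add_zero, sub_zero]
    · rw [map_sub, map_add, comm_apply, hc]
      abel
  · intro h
    constructor
    · intro i b hb
      obtain ⟨a, ha, rfl⟩ := h i _ (rel_succDeg i) 0 b (fun _ => map_zero _) (by rw [hb, map_zero])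
      refine ⟨a, isCycle_of_rel (rel_succDeg i) ha, ?_⟩
      rw [sub_self]
      exact isBdry_zero
    · intro j x hx hb
      obtain ⟨y, hy⟩ := hb.exists_of_rel (predDeg_rel j)
      obtain ⟨x', hx', -⟩ := h _ j (predDeg_rel j) x y hx hy
      exact ⟨_, x', hx'⟩

end RBC

/-! ### Disks, spheres and transferred model structures -/

namespace RBC

open scoped ZeroObject

variable {R : Type u} [CommRing R] {k : ℕ}

instance : (RBC.weq R k).HasTwoOutOfThreeProperty :=
  inferInstanceAs (HomologicalComplex.quasiIso _ _).HasTwoOutOfThreeProperty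

instance : (RBC.weq R k).IsStableUnderRetracts :=
  inferInstanceAs (HomologicalComplex.quasiIso _ _).IsStableUnderRetracts

variable (R) in
/-- The complex `R = R` concentrated in bidegree `i` and the next one. -/
noncomputable def disk (k : ℕ) (i : ℤ × ℤ) : RBC R k :=
  HomologicalComplex.double (𝟙 (ModuleCat.of R R)) (rel_succDeg (k := k) i)

variable (R) in
/-- The generator of `disk R k i`. -/
noncomputable def diskGen (k : ℕ) (i : ℤ × ℤ) : (disk R k i).X i :=
  (HomologicalComplex.doubleXIso₀ (𝟙 (ModuleCat.of R R)) (rel_succDeg (k := k) i)).inv (1 : R)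

/-- Maps out of a disk correspond to elements. -/
lemma disk_hom_ext {A : RBC R k} {i : ℤ × ℤ} {f g : disk R k i ⟶ A}
    (h : f.f i (diskGen R k i) = g.f i (diskGen R k i)) : f = g := by
  refine (HomologicalComplex.evalCompCoyonedaCorepresentableByDoubleId
    (rel_succDeg (k := k) i) (rel_ne (rel_succDeg i)) (ModuleCat.of R R)).homEquiv.injective ?_
  exact ModuleCat.hom_ext (LinearMap.ext_ring h)

lemma exists_disk_hom (A : RBC R k) {i : ℤ × ℤ} (x : A.X i) :
    ∃ f : disk R k i ⟶ A, f.f i (diskGen R k i) = x := by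
  let e := (HomologicalComplex.evalCompCoyonedaCorepresentableByDoubleId
    (rel_succDeg (k := k) i) (rel_ne (rel_succDeg i)) (ModuleCat.of R R)).homEquiv (Y := A)
  refine ⟨e.symm (ModuleCat.ofHom (LinearMap.toSpanSingleton R _ x)), ?_⟩
  have := ConcreteCategory.congr_hom (e.apply_symm_apply
    (ModuleCat.ofHom (LinearMap.toSpanSingleton R _ x))) (1 : R)
  refine Eq.trans this ?_
  exact one_smul _ _

variable (R) in
/-- The complex `R` concentrated in bidegree `i`. -/
noncomputable def sphere (k : ℕ) (i : ℤ × ℤ) : RBC R k :=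
  (HomologicalComplex.single _ (pageShape k) i).obj (ModuleCat.of R R)

variable (R) in
/-- The generator of `sphere R k i`. -/
noncomputable def sphereGen (k : ℕ) (i : ℤ × ℤ) : (sphere R k i).X i :=
  (HomologicalComplex.singleObjXSelf (pageShape k) i (ModuleCat.of R R)).inv (1 : R)

lemma isCycle_sphereGen (i : ℤ × ℤ) : (sphere R k i).IsCycle i (sphereGen R k i) :=
  fun _ => rfl

/-- Maps out of a sphere correspond to cycles. -/
lemma sphere_hom_ext {A : RBC R k} {i : ℤ × ℤ} {f g : sphere R k i ⟶ A}
    (h : f.f i (sphereGen R k i) = g.f i (sphereGen R k i)) : f = g := by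
  refine HomologicalComplex.from_single_hom_ext ?_
  rw [← cancel_epi (HomologicalComplex.singleObjXSelf (pageShape k) i (ModuleCat.of R R)).inv]
  exact ModuleCat.hom_ext (LinearMap.ext_ring h)

lemma exists_sphere_hom {A : RBC R k} {i : ℤ × ℤ} {x : A.X i} (hx : A.IsCycle i x) :
    ∃ f : sphere R k i ⟶ A, f.f i (sphereGen R k i) = x := by
  refine ⟨HomologicalComplex.mkHomFromSingle (ModuleCat.ofHom (LinearMap.toSpanSingleton R _ x))
    fun j _ => ?_, ?_⟩
  · refine ModuleCat.hom_ext (LinearMap.ext_ring ?_)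
    change A.d i j ((1 : R) • x) = 0
    rw [one_smul, hx]
  · rw [HomologicalComplex.mkHomFromSingle_f]
    exact (ConcreteCategory.congr_hom (Iso.inv_hom_id_assoc
      (HomologicalComplex.singleObjXSelf (pageShape k) i (ModuleCat.of R R))
      (ModuleCat.ofHom (LinearMap.toSpanSingleton R _ x))) (1 : R)).trans (one_smul _ _)

/-- The inclusion of the boundary of a disk. -/
noncomputable def sphereToDisk (R : Type u) [CommRing R] (k : ℕ) (i : ℤ × ℤ) :
    sphere R k (succDeg k i) ⟶ disk R k i :=
  (exists_sphere_hom (isBdry_d (A := disk R k i) (i := succDeg k i) (diskGen R k i)).isCycle).choose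

lemma sphereToDisk_gen (i : ℤ × ℤ) :
    (sphereToDisk R k i).f _ (sphereGen R k (succDeg k i)) =
      (disk R k i).d i _ (diskGen R k i) :=
  (exists_sphere_hom
    (isBdry_d (A := disk R k i) (i := succDeg k i) (diskGen R k i)).isCycle).choose_spec

lemma hasLiftingProperty_zero_disk_iff {A B : RBC R k} (f : A ⟶ B) (i : ℤ × ℤ) :
    HasLiftingProperty (0 : (0 : RBC R k) ⟶ disk R k i) f ↔ Function.Surjective (f.f i) := by
  constructor
  · intro h y
    obtain ⟨g, rfl⟩ := exists_disk_hom B y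
    have sq : CommSq (0 : 0 ⟶ A) (0 : 0 ⟶ disk R k i) f g := ⟨by simp⟩
    refine ⟨sq.lift.f i (diskGen R k i), ?_⟩
    rw [← comp_f_apply, sq.fac_right]
  · intro h
    refine ⟨fun {a g} sq => ?_⟩
    obtain ⟨x, hx⟩ := h (g.f i (diskGen R k i))
    obtain ⟨l, rfl⟩ := exists_disk_hom A x
    exact ⟨⟨l, (isZero_zero _).eq_of_src _ _, disk_hom_ext (by rw [comp_f_apply, hx])⟩⟩

lemma hasLiftingProperty_sphereToDisk_iff {A B : RBC R k} (f : A ⟶ B) (i : ℤ × ℤ) :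
    HasLiftingProperty (sphereToDisk R k i) f ↔
      ∀ (x : A.X (succDeg k i)) (y : B.X i), A.IsCycle _ x →
        B.d i _ y = f.f _ x → ∃ x', A.d i _ x' = x ∧ f.f i x' = y := by
  constructor
  · intro h x y hx hy
    obtain ⟨a, rfl⟩ := exists_sphere_hom hx
    obtain ⟨b, rfl⟩ := exists_disk_hom B y
    have sq : CommSq a (sphereToDisk R k i) f b := ⟨sphere_hom_ext (by
      rw [comp_f_apply, comp_f_apply, sphereToDisk_gen, comm_apply, hy])⟩
    refine ⟨sq.lift.f i (diskGen R k i), ?_, ?_⟩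
    · rw [← comm_apply, ← sphereToDisk_gen, ← comp_f_apply, sq.fac_left]
    · rw [← comp_f_apply, sq.fac_right]
  · intro h
    refine ⟨fun {a b} sq => ?_⟩
    have hw := ConcreteCategory.congr_hom (HomologicalComplex.congr_hom sq.w _)
      (sphereGen R k (succDeg k i))
    rw [comp_f_apply, comp_f_apply, sphereToDisk_gen, comm_apply] at hw
    obtain ⟨x', hx, hx'⟩ := h (a.f _ (sphereGen R k _)) (b.f _ (diskGen R k _))
      ((isCycle_sphereGen _).map a) hw.symm
    obtain ⟨l, rfl⟩ := exists_disk_hom A x'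
    refine ⟨⟨l, sphere_hom_ext ?_, disk_hom_ext hx'⟩⟩
    rw [comp_f_apply, sphereToDisk_gen, comm_apply, hx]

end RBC

section Transfer

open scoped ZeroObject

variable {R : Type u} [CommRing R] {C : Type u'} [Category.{u} C]

/-- If the cycles on a page depend on an object of `C` in a way which commutes with filtered
colimits, then so does the set of morphisms from the free object on a sphere. -/
lemma preservesColimitsOfShape_of_cycles {k : ℕ} (V : C ⥤ RBC R k) (F : RBC R k ⥤ C)
    (adj : F ⊣ V) (J : Type u) [SmallCategory J] [IsFiltered J]
    (hsurj : ∀ (G : J ⥤ C) (c : Cocone G), IsColimit c → ∀ i (x : (V.obj c.pt).X i),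
      (V.obj c.pt).IsCycle i x → ∃ j y, (V.obj (G.obj j)).IsCycle i y ∧
        (V.map (c.ι.app j)).f i y = x)
    (hinj : ∀ (G : J ⥤ C) (c : Cocone G), IsColimit c → ∀ i j (x y : (V.obj (G.obj j)).X i),
      (V.map (c.ι.app j)).f i x = (V.map (c.ι.app j)).f i y →
        ∃ j' f, (V.map (G.map (f : j ⟶ j'))).f i x = (V.map (G.map f)).f i y) (i : ℤ × ℤ) :
    PreservesColimitsOfShape J (coyoneda.obj (Opposite.op (F.obj (RBC.sphere R k i)))) where
  preservesColimit {G} := ⟨fun {c} hc => by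
    refine ⟨Types.FilteredColimit.isColimitOf' _ _ ?_ ?_⟩
    · intro (x : F.obj (RBC.sphere R k i) ⟶ c.pt)
      obtain ⟨j, y, hy, hxy⟩ := hsurj G c hc i
        ((adj.homEquiv _ _ x).f i (RBC.sphereGen R k i)) ((RBC.isCycle_sphereGen i).map _)
      obtain ⟨g, rfl⟩ := RBC.exists_sphere_hom hy
      refine ⟨j, (adj.homEquiv _ _).symm g, ?_⟩
      change x = (adj.homEquiv _ _).symm g ≫ c.ι.app j
      rw [← adj.homEquiv_naturality_right_symm, Equiv.eq_symm_apply]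
      exact RBC.sphere_hom_ext hxy.symm
    · intro j (x : F.obj (RBC.sphere R k i) ⟶ G.obj j) (y : F.obj (RBC.sphere R k i) ⟶ G.obj j)
        (hxy : x ≫ c.ι.app j = y ≫ c.ι.app j)
      obtain ⟨j', f, hf⟩ := hinj G c hc i j
        ((adj.homEquiv _ _ x).f i (RBC.sphereGen R k i))
        ((adj.homEquiv _ _ y).f i (RBC.sphereGen R k i)) (by
          rw [← RBC.comp_f_apply, ← RBC.comp_f_apply, ← adj.homEquiv_naturality_right,
            ← adj.homEquiv_naturality_right, hxy])
      refine ⟨j', f, ?_⟩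
      change x ≫ G.map f = y ≫ G.map f
      apply (adj.homEquiv _ _).injective
      rw [adj.homEquiv_naturality_right, adj.homEquiv_naturality_right]
      exact RBC.sphere_hom_ext hf⟩

/-- Morphisms out of an initial object commute with nonempty colimits. -/
lemma preservesColimitsOfShape_of_isInitial {A : C} (hA : IsInitial A) (J : Type u)
    [SmallCategory J] [IsFiltered J] :
    PreservesColimitsOfShape J (coyoneda.obj (Opposite.op A)) where
  preservesColimit {G} := ⟨fun {c} _ => by
    refine ⟨Types.FilteredColimit.isColimitOf' _ _ ?_ ?_⟩
    · intro (x : A ⟶ c.pt)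
      obtain ⟨j⟩ := IsFiltered.nonempty (C := J)
      exact ⟨j, hA.to _, hA.hom_ext _ _⟩
    · intro j x y _
      exact ⟨j, 𝟙 j, hA.hom_ext (Y := G.obj j) _ _⟩⟩

/-- Let `V a` be a family of right adjoint functors from `C` to categories of bigraded complexes,
and `a₀` an index. Assume that the cycles of `V a₀` commute with filtered colimits, and that every
map factors as a map which `V a₀` sends to a quasi-isomorphism followed by a map which all `V a`
send to surjections. Then these two classes are the weak equivalences and the fibrations of a
cofibrantly generated model structure. -/
theorem exists_modelCategory_of_adjunctions [HasLimits C] [HasColimits C] {ι : Type}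
    (deg : ι → ℕ) (V : ∀ a, C ⥤ RBC R (deg a)) (F : ∀ a, RBC R (deg a) ⥤ C)
    (adj : ∀ a, F a ⊣ V a) (a₀ : ι)
    (hsurj : ∀ (J : Type u) [SmallCategory J] [IsFiltered J] (G : J ⥤ C) (c : Cocone G),
      IsColimit c → ∀ i (x : ((V a₀).obj c.pt).X i),
      ((V a₀).obj c.pt).IsCycle i x → ∃ j y, ((V a₀).obj (G.obj j)).IsCycle i y ∧
        ((V a₀).map (c.ι.app j)).f i y = x)
    (hinj : ∀ (J : Type u) [SmallCategory J] [IsFiltered J] (G : J ⥤ C) (c : Cocone G),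
      IsColimit c → ∀ i j (x y : ((V a₀).obj (G.obj j)).X i),
      ((V a₀).map (c.ι.app j)).f i x = ((V a₀).map (c.ι.app j)).f i y →
        ∃ j' f, ((V a₀).map (G.map (f : j ⟶ j'))).f i x = ((V a₀).map (G.map f)).f i y)
    (hfac : ∀ ⦃X Y : C⦄ (f : X ⟶ Y), ∃ (Z : C) (j : X ⟶ Z) (p : Z ⟶ Y), j ≫ p = f ∧
      RBC.weq R _ ((V a₀).map j) ∧ ∀ a, RBC.Surj ((V a).map p)) :
    ∃ _ : ModelCategory C, IsCofibrantlyGenerated C ∧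
      fibrations C = (fun _ _ f => ∀ a, RBC.Surj ((V a).map f)) ∧
      weakEquivalences C = fun _ _ f => RBC.weq R _ ((V a₀).map f) := by
  let J : MorphismProperty C := MorphismProperty.ofHoms fun x : ι × (ℤ × ℤ) =>
    (F x.1).map (0 : (0 : RBC R (deg x.1)) ⟶ RBC.disk R _ x.2)
  let K : MorphismProperty C := MorphismProperty.ofHoms fun i : ℤ × ℤ =>
    (F a₀).map (RBC.sphereToDisk R (deg a₀) i)
  have : MorphismProperty.IsSmall.{u} J := MorphismProperty.isSmall_ofHoms _
  have : MorphismProperty.IsSmall.{u} K := MorphismProperty.isSmall_ofHoms _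
  let I : MorphismProperty C := ⨆ b : Bool, if b then J else K
  have : MorphismProperty.IsSmall.{u} I := by
    have : ∀ b : Bool, MorphismProperty.IsSmall.{u} (if b then J else K) := by
      rintro (_ | _) <;> assumption
    infer_instance
  let Fib : MorphismProperty C := fun _ _ f => ∀ a, RBC.Surj ((V a).map f)
  have hJF : J.rlp = Fib := by
    ext X Y f
    constructor
    · intro h a i
      rw [← RBC.hasLiftingProperty_zero_disk_iff, ← (adj a).hasLiftingProperty_iff]
      exact h _ ⟨(a, i)⟩
    · rintro h _ _ _ ⟨a, i⟩
      rw [(adj a).hasLiftingProperty_iff, RBC.hasLiftingProperty_zero_disk_iff]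
      exact h a i
  have hJ : ∀ ⦃A B : C⦄ (i : A ⟶ B), J i → ∀ (S : Type u) [SmallCategory S] [IsFiltered S],
      PreservesColimitsOfShape S (coyoneda.obj (Opposite.op A)) := by
    rintro _ _ _ ⟨a, i⟩ S _ _
    have := (adj a).leftAdjoint_preservesColimits
    exact preservesColimitsOfShape_of_isInitial
      (IsInitial.isInitialObj (F a) _ (isZero_zero _).isInitial) S
  have hK : ∀ ⦃A B : C⦄ (i : A ⟶ B), K i → ∀ (S : Type u) [SmallCategory S] [IsFiltered S],
      PreservesColimitsOfShape S (coyoneda.obj (Opposite.op A)) := by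
    rintro _ _ _ ⟨i⟩ S _ _
    exact preservesColimitsOfShape_of_cycles (V a₀) (F a₀) (adj a₀) S (hsurj S) (hinj S) _
  refine exists_modelCategory ((RBC.weq R (deg a₀)).inverseImage (V a₀)) Fib I J
    (permitsSmallObjectArgument_of_preservesColimits I ?_)
    (permitsSmallObjectArgument_of_preservesColimits J hJ) ?_ hJF hfac
  · intro A B i hi
    simp only [I, MorphismProperty.iSup_iff] at hi
    obtain ⟨_ | _, hi⟩ := hi
    · exact hK i hi
    · exact hJ i hi
  · ext X Y f
    have hrlp : I.rlp f ↔ J.rlp f ∧ K.rlp f := by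
      constructor
      · intro h
        refine ⟨fun _ _ i hi => h i ?_, fun _ _ i hi => h i ?_⟩
        · simp only [I, MorphismProperty.iSup_iff]
          exact ⟨true, hi⟩
        · simp only [I, MorphismProperty.iSup_iff]
          exact ⟨false, hi⟩
      · rintro ⟨h₁, h₂⟩ _ _ i hi
        simp only [I, MorphismProperty.iSup_iff] at hi
        obtain ⟨_ | _, hi⟩ := hi
        · exact h₂ i hi
        · exact h₁ i hi
    rw [hrlp, hJF]
    refine and_congr_right fun hf => ?_
    change _ ↔ RBC.weq R (deg a₀) ((V a₀).map f)
    rw [RBC.weq_iff_of_surj (hf a₀)]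
    constructor
    · intro h i j hij x y hx hy
      obtain rfl : RBC.succDeg (deg a₀) i = j := hij
      have := h _ ⟨i⟩
      rw [(adj a₀).hasLiftingProperty_iff, RBC.hasLiftingProperty_sphereToDisk_iff] at this
      exact this x y hx hy
    · rintro h _ _ _ ⟨i⟩
      rw [(adj a₀).hasLiftingProperty_iff, RBC.hasLiftingProperty_sphereToDisk_iff]
      exact h i _ (RBC.rel_succDeg i)

end Transfer

/-! ### Limits and colimits of linear witness books -/

namespace RBC

variable {R : Type u} [CommRing R] {k : ℕ} {J : Type u} [SmallCategory J]

lemma exists_rep [IsFiltered J] {G : J ⥤ RBC R k} {c : Cocone G} (hc : IsColimit c)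
    {i : ℤ × ℤ} (x : c.pt.X i) : ∃ j y, (c.ι.app j).f i y = x :=
  Types.jointly_surjective_of_isColimit (isColimitOfPreserves
    (HomologicalComplex.eval (ModuleCat.{u} R) (pageShape k) i ⋙ forget (ModuleCat.{u} R)) hc) x

lemma exists_map_eq [IsFiltered J] {G : J ⥤ RBC R k} {c : Cocone G} (hc : IsColimit c)
    {i : ℤ × ℤ} {j : J} {x y : (G.obj j).X i} (h : (c.ι.app j).f i x = (c.ι.app j).f i y) :
    ∃ (j' : J) (f : j ⟶ j'), (G.map f).f i x = (G.map f).f i y :=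
  (Types.FilteredColimit.isColimit_eq_iff' (isColimitOfPreserves
    (HomologicalComplex.eval (ModuleCat.{u} R) (pageShape k) i ⋙ forget (ModuleCat.{u} R)) hc)
    x y).1 h

lemma exists_rep_of_isCycle [IsFiltered J] {G : J ⥤ RBC R k} {c : Cocone G} (hc : IsColimit c)
    {i : ℤ × ℤ} {x : c.pt.X i} (hx : c.pt.IsCycle i x) :
    ∃ j y, (G.obj j).IsCycle i y ∧ (c.ι.app j).f i y = x := by
  obtain ⟨j, y, rfl⟩ := exists_rep hc x
  obtain ⟨j', f, hf⟩ := exists_map_eq hc (x := (G.obj j).d i (succDeg k i) y) (y := 0) (by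
    rw [comm_apply, map_zero]
    exact hx _)
  refine ⟨j', (G.map f).f i y, isCycle_of_rel (rel_succDeg i) ?_, ?_⟩
  · rw [← comm_apply, hf, map_zero]
  · rw [← comp_f_apply, c.w]

variable {F : J ⥤ RBC R k}

/-- A limit cone of bigraded complexes is a limit cone in each bidegree. -/
noncomputable def isLimitEval {c : Cone F} (hc : IsLimit c) (i : ℤ × ℤ) :
    IsLimit ((HomologicalComplex.eval (ModuleCat.{u} R) (pageShape k) i).mapCone c) :=
  isLimitOfPreserves _ hc

/-- A colimit cocone of bigraded complexes is a colimit cocone in each bidegree. -/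
noncomputable def isColimitEval {c : Cocone F} (hc : IsColimit c) (i : ℤ × ℤ) :
    IsColimit ((HomologicalComplex.eval (ModuleCat.{u} R) (pageShape k) i).mapCocone c) :=
  isColimitOfPreserves _ hc

end RBC

namespace LWB

variable {R : Type u} [CommRing R]

lemma hom_ext_apply {K L : LWB R} {f g : K ⟶ L}
    (h : ∀ k i x, (Hom.page f k).f i x = (Hom.page g k).f i x) : f = g :=
  Hom.ext (funext fun k => RBC.hom_ext_apply (h k))

variable (R) in
/-- The witness maps, as natural transformations. -/
def wNatTrans (k : ℕ) (i : ℤ × ℤ) :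
    pageFunctor R (k + 1) ⋙ HomologicalComplex.eval (ModuleCat.{u} R) (pageShape (k + 1)) i ⟶
      pageFunctor R k ⋙ HomologicalComplex.eval (ModuleCat.{u} R) (pageShape k) i where
  app L := L.w k i
  naturality _ _ f := (Hom.comm_w f k i).symm

variable (R) in
/-- The degeneracy maps, as natural transformations. -/
def sNatTrans (k : ℕ) (i : ℤ × ℤ) :
    pageFunctor R k ⋙ HomologicalComplex.eval (ModuleCat.{u} R) (pageShape k) i ⟶
      pageFunctor R (k + 1) ⋙
        HomologicalComplex.eval (ModuleCat.{u} R) (pageShape (k + 1)) (i + (1, 1)) where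
  app L := L.s k i
  naturality _ _ f := (Hom.comm_s f k i).symm

section Limits

variable {J : Type u} [SmallCategory J] (F : J ⥤ LWB R)

/-- The pages of a limit of linear witness books. -/
noncomputable def limitPage (k : ℕ) : RBC R k := limit (F ⋙ pageFunctor R k)

/-- The projections from the pages of a limit of linear witness books. -/
noncomputable def limitPageπ (k : ℕ) (j : J) : limitPage F k ⟶ (F.obj j).page k :=
  limit.π (F ⋙ pageFunctor R k) j

/-- The pages of the map to a limit of linear witness books given by a cone. -/
noncomputable def limitPageLift (c : Cone F) (k : ℕ) : c.pt.page k ⟶ limitPage F k :=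
  limit.lift _ ((pageFunctor R k).mapCone c)

lemma limitPageLift_π (c : Cone F) (k : ℕ) (j : J) :
    limitPageLift F c k ≫ limitPageπ F k j = Hom.page (K := c.pt) (L := F.obj j) (c.π.app j) k :=
  limit.lift_π ((pageFunctor R k).mapCone c) j

/-- The witness maps of a limit of linear witness books. -/
noncomputable def limitW (k : ℕ) (i : ℤ × ℤ) :
    (limitPage F (k + 1)).X i ⟶ (limitPage F k).X i :=
  IsLimit.map ((HomologicalComplex.eval (ModuleCat.{u} R) (pageShape (k + 1)) i).mapCone
      (limit.cone (F ⋙ pageFunctor R (k + 1))))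
    (RBC.isLimitEval (limit.isLimit (F ⋙ pageFunctor R k)) i)
    (Functor.whiskerLeft F (wNatTrans R k i))

/-- The degeneracy maps of a limit of linear witness books. -/
noncomputable def limitS (k : ℕ) (i : ℤ × ℤ) :
    (limitPage F k).X i ⟶ (limitPage F (k + 1)).X (i + (1, 1)) :=
  IsLimit.map ((HomologicalComplex.eval (ModuleCat.{u} R) (pageShape k) i).mapCone
      (limit.cone (F ⋙ pageFunctor R k)))
    (RBC.isLimitEval (limit.isLimit (F ⋙ pageFunctor R (k + 1))) (i + (1, 1)))
    (Functor.whiskerLeft F (sNatTrans R k i))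

lemma limitW_π (k : ℕ) (i : ℤ × ℤ) (j : J) :
    limitW F k i ≫ (limitPageπ F k j).f i =
      (limitPageπ F (k + 1) j).f i ≫ (F.obj j).w k i :=
  IsLimit.map_π _ (RBC.isLimitEval (limit.isLimit (F ⋙ pageFunctor R k)) i) _ j

lemma limitS_π (k : ℕ) (i : ℤ × ℤ) (j : J) :
    limitS F k i ≫ (limitPageπ F (k + 1) j).f (i + (1, 1)) =
      (limitPageπ F k j).f i ≫ (F.obj j).s k i :=
  IsLimit.map_π _ (RBC.isLimitEval (limit.isLimit (F ⋙ pageFunctor R (k + 1))) _) _ j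

lemma limit_hom_ext {k : ℕ} {i : ℤ × ℤ} {M : ModuleCat.{u} R}
    {f g : M ⟶ (limitPage F k).X i}
    (h : ∀ j, f ≫ (limitPageπ F k j).f i =
      g ≫ (limitPageπ F k j).f i) : f = g :=
  (RBC.isLimitEval (limit.isLimit (F ⋙ pageFunctor R k)) i).hom_ext h

/-- The limit of a diagram of linear witness books. -/
noncomputable def limitObj : LWB R where
  page := limitPage F
  w := limitW F
  s := limitS F
  s_w k i := limit_hom_ext F fun j => by
    rw [Category.assoc, limitW_π, reassoc_of% limitS_π F, (F.obj j).s_w, comp_zero, zero_comp]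
  w_s k i := limit_hom_ext F fun j => by
    rw [Category.assoc, limitS_π, reassoc_of% limitW_π F, (F.obj j).w_s, comp_zero, zero_comp]
  s_d_w k i i' := limit_hom_ext F fun j => by
    rw [Category.assoc, Category.assoc, limitW_π, ← HomologicalComplex.Hom.comm_assoc,
      reassoc_of% limitS_π F, ← HomologicalComplex.Hom.comm]
    exact congr_arg _ ((F.obj j).s_d_w k i i')

/-- The limit cone of a diagram of linear witness books. -/
noncomputable def limitCone : Cone F where
  pt := limitObj F
  π :=
    { app j :=
        { page := fun k => limitPageπ F k j
          comm_w := fun k i => limitW_π F k i j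
          comm_s := fun k i => limitS_π F k i j }
      naturality := fun j j' f => by
        refine Hom.ext (funext fun k => ?_)
        exact (Category.id_comp _).trans (limit.w (F ⋙ pageFunctor R k) f).symm }

/-- Limits of linear witness books are computed on each page. -/
noncomputable def isLimitLimitCone : IsLimit (limitCone F) where
  lift c :=
    { page := limitPageLift F c
      comm_w := fun k i => limit_hom_ext F fun j => by
        change (_ ≫ (limitPageLift F c k).f i) ≫ _ = (_ ≫ limitW F k i) ≫ _
        rw [Category.assoc, Category.assoc, limitW_π, ← HomologicalComplex.comp_f,
          ← HomologicalComplex.comp_f_assoc, limitPageLift_π, limitPageLift_π]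
        exact Hom.comm_w (c.π.app j) k i
      comm_s := fun k i => limit_hom_ext F fun j => by
        change (_ ≫ (limitPageLift F c (k + 1)).f _) ≫ _ = (_ ≫ limitS F k i) ≫ _
        rw [Category.assoc, Category.assoc, limitS_π, ← HomologicalComplex.comp_f,
          ← HomologicalComplex.comp_f_assoc, limitPageLift_π, limitPageLift_π]
        exact Hom.comm_s (c.π.app j) k i }
  fac c j := Hom.ext (funext fun k => limitPageLift_π F c k j)
  uniq c m hm := Hom.ext (funext fun k => limit.hom_ext fun j => by
    exact (congr_arg (fun f => Hom.page f k) (hm j)).trans (limitPageLift_π F c k j).symm)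

instance : HasLimits (LWB R) where
  has_limits_of_shape _ _ := ⟨fun F => ⟨⟨_, isLimitLimitCone F⟩⟩⟩

/-- The pages of a colimit of linear witness books. -/
noncomputable def colimitPage (k : ℕ) : RBC R k := colimit (F ⋙ pageFunctor R k)

/-- The maps to the pages of a colimit of linear witness books. -/
noncomputable def colimitPageι (k : ℕ) (j : J) : (F.obj j).page k ⟶ colimitPage F k :=
  colimit.ι (F ⋙ pageFunctor R k) j

/-- The pages of the map from a colimit of linear witness books given by a cocone. -/
noncomputable def colimitPageDesc (c : Cocone F) (k : ℕ) : colimitPage F k ⟶ c.pt.page k :=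
  colimit.desc _ ((pageFunctor R k).mapCocone c)

lemma ι_colimitPageDesc (c : Cocone F) (k : ℕ) (j : J) :
    colimitPageι F k j ≫ colimitPageDesc F c k =
      Hom.page (K := F.obj j) (L := c.pt) (c.ι.app j) k :=
  colimit.ι_desc ((pageFunctor R k).mapCocone c) j

/-- The witness maps of a colimit of linear witness books. -/
noncomputable def colimitW (k : ℕ) (i : ℤ × ℤ) :
    (colimitPage F (k + 1)).X i ⟶ (colimitPage F k).X i :=
  IsColimit.map (RBC.isColimitEval (colimit.isColimit (F ⋙ pageFunctor R (k + 1))) i)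
    ((HomologicalComplex.eval (ModuleCat.{u} R) (pageShape k) i).mapCocone
      (colimit.cocone (F ⋙ pageFunctor R k))) (Functor.whiskerLeft F (wNatTrans R k i))

/-- The degeneracy maps of a colimit of linear witness books. -/
noncomputable def colimitS (k : ℕ) (i : ℤ × ℤ) :
    (colimitPage F k).X i ⟶
      (colimitPage F (k + 1)).X (i + (1, 1)) :=
  IsColimit.map (RBC.isColimitEval (colimit.isColimit (F ⋙ pageFunctor R k)) i)
    ((HomologicalComplex.eval (ModuleCat.{u} R) (pageShape (k + 1)) (i + (1, 1))).mapCocone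
      (colimit.cocone (F ⋙ pageFunctor R (k + 1)))) (Functor.whiskerLeft F (sNatTrans R k i))

lemma ι_colimitW (k : ℕ) (i : ℤ × ℤ) (j : J) :
    (colimitPageι F (k + 1) j).f i ≫ colimitW F k i =
      (F.obj j).w k i ≫ (colimitPageι F k j).f i :=
  IsColimit.ι_map (RBC.isColimitEval (colimit.isColimit (F ⋙ pageFunctor R (k + 1))) i) _ _ j

lemma ι_colimitS (k : ℕ) (i : ℤ × ℤ) (j : J) :
    (colimitPageι F k j).f i ≫ colimitS F k i =
      (F.obj j).s k i ≫ (colimitPageι F (k + 1) j).f (i + (1, 1)) :=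
  IsColimit.ι_map (RBC.isColimitEval (colimit.isColimit (F ⋙ pageFunctor R k)) i) _ _ j

lemma colimit_hom_ext {k : ℕ} {i : ℤ × ℤ} {M : ModuleCat.{u} R}
    {f g : (colimitPage F k).X i ⟶ M}
    (h : ∀ j, (colimitPageι F k j).f i ≫ f =
      (colimitPageι F k j).f i ≫ g) : f = g :=
  (RBC.isColimitEval (colimit.isColimit (F ⋙ pageFunctor R k)) i).hom_ext h

/-- The colimit of a diagram of linear witness books. -/
noncomputable def colimitObj : LWB R where
  page := colimitPage F
  w := colimitW F
  s := colimitS F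
  s_w k i := colimit_hom_ext F fun j => by
    rw [reassoc_of% ι_colimitS F, ι_colimitW, reassoc_of% (F.obj j).s_w, comp_zero, zero_comp]
  w_s k i := colimit_hom_ext F fun j => by
    rw [reassoc_of% ι_colimitW F, ι_colimitS, reassoc_of% (F.obj j).w_s, comp_zero, zero_comp]
  s_d_w k i i' := colimit_hom_ext F fun j => by
    rw [reassoc_of% ι_colimitS F, HomologicalComplex.Hom.comm_assoc, ι_colimitW,
      HomologicalComplex.Hom.comm]
    have := (F.obj j).s_d_w k i i'
    rw [this]
    simp only [Category.assoc]

/-- The colimit cocone of a diagram of linear witness books. -/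
noncomputable def colimitCocone : Cocone F where
  pt := colimitObj F
  ι :=
    { app j :=
        { page := fun k => colimitPageι F k j
          comm_w := fun k i => (ι_colimitW F k i j).symm
          comm_s := fun k i => (ι_colimitS F k i j).symm }
      naturality := fun j j' f => by
        refine Hom.ext (funext fun k => ?_)
        exact (colimit.w (F ⋙ pageFunctor R k) f).trans (Category.comp_id _).symm }

/-- Colimits of linear witness books are computed on each page. -/
noncomputable def isColimitColimitCocone : IsColimit (colimitCocone F) where
  desc c :=
    { page := colimitPageDesc F c
      comm_w := fun k i => colimit_hom_ext F fun j => by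
        change _ ≫ colimitW F k i ≫ (colimitPageDesc F c k).f i = _ ≫ _ ≫ _
        rw [reassoc_of% ι_colimitW F, ← HomologicalComplex.comp_f,
          ← HomologicalComplex.comp_f_assoc, ι_colimitPageDesc, ι_colimitPageDesc]
        exact Hom.comm_w (c.ι.app j) k i
      comm_s := fun k i => colimit_hom_ext F fun j => by
        change _ ≫ colimitS F k i ≫ (colimitPageDesc F c (k + 1)).f _ = _ ≫ _ ≫ _
        rw [reassoc_of% ι_colimitS F, ← HomologicalComplex.comp_f,
          ← HomologicalComplex.comp_f_assoc, ι_colimitPageDesc, ι_colimitPageDesc]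
        exact Hom.comm_s (c.ι.app j) k i }
  fac c j := Hom.ext (funext fun k => ι_colimitPageDesc F c k j)
  uniq c m hm := Hom.ext (funext fun k => colimit.hom_ext fun j => by
    exact (congr_arg (fun f => Hom.page f k) (hm j)).trans (ι_colimitPageDesc F c k j).symm)

instance : HasColimits (LWB R) where
  has_colimits_of_shape _ _ := ⟨fun F => ⟨⟨_, isColimitColimitCocone F⟩⟩⟩

instance (k : ℕ) : PreservesColimitsOfShape J (pageFunctor R k) where
  preservesColimit {F} := preservesColimit_of_preserves_colimit_cocone (isColimitColimitCocone F)
    (colimit.isColimit (F ⋙ pageFunctor R k))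

end Limits

end LWB

/-! ### Free linear witness books -/

namespace RBC

variable {R : Type u} [CommRing R] {k : ℕ}

/-- Transport along an equality of bidegrees. -/
def castX (A : RBC R k) {i j : ℤ × ℤ} (h : i = j) : A.X i →ₗ[R] A.X j :=
  h ▸ LinearMap.id

lemma pOpcycles_surjective (A : RBC R k) (i : ℤ × ℤ) : Function.Surjective (A.pOpcycles i) :=
  (ModuleCat.epi_iff_surjective _).1 inferInstance

lemma fromOpcycles_p (A : RBC R k) (i j : ℤ × ℤ) (x : A.X i) :
    A.fromOpcycles i j (A.pOpcycles i x) = A.d i j x := by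
  rw [← ConcreteCategory.comp_apply, HomologicalComplex.p_fromOpcycles]

lemma pOpcycles_d (A : RBC R k) (i j : ℤ × ℤ) (x : A.X i) :
    A.pOpcycles j (A.d i j x) = 0 := by
  rw [← ConcreteCategory.comp_apply, HomologicalComplex.d_pOpcycles]
  rfl

lemma pOpcycles_fromOpcycles (A : RBC R k) (i j : ℤ × ℤ) (y : A.opcycles i) :
    A.pOpcycles j (A.fromOpcycles i j y) = 0 := by
  obtain ⟨x, rfl⟩ := A.pOpcycles_surjective i y
  rw [fromOpcycles_p, pOpcycles_d]

end RBC

namespace LWB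

variable {R : Type u} [CommRing R]

section Elements

variable (L : LWB R) {K : LWB R}

@[simp]
lemma w_s_apply (k : ℕ) (i : ℤ × ℤ) (x : (L.page k).X i) : L.w k (i + (1, 1)) (L.s k i x) = 0 :=
  ConcreteCategory.congr_hom (L.s_w k i) x

@[simp]
lemma s_w_apply (k : ℕ) (i : ℤ × ℤ) (x : (L.page (k + 1)).X i) : L.s k i (L.w k i x) = 0 :=
  ConcreteCategory.congr_hom (L.w_s k i) x

lemma w_d_s (k : ℕ) (i j : ℤ × ℤ) (x : (L.page k).X i) :
    L.w k j ((L.page (k + 1)).d (i + (1, 1)) j (L.s k i x)) = (L.page k).d i j x :=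
  (ConcreteCategory.congr_hom (L.s_d_w k i j) x).symm

@[simp]
lemma d_w (k : ℕ) (i j : ℤ × ℤ) (x : (L.page (k + 1)).X i) :
    (L.page k).d i j (L.w k i x) = 0 := by
  rw [← w_d_s, s_w_apply, map_zero, map_zero]

@[simp]
lemma s_d (k : ℕ) (i j : ℤ × ℤ) (x : (L.page k).X i) :
    L.s k j ((L.page k).d i j x) = 0 := by
  rw [← w_d_s, s_w_apply]

variable {L} in
lemma map_w (f : K ⟶ L) (k : ℕ) (i : ℤ × ℤ) (x : (K.page (k + 1)).X i) :
    (Hom.page f k).f i (K.w k i x) = L.w k i ((Hom.page f (k + 1)).f i x) :=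
  ConcreteCategory.congr_hom (Hom.comm_w f k i) x

variable {L} in
lemma map_s (f : K ⟶ L) (k : ℕ) (i : ℤ × ℤ) (x : (K.page k).X i) :
    (Hom.page f (k + 1)).f (i + (1, 1)) (K.s k i x) = L.s k i ((Hom.page f k).f i x) :=
  ConcreteCategory.congr_hom (Hom.comm_s f k i) x

/-- The iterated witness maps. -/
def wIter {n k : ℕ} (h : n ≤ k) (i : ℤ × ℤ) : (L.page k).X i →ₗ[R] (L.page n).X i :=
  Nat.leRec (motive := fun k _ => (L.page k).X i →ₗ[R] (L.page n).X i) LinearMap.id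
    (fun k _ f => f ∘ₗ (L.w k i).hom) h

@[simp]
lemma wIter_self (n : ℕ) (i : ℤ × ℤ) (x : (L.page n).X i) : L.wIter le_rfl i x = x := by
  rw [wIter, Nat.leRec_self]
  rfl

lemma wIter_succ {n k : ℕ} (h : n ≤ k) (i : ℤ × ℤ) (x : (L.page (k + 1)).X i) :
    L.wIter (h.trans k.le_succ) i x = L.wIter h i (L.w k i x) := by
  rw [wIter, Nat.leRec_succ _ _ h]
  rfl

lemma w_wIter {n k : ℕ} (h : n + 1 ≤ k) (i : ℤ × ℤ) (x : (L.page k).X i) :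
    L.w n i (L.wIter h i x) = L.wIter (n.le_succ.trans h) i x := by
  induction h with
  | refl => rw [wIter_succ _ le_rfl, wIter_self, wIter_self]
  | step h ih => rw [wIter_succ _ h, ih, ← wIter_succ]

lemma d_wIter {n k : ℕ} (h : n < k) (i j : ℤ × ℤ) (x : (L.page k).X i) :
    (L.page n).d i j (L.wIter h.le i x) = 0 := by
  rw [← w_wIter L h, d_w]

lemma s_wIter {n k : ℕ} (h : n < k) (i : ℤ × ℤ) (x : (L.page k).X i) :
    L.s n i (L.wIter h.le i x) = 0 := by
  rw [← w_wIter L h, s_w_apply]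

variable {L} in
lemma map_wIter (f : K ⟶ L) {n k : ℕ} (h : n ≤ k) (i : ℤ × ℤ) (x : (K.page k).X i) :
    (Hom.page f n).f i (K.wIter h i x) = L.wIter h i ((Hom.page f k).f i x) := by
  induction h with
  | refl => rw [wIter_self, wIter_self]
  | step h ih => rw [wIter_succ _ h, ih, wIter_succ _ h, map_w]

/-- `b` is the bidegree of the image of an element of page `k` of bidegree `a` under the iterated
degeneracy map to page `n`. -/
def IsShift (k n : ℕ) (a b : ℤ × ℤ) : Prop := b.1 = a.1 + (n - k) ∧ b.2 = a.2 + (n - k)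

lemma IsShift.eq {k : ℕ} {a b : ℤ × ℤ} (h : IsShift k k a b) : a = b := by
  rw [IsShift] at h
  ext <;> omega

lemma isShift_self (k : ℕ) (a : ℤ × ℤ) : IsShift k k a a := by
  rw [IsShift]
  omega

lemma isShift_succ_iff {k n : ℕ} {a b : ℤ × ℤ} :
    IsShift k (n + 1) a (b + (1, 1)) ↔ IsShift k n a b := by
  simp only [IsShift, Prod.fst_add, Prod.snd_add]
  push_cast
  omega

lemma IsShift.pred {k n : ℕ} {a b : ℤ × ℤ} (h : IsShift k (n + 1) a b) :
    IsShift k n a (b - (1, 1)) := by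
  rw [← isShift_succ_iff, sub_add_cancel]
  exact h

/-- The iterated degeneracy maps. -/
def sIter {k n : ℕ} (h : k ≤ n) {a b : ℤ × ℤ} (hab : IsShift k n a b) :
    (L.page k).X a →ₗ[R] (L.page n).X b :=
  Nat.leRec (motive := fun n _ => ∀ b, IsShift k n a b → ((L.page k).X a →ₗ[R] (L.page n).X b))
    (fun _ hab => (L.page k).castX hab.eq)
    (fun n _ f b hab => (L.page (n + 1)).castX (sub_add_cancel b (1, 1)) ∘ₗ
      (L.s n (b - (1, 1))).hom ∘ₗ f (b - (1, 1)) hab.pred) h b hab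

@[simp]
lemma sIter_self {k : ℕ} {a : ℤ × ℤ} (h : IsShift k k a a) (x : (L.page k).X a) :
    L.sIter le_rfl h x = x := by
  rw [sIter, Nat.leRec_self]
  rfl

lemma s_sIter {k n : ℕ} (h : k ≤ n) {a b : ℤ × ℤ} (hab : IsShift k n a b)
    (x : (L.page k).X a) :
    L.s n b (L.sIter h hab x) =
      L.sIter (h.trans n.le_succ) (isShift_succ_iff.2 hab) x := by
  conv_rhs => rw [sIter, Nat.leRec_succ _ _ h]
  have aux : ∀ (b' : ℤ × ℤ) (hb : b = b') (e : b' + (1, 1) = b + (1, 1)) (hab' : IsShift k n a b'),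
      L.s n b (L.sIter h hab x) = (L.page (n + 1)).castX e (L.s n b' (L.sIter h hab' x)) := by
    rintro _ rfl _ _
    rfl
  exact aux _ (add_sub_cancel_right b _).symm _ _

/-- Bidegrees on a positive page can be written as shifts. -/
lemma IsShift.exists_eq {k n : ℕ} {a b : ℤ × ℤ} (h : IsShift k (n + 1) a b) :
    ∃ b', b = b' + (1, 1) ∧ IsShift k n a b' :=
  ⟨b - (1, 1), (sub_add_cancel _ _).symm, h.pred⟩

lemma w_sIter {k n : ℕ} (h : k ≤ n) {a b : ℤ × ℤ} (hab : IsShift k (n + 1) a b)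
    (x : (L.page k).X a) : L.w n b (L.sIter (h.trans n.le_succ) hab x) = 0 := by
  obtain ⟨b, rfl, hab'⟩ := hab.exists_eq
  rw [← s_sIter _ h hab', w_s_apply]

lemma w_d_sIter {k n : ℕ} (h : k ≤ n) {a b : ℤ × ℤ} (hab : IsShift k n a b) {b' : ℤ × ℤ}
    (hab' : IsShift k (n + 1) a b') (i : ℤ × ℤ) (x : (L.page k).X a) :
    L.w n i ((L.page (n + 1)).d b' i (L.sIter (h.trans n.le_succ) hab' x)) =
      (L.page n).d b i (L.sIter h hab x) := by
  obtain rfl : b' = b + (1, 1) := by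
    simp only [IsShift] at hab hab'
    push_cast at hab'
    ext <;> simp only [Prod.fst_add, Prod.snd_add] <;> omega
  rw [← s_sIter _ h hab, w_d_s]

lemma sIter_d {k n : ℕ} (h : k < n) {a b : ℤ × ℤ} (hab : IsShift k n a b) (i : ℤ × ℤ)
    (x : (L.page k).X i) : L.sIter h.le hab ((L.page k).d i a x) = 0 := by
  induction n, h using Nat.le_induction generalizing b with
  | base =>
    obtain ⟨b, rfl, hab'⟩ := hab.exists_eq
    obtain rfl := hab'.eq
    rw [← s_sIter _ le_rfl hab', sIter_self, s_d]
  | succ n h ih =>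
    obtain ⟨b, rfl, hab'⟩ := hab.exists_eq
    rw [← s_sIter _ (Nat.le_of_succ_le h) hab', ih, map_zero]

variable {L} in
lemma map_sIter (f : K ⟶ L) {k n : ℕ} (h : k ≤ n) {a b : ℤ × ℤ} (hab : IsShift k n a b)
    (x : (K.page k).X a) :
    (Hom.page f n).f b (K.sIter h hab x) = L.sIter h hab ((Hom.page f k).f a x) := by
  induction n, h using Nat.le_induction generalizing b with
  | base =>
    obtain rfl := hab.eq
    rw [sIter_self, sIter_self]
  | succ n h ih =>
    obtain ⟨b, rfl, hab'⟩ := hab.exists_eq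
    rw [← s_sIter _ h hab', map_s, ih, s_sIter]

end Elements

section Free

variable {k : ℕ} (A : RBC R k)

/-- The component of page `n` in bidegree `i` of the free linear witness book on a `k`-bigraded
complex `A`: for `n ≤ k` the images of `A` under the iterated witness map; for `k < n`, the images
of `A` under the iterated degeneracy map and the differentials of the latter. As `s d = 0`, one has
to divide by the boundaries of `A` for `k < n`. The bidegrees of `A` which contribute are kept as
indices. -/
abbrev FreeX (n : ℕ) (i : ℤ × ℤ) : Type u :=
  (∀ j : {j : ℤ × ℤ // n ≤ k ∧ j = i}, A.X j.1) ×
    (∀ j : {j : ℤ × ℤ // k < n ∧ IsShift k n j i}, A.opcycles j.1) ×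
      (∀ j : {j : ℤ × ℤ // k < n ∧ (pageShape k).Rel j i}, A.opcycles j.1)

variable {A}

lemma freeX_ext {n : ℕ} {i : ℤ × ℤ} {x y : FreeX A n i}
    (h₁ : ∀ h : n ≤ k, x.1 ⟨i, h, rfl⟩ = y.1 ⟨i, h, rfl⟩)
    (h₂ : ∀ (h : k < n) j (hj : IsShift k n j i), x.2.1 ⟨j, h, hj⟩ = y.2.1 ⟨j, h, hj⟩)
    (h₃ : ∀ (h : k < n) j (hj : (pageShape k).Rel j i), x.2.2 ⟨j, h, hj⟩ = y.2.2 ⟨j, h, hj⟩) :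
    x = y := by
  refine Prod.ext (funext ?_) (Prod.ext (funext ?_) (funext ?_))
  · rintro ⟨_, h, rfl⟩
    exact h₁ h
  · rintro ⟨j, h, hj⟩
    exact h₂ h j hj
  · rintro ⟨j, h, hj⟩
    exact h₃ h j hj

lemma isShift_of_rel {n : ℕ} {j i i' : ℤ × ℤ} (h : (pageShape n).Rel i i')
    (h' : (pageShape k).Rel j i') : IsShift k n j i := by
  rw [RBC.rel_iff] at h h'
  rw [IsShift]
  omega

lemma predDeg_rel_of_eq {i j : ℤ × ℤ} (h : j = i) : (pageShape k).Rel (RBC.predDeg k j) i := by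
  subst h
  exact RBC.predDeg_rel j

lemma rel_of_isShift {n : ℕ} {j i i' : ℤ × ℤ} (h : (pageShape n).Rel i i')
    (h' : IsShift k n j i) : (pageShape k).Rel j i' := by
  rw [RBC.rel_iff] at h ⊢
  rw [IsShift] at h'
  omega

variable (A)

/-- The differential of the free linear witness book. -/
noncomputable def freeD (n : ℕ) (i i' : ℤ × ℤ) (hi : (pageShape n).Rel i i') :
    FreeX A n i →ₗ[R] FreeX A n i' where
  toFun x := (fun j => A.d i j.1 (x.1 ⟨i, j.2.1, rfl⟩), 0,
    fun j => x.2.1 ⟨j.1, j.2.1, isShift_of_rel hi j.2.2⟩)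
  map_add' _ _ := freeX_ext (fun _ => map_add _ _ _) (fun _ _ _ => (add_zero _).symm)
    fun _ _ _ => rfl
  map_smul' c _ := freeX_ext (fun _ => map_smul (A.d _ _).hom _ _)
    (fun _ _ _ => (smul_zero c).symm) fun _ _ _ => rfl

/-- The witness maps of the free linear witness book. -/
noncomputable def freeW (n : ℕ) (i : ℤ × ℤ) : FreeX A (n + 1) i →ₗ[R] FreeX A n i where
  toFun x := (fun j => if h : n + 1 ≤ k then x.1 ⟨j.1, h, j.2.2⟩ else
      A.fromOpcycles (RBC.predDeg k j) j
        (x.2.2 ⟨RBC.predDeg k j, by omega, predDeg_rel_of_eq j.2.2⟩),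
    0, fun j => x.2.2 ⟨j.1, by omega, j.2.2⟩)
  map_add' x y := by
    refine freeX_ext (fun _ => ?_) (fun _ _ _ => (add_zero _).symm) fun _ _ _ => rfl
    by_cases h : n + 1 ≤ k
    · simp only [dif_pos h, Prod.fst_add, Pi.add_apply]
    · simp only [dif_neg h, Prod.fst_add, Prod.snd_add, Pi.add_apply, map_add]
  map_smul' c x := by
    refine freeX_ext (fun _ => ?_) (fun _ _ _ => (smul_zero c).symm) fun _ _ _ => rfl
    by_cases h : n + 1 ≤ k
    · simp only [dif_pos h, Prod.smul_fst, Pi.smul_apply, RingHom.id_apply]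
    · simp only [dif_neg h, Prod.smul_fst, Prod.smul_snd, Pi.smul_apply, RingHom.id_apply, map_smul]

/-- The degeneracy maps of the free linear witness book. -/
noncomputable def freeS (n : ℕ) (i : ℤ × ℤ) :
    FreeX A n i →ₗ[R] FreeX A (n + 1) (i + (1, 1)) where
  toFun x := (0, fun j => if h : k < n then x.2.1 ⟨j.1, h, isShift_succ_iff.1 j.2.2⟩ else
      A.pOpcycles j (x.1 ⟨j.1, not_lt.1 h, by
        obtain ⟨j, hj, hj'⟩ := j
        obtain rfl : k = n := by omega
        exact (isShift_succ_iff.1 hj').eq⟩), 0)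
  map_add' x y := by
    refine freeX_ext (fun _ => (add_zero _).symm) (fun _ _ _ => ?_)
      fun _ _ _ => (add_zero _).symm
    by_cases h : k < n
    · simp only [dif_pos h, Prod.fst_add, Prod.snd_add, Pi.add_apply]
    · simp only [dif_neg h, Prod.fst_add, Prod.snd_add, Pi.add_apply, map_add]
  map_smul' c x := by
    refine freeX_ext (fun _ => (smul_zero c).symm) (fun _ _ _ => ?_)
      fun _ _ _ => (smul_zero c).symm
    by_cases h : k < n
    · simp only [dif_pos h, Prod.smul_fst, Prod.smul_snd, Pi.smul_apply, RingHom.id_apply]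
    · simp only [dif_neg h, Prod.smul_fst, Prod.smul_snd, Pi.smul_apply, RingHom.id_apply, map_smul]

lemma freeS_of_lt {n : ℕ} {i j : ℤ × ℤ} (h : k < n) (hj : IsShift k (n + 1) j (i + (1, 1)))
    (x : FreeX A n i) : (freeS A n i x).2.1 ⟨j, h.trans n.lt_succ_self, hj⟩ =
      x.2.1 ⟨j, h, isShift_succ_iff.1 hj⟩ := dif_pos h

lemma freeS_self {i : ℤ × ℤ} (hj : IsShift k (k + 1) i (i + (1, 1)))
    (x : FreeX A k i) : (freeS A k i x).2.1 ⟨i, k.lt_succ_self, hj⟩ =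
      A.pOpcycles i (x.1 ⟨i, le_rfl, rfl⟩) := dif_neg (lt_irrefl k)

lemma freeW_of_lt {n : ℕ} {i : ℤ × ℤ} (h : n + 1 ≤ k) (x : FreeX A (n + 1) i) :
    (freeW A n i x).1 ⟨i, n.le_succ.trans h, rfl⟩ = x.1 ⟨i, h, rfl⟩ := dif_pos h

open Classical in
/-- The pages of the free linear witness book. -/
noncomputable def freePage (n : ℕ) : RBC R n where
  X i := ModuleCat.of R (FreeX A n i)
  d i j := if h : (pageShape n).Rel i j then ModuleCat.ofHom (freeD A n i j h) else 0
  shape i j h := dif_neg h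
  d_comp_d' i j l hij hjl := by
    rw [dif_pos hij, dif_pos hjl]
    refine ModuleCat.hom_ext (LinearMap.ext fun x => ?_)
    change freeD A n j l hjl (freeD A n i j hij x) = 0
    exact freeX_ext (fun h => A.d_d_apply i j l _) (fun _ _ _ => rfl) fun _ _ _ => rfl

lemma freePage_d {n : ℕ} {i j : ℤ × ℤ} (h : (pageShape n).Rel i j) (x : FreeX A n i) :
    (freePage A n).d i j x = freeD A n i j h x :=
  ConcreteCategory.congr_hom (dif_pos h : (freePage A n).d i j = _) x

/-- The free linear witness book on a `k`-bigraded complex. -/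
noncomputable def free : LWB R where
  page := freePage A
  w n i := ModuleCat.ofHom (freeW A n i)
  s n i := ModuleCat.ofHom (freeS A n i)
  s_w n i := by
    refine ModuleCat.hom_ext (LinearMap.ext fun x => freeX_ext (fun h => ?_) (fun _ _ _ => rfl)
      fun _ _ _ => rfl)
    change (if h : n + 1 ≤ k then 0 else A.fromOpcycles _ _ 0) = _
    split_ifs
    · rfl
    · exact map_zero _
  w_s n i := by
    refine ModuleCat.hom_ext (LinearMap.ext fun x => freeX_ext (fun h => rfl) (fun h j hj => ?_)
      fun _ _ _ => rfl)
    change (if h : k < n then 0 else A.pOpcycles j (dite _ _ _)) = 0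
    split_ifs
    · rfl
    · omega
    · exact A.pOpcycles_fromOpcycles _ _ _
  s_d_w n i j := by
    by_cases h : (pageShape n).Rel i j
    · have h' : (pageShape (n + 1)).Rel (i + (1, 1)) j := by
        rw [RBC.rel_iff] at h ⊢
        simp only [Prod.fst_add, Prod.snd_add]
        push_cast
        omega
      refine ModuleCat.hom_ext (LinearMap.ext fun x => ?_)
      change (freePage A n).d i j x = freeW A n j ((freePage A (n + 1)).d _ j (freeS A n i x))
      refine (freePage_d A h x).trans (Eq.trans ?_
        (congrArg (freeW A n j) (freePage_d A h' (freeS A n i x))).symm)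
      refine freeX_ext (fun hn => ?_) (fun _ _ _ => rfl) fun hn l hl => ?_
      · change A.d i j _ = if h : n + 1 ≤ k then A.d (i + (1, 1)) j 0 else
          A.fromOpcycles _ _ (dite _ _ _)
        split_ifs with hk hk'
        · rw [map_zero, A.d_apply_of_not_rel]
          rw [RBC.rel_iff] at h ⊢
          omega
        · omega
        · obtain rfl : n = k := by omega
          rw [RBC.fromOpcycles_p]
          obtain rfl : i = RBC.predDeg n j := by
            rw [RBC.rel_iff] at h
            ext <;> simp only [Prod.fst_sub, Prod.snd_sub] <;> omega
          rfl
      · exact (freeS_of_lt A hn (isShift_of_rel h' hl) x).symm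
    · have h' : ¬ (pageShape (n + 1)).Rel (i + (1, 1)) j := fun h' => h (ESpSe.rel_of_rel_succ h')
      rw [(freePage A n).shape _ _ h, (freePage A (n + 1)).shape _ _ h']
      exact ModuleCat.hom_ext (LinearMap.ext fun x => (map_zero (freeW A n j)).symm)

end Free

end LWB

/-! ### The universal property of free linear witness books -/

namespace LWB

variable {R : Type u} [CommRing R] {k : ℕ} (A : RBC R k)

/-- The components of an element of a free linear witness book. -/
def toFreeX {A : RBC R k} {n : ℕ} {i : ℤ × ℤ} (x : ((free A).page n).X i) : FreeX A n i := x

/-- The inclusion of `A` in page `k` of the free linear witness book on `A`, on elements. -/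
noncomputable def freeι (i : ℤ × ℤ) : A.X i →ₗ[R] FreeX A k i where
  toFun x := (fun j => A.castX j.2.2.symm x, 0, 0)
  map_add' _ _ := freeX_ext (fun _ => map_add _ _ _) (fun _ _ _ => (add_zero _).symm)
    fun _ _ _ => (add_zero _).symm
  map_smul' c _ := freeX_ext (fun _ => map_smul _ _ _) (fun _ _ _ => (smul_zero c).symm)
    fun _ _ _ => (smul_zero c).symm

/-- The inclusion of `A` in page `k` of the free linear witness book on `A`. -/
noncomputable def freeUnit : A ⟶ (free A).page k where
  f i := ModuleCat.ofHom (freeι A i)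
  comm' i j hij := by
    refine ModuleCat.hom_ext (LinearMap.ext fun x => ?_)
    refine (freePage_d A hij (freeι A i x)).trans ?_
    exact freeX_ext (fun _ => rfl) (fun _ _ _ => rfl) fun _ _ _ => rfl

lemma toFreeX_freeUnit {i : ℤ × ℤ} (x : A.X i) :
    (toFreeX ((freeUnit A).f i x)).1 ⟨i, le_rfl, rfl⟩ = x := rfl

instance : IsIso (freeUnit A) := by
  have : ∀ i, IsIso ((freeUnit A).f i) := fun i => by
    rw [ConcreteCategory.isIso_iff_bijective]
    constructor
    · intro x y h
      rw [← toFreeX_freeUnit A x, h, toFreeX_freeUnit]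
    · intro y
      refine ⟨(toFreeX y).1 ⟨i, le_rfl, rfl⟩, freeX_ext (fun _ => rfl) (fun h => ?_) fun h => ?_⟩
      · exact absurd h (lt_irrefl k)
      · exact absurd h (lt_irrefl k)
  exact HomologicalComplex.Hom.isIso_of_components _

lemma toFreeX_wIter {n : ℕ} (h : n ≤ k) {i : ℤ × ℤ} (x : A.X i) :
    (toFreeX ((free A).wIter h i ((freeUnit A).f i x))).1 ⟨i, h, rfl⟩ = x := by
  obtain ⟨m, hm⟩ := Nat.exists_eq_add_of_le' h
  induction m generalizing n with
  | zero =>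
    obtain rfl : k = n := by omega
    rw [wIter_self, toFreeX_freeUnit]
  | succ m ih =>
    rw [← w_wIter _ (by omega : n + 1 ≤ k)]
    exact (freeW_of_lt A (by omega) _).trans (ih (by omega) (by omega))

lemma toFreeX_sIter {n : ℕ} (h : k < n) {a b : ℤ × ℤ} (hab : IsShift k n a b) (x : A.X a) :
    (toFreeX ((free A).sIter h.le hab ((freeUnit A).f a x))).2.1 ⟨a, h, hab⟩ =
      A.pOpcycles a x := by
  induction n, h using Nat.le_induction generalizing b with
  | base =>
    obtain ⟨b, rfl, hab'⟩ := hab.exists_eq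
    obtain rfl := hab'.eq
    rw [← s_sIter _ le_rfl hab', sIter_self]
    exact freeS_self A hab _
  | succ n h ih =>
    obtain ⟨b, rfl, hab'⟩ := hab.exists_eq
    rw [← s_sIter _ (Nat.le_of_succ_le h) hab']
    exact (freeS_of_lt A h hab _).trans (ih hab')

lemma toFreeX_sIter_snd {n : ℕ} (h : k < n) {a b : ℤ × ℤ} (hab : IsShift k n a b)
    (x : A.X a) : (toFreeX ((free A).sIter h.le hab ((freeUnit A).f a x))).2.2 = 0 := by
  obtain ⟨n, rfl⟩ : ∃ m, n = m + 1 := ⟨n - 1, by omega⟩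
  obtain ⟨b, rfl, hab'⟩ := hab.exists_eq
  rw [← s_sIter _ (Nat.lt_succ_iff.1 h) hab']
  rfl

lemma toFreeX_d {n : ℕ} {b i : ℤ × ℤ} (hb : (pageShape n).Rel b i)
    (x : ((free A).page n).X b) :
    toFreeX (((free A).page n).d b i x) = freeD A n b i hb (toFreeX x) :=
  freePage_d A hb x

/-- The bidegree `a` of page `k` such that the iterated degeneracy map to page `n` takes bidegree
`a` to bidegree `i`. -/
abbrev shiftDeg (k n : ℕ) (i : ℤ × ℤ) : ℤ × ℤ := i - ((n : ℤ) - k, (n : ℤ) - k)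

lemma isShift_shiftDeg (k n : ℕ) (i : ℤ × ℤ) : IsShift k n (shiftDeg k n i) i := by
  simp [IsShift]

lemma isShift_predDeg (k n : ℕ) (i : ℤ × ℤ) :
    IsShift k n (RBC.predDeg k i) (RBC.predDeg n i) := by
  rw [IsShift]
  simp only [Prod.fst_sub, Prod.snd_sub]
  omega

lemma IsShift.unique {n : ℕ} {a a' b : ℤ × ℤ} (h : IsShift k n a b) (h' : IsShift k n a' b) :
    a = a' := by
  rw [IsShift] at h h'
  ext <;> omega

/-- On the pages `n ≤ k`, a free linear witness book consists of iterated witnesses of the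
generators. -/
lemma exists_eq_wIter {n : ℕ} (h : n ≤ k) {i : ℤ × ℤ} (z : ((free A).page n).X i) :
    ∃ x, z = (free A).wIter h i ((freeUnit A).f i x) := by
  refine ⟨(toFreeX z).1 ⟨i, h, rfl⟩, freeX_ext (fun _ => ?_) (fun h' => ?_) fun h' => ?_⟩
  · exact (toFreeX_wIter A h _).symm
  · omega
  · omega

/-- On the pages `n > k`, a free linear witness book is generated by the iterated degeneracies of
the generators as a complex. -/
lemma exists_eq_sIter {n : ℕ} (h : k < n) {i : ℤ × ℤ} (z : ((free A).page n).X i) :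
    ∃ x y, z = (free A).sIter h.le (isShift_shiftDeg k n i) ((freeUnit A).f _ x) +
      ((free A).page n).d _ i
        ((free A).sIter h.le (isShift_predDeg k n i) ((freeUnit A).f _ y)) := by
  obtain ⟨x, hx⟩ := A.pOpcycles_surjective _
    ((toFreeX z).2.1 ⟨shiftDeg k n i, h, isShift_shiftDeg k n i⟩)
  obtain ⟨y, hy⟩ := A.pOpcycles_surjective _
    ((toFreeX z).2.2 ⟨RBC.predDeg k i, h, RBC.predDeg_rel i⟩)
  refine ⟨x, y, freeX_ext (fun h' => ?_) (fun _ a ha => ?_) fun _ a ha => ?_⟩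
  · omega
  · obtain rfl := ha.unique (isShift_shiftDeg k n i)
    refine (hx.symm.trans (toFreeX_sIter A h ha x).symm).trans ?_
    change _ = (toFreeX _).2.1 _ + (toFreeX _).2.1 _
    rw [toFreeX_d A (RBC.predDeg_rel i)]
    exact (add_zero _).symm
  · obtain rfl := (pageShape k).prev_eq ha (RBC.predDeg_rel i)
    refine hy.symm.trans ((toFreeX_sIter A h (isShift_predDeg k n i) y).symm.trans ?_)
    have h₀ : (toFreeX ((free A).sIter h.le (isShift_shiftDeg k n i)
        ((freeUnit A).f _ x))).2.2 ⟨_, h, RBC.predDeg_rel i⟩ = 0 :=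
      congr_fun (toFreeX_sIter_snd A h (isShift_shiftDeg k n i) x) _
    have h₁ : (toFreeX (((free A).page n).d _ i ((free A).sIter h.le (isShift_predDeg k n i)
        ((freeUnit A).f _ y)))).2.2 ⟨_, h, RBC.predDeg_rel i⟩ =
        (toFreeX ((free A).sIter h.le (isShift_predDeg k n i) ((freeUnit A).f _ y))).2.1
          ⟨_, h, isShift_predDeg k n i⟩ := by
      rw [toFreeX_d A (RBC.predDeg_rel i)]
      rfl
    refine Eq.trans ?_ (congr_arg₂ (· + ·) h₀ h₁).symm
    exact (zero_add _).symm

variable {A} {L : LWB R}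

/-- Maps out of a free linear witness book are determined by their restrictions to the
generators. -/
lemma free_hom_ext {f g : free A ⟶ L} (h : freeUnit A ≫ Hom.page f k = freeUnit A ≫ Hom.page g k) :
    f = g := by
  have h' (i) (x : A.X i) : (Hom.page f k).f i ((freeUnit A).f i x) =
      (Hom.page g k).f i ((freeUnit A).f i x) :=
    ConcreteCategory.congr_hom (HomologicalComplex.congr_hom h i) x
  refine hom_ext_apply fun n i z => ?_
  obtain hn | hn := le_or_gt n k
  · obtain ⟨x, rfl⟩ := exists_eq_wIter A hn z
    rw [map_wIter, map_wIter, h']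
  · obtain ⟨x, y, rfl⟩ := exists_eq_sIter A hn z
    rw [map_add, map_add, map_sIter, map_sIter, RBC.comm_apply, RBC.comm_apply, map_sIter,
      map_sIter, h', h']

variable (g : A ⟶ L.page k)

/-- The iterated degeneracy map of `L`, composed with `g`, descends to the quotient of `A` by the
boundaries. -/
noncomputable def sBar {n : ℕ} (h : k < n) {a b : ℤ × ℤ} (hab : IsShift k n a b) :
    A.opcycles a →ₗ[R] (L.page n).X b :=
  (A.descOpcycles (ModuleCat.ofHom (L.sIter h.le hab ∘ₗ (g.f a).hom)) (RBC.predDeg k a)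
    ((pageShape k).prev_eq' (RBC.predDeg_rel a)) (by
      refine ModuleCat.hom_ext (LinearMap.ext fun x => ?_)
      change L.sIter h.le hab (g.f a (A.d _ a x)) = 0
      rw [RBC.comm_apply, sIter_d _ h])).hom

lemma sBar_p {n : ℕ} (h : k < n) {a b : ℤ × ℤ} (hab : IsShift k n a b) (x : A.X a) :
    sBar g h hab (A.pOpcycles a x) = L.sIter h.le hab (g.f a x) :=
  ConcreteCategory.congr_hom (A.p_descOpcycles (ModuleCat.ofHom (L.sIter h.le hab ∘ₗ (g.f a).hom))
    (RBC.predDeg k a) _ _) x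

variable (A) in
/-- The component of an element of a free linear witness book on a page `n ≤ k`. -/
noncomputable def freeProj₁ {n : ℕ} (h : n ≤ k) (i : ℤ × ℤ) : ((free A).page n).X i →ₗ[R] A.X i where
  toFun x := (toFreeX x).1 ⟨i, h, rfl⟩
  map_add' _ _ := rfl
  map_smul' _ _ := rfl

variable (A) in
/-- The first component of an element of a free linear witness book on a page `n > k`. -/
noncomputable def freeProj₂ {n : ℕ} (h : k < n) (i : ℤ × ℤ) :
    ((free A).page n).X i →ₗ[R] A.opcycles (shiftDeg k n i) where
  toFun x := (toFreeX x).2.1 ⟨_, h, isShift_shiftDeg k n i⟩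
  map_add' _ _ := rfl
  map_smul' _ _ := rfl

variable (A) in
/-- The second component of an element of a free linear witness book on a page `n > k`. -/
noncomputable def freeProj₃ {n : ℕ} (h : k < n) (i : ℤ × ℤ) :
    ((free A).page n).X i →ₗ[R] A.opcycles (RBC.predDeg k i) where
  toFun x := (toFreeX x).2.2 ⟨_, h, RBC.predDeg_rel i⟩
  map_add' _ _ := rfl
  map_smul' _ _ := rfl

/-- The map out of a free linear witness book which extends `g`, on elements. -/
noncomputable def freeDescX (n : ℕ) (i : ℤ × ℤ) :
    ((free A).page n).X i →ₗ[R] (L.page n).X i :=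
  if h : n ≤ k then
    L.wIter h i ∘ₗ (g.f i).hom ∘ₗ freeProj₁ A h i
  else
    sBar g (not_le.1 h) (isShift_shiftDeg k n i) ∘ₗ freeProj₂ A (not_le.1 h) i +
      ((L.page n).d _ i).hom ∘ₗ
        sBar g (not_le.1 h) (isShift_predDeg k n i) ∘ₗ freeProj₃ A (not_le.1 h) i

lemma freeDescX_wIter {n : ℕ} (h : n ≤ k) {i : ℤ × ℤ} (x : A.X i) :
    freeDescX g n i ((free A).wIter h i ((freeUnit A).f i x)) = L.wIter h i (g.f i x) := by
  rw [freeDescX, dif_pos h, LinearMap.comp_apply, LinearMap.comp_apply]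
  exact congr_arg (fun t => L.wIter h i (g.f i t)) (toFreeX_wIter A h x)

lemma freeDescX_unit {i : ℤ × ℤ} (x : A.X i) :
    freeDescX g k i ((freeUnit A).f i x) = g.f i x := by
  simpa using freeDescX_wIter g le_rfl x

lemma freeDescX_sIter {n : ℕ} (h : k < n) {a i : ℤ × ℤ} (ha : IsShift k n a i) (x : A.X a) :
    freeDescX g n i ((free A).sIter h.le ha ((freeUnit A).f a x)) =
      L.sIter h.le ha (g.f a x) := by
  obtain rfl := ha.unique (isShift_shiftDeg k n i)
  have h₂ : freeProj₂ A h i ((free A).sIter h.le ha ((freeUnit A).f _ x)) = A.pOpcycles _ x :=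
    toFreeX_sIter A h ha x
  have h₃ : freeProj₃ A h i ((free A).sIter h.le ha ((freeUnit A).f _ x)) = 0 :=
    congr_fun (toFreeX_sIter_snd A h ha x) _
  rw [freeDescX, dif_neg (not_le.2 h), LinearMap.add_apply, LinearMap.comp_apply,
    LinearMap.comp_apply, LinearMap.comp_apply, h₂, h₃, map_zero, map_zero, add_zero, sBar_p]

lemma freeDescX_d_sIter {n : ℕ} (h : k < n) {a b i : ℤ × ℤ} (hb : (pageShape n).Rel b i)
    (ha : IsShift k n a b) (x : A.X a) :
    freeDescX g n i (((free A).page n).d b i ((free A).sIter h.le ha ((freeUnit A).f a x))) =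
      (L.page n).d b i (L.sIter h.le ha (g.f a x)) := by
  obtain rfl := (pageShape n).prev_eq hb (RBC.predDeg_rel i)
  obtain rfl := ha.unique (isShift_predDeg k n i)
  have h₂ : freeProj₂ A h i (((free A).page n).d _ i
      ((free A).sIter h.le ha ((freeUnit A).f _ x))) = 0 := by
    change (toFreeX _).2.1 _ = 0
    rw [toFreeX_d A hb]
    rfl
  have h₃ : freeProj₃ A h i (((free A).page n).d _ i
      ((free A).sIter h.le ha ((freeUnit A).f _ x))) = A.pOpcycles _ x := by
    refine Eq.trans ?_ (toFreeX_sIter A h ha x)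
    change (toFreeX _).2.2 _ = _
    rw [toFreeX_d A hb]
    rfl
  rw [freeDescX, dif_neg (not_le.2 h), LinearMap.add_apply, LinearMap.comp_apply,
    LinearMap.comp_apply, LinearMap.comp_apply, h₂, h₃, map_zero, zero_add, sBar_p]

/-- The map out of a free linear witness book which extends `g`. -/
noncomputable def freeDesc : free A ⟶ L where
  page n :=
    { f := fun i => ModuleCat.ofHom (freeDescX g n i)
      comm' := fun i j hij => by
        refine ModuleCat.hom_ext (LinearMap.ext fun z => ?_)
        change (L.page n).d i j (freeDescX g n i z) =
          freeDescX g n j (((free A).page n).d i j z)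
        obtain hn | rfl | hn := lt_trichotomy n k
        · obtain ⟨x, rfl⟩ := exists_eq_wIter A hn.le z
          rw [freeDescX_wIter, d_wIter _ hn, d_wIter _ hn, map_zero]
        · obtain ⟨x, rfl⟩ := exists_eq_wIter A le_rfl z
          rw [wIter_self, freeDescX_unit, ← RBC.comm_apply, ← RBC.comm_apply, freeDescX_unit]
        · obtain ⟨x, y, rfl⟩ := exists_eq_sIter A hn z
          rw [map_add, map_add, freeDescX_sIter _ hn, freeDescX_d_sIter _ hn (RBC.predDeg_rel i),
            map_add, RBC.d_d_apply, RBC.d_d_apply, add_zero, add_zero,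
            freeDescX_d_sIter _ hn hij] }
  comm_w n i := by
    refine ModuleCat.hom_ext (LinearMap.ext fun z => ?_)
    change freeDescX g n i ((free A).w n i z) = L.w n i (freeDescX g (n + 1) i z)
    obtain hn | hn := lt_or_ge n k
    · obtain ⟨x, rfl⟩ := exists_eq_wIter A hn z
      rw [w_wIter, freeDescX_wIter, freeDescX_wIter, w_wIter]
    · obtain ⟨x, y, rfl⟩ := exists_eq_sIter A (Nat.lt_succ_iff.2 hn) z
      rw [map_add, map_add, map_add, freeDescX_sIter _ (Nat.lt_succ_iff.2 hn),
        freeDescX_d_sIter _ (Nat.lt_succ_iff.2 hn) (RBC.predDeg_rel i), map_add,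
        w_sIter (free A) hn, w_sIter L hn, w_d_sIter (free A) hn (isShift_predDeg k n i),
        w_d_sIter L hn (isShift_predDeg k n i), map_zero, zero_add, zero_add]
      obtain rfl | hn := hn.eq_or_lt
      · rw [sIter_self, sIter_self, ← RBC.comm_apply, ← RBC.comm_apply, freeDescX_unit]
      · rw [freeDescX_d_sIter _ hn (RBC.predDeg_rel i)]
  comm_s n i := by
    refine ModuleCat.hom_ext (LinearMap.ext fun z => ?_)
    change freeDescX g (n + 1) _ ((free A).s n i z) = L.s n i (freeDescX g n i z)
    obtain hn | rfl | hn := lt_trichotomy n k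
    · obtain ⟨x, rfl⟩ := exists_eq_wIter A hn.le z
      rw [freeDescX_wIter, s_wIter _ hn, s_wIter _ hn, map_zero]
    · obtain ⟨x, rfl⟩ := exists_eq_wIter A le_rfl z
      have h := isShift_self n i
      rw [wIter_self, freeDescX_unit]
      have h₁ := s_sIter (free A) le_rfl h ((freeUnit A).f i x)
      have h₂ := s_sIter L le_rfl h (g.f i x)
      rw [sIter_self] at h₁ h₂
      rw [h₁, h₂, freeDescX_sIter _ n.lt_succ_self]
    · obtain ⟨x, y, rfl⟩ := exists_eq_sIter A hn z
      rw [map_add, map_add, map_add, freeDescX_sIter _ hn,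
        freeDescX_d_sIter _ hn (RBC.predDeg_rel i), map_add, s_d (free A), s_d L, map_zero,
        add_zero, add_zero, s_sIter (free A) hn.le (isShift_shiftDeg k n i),
        s_sIter L hn.le (isShift_shiftDeg k n i), freeDescX_sIter _ (hn.trans n.lt_succ_self)]

lemma freeUnit_desc : freeUnit A ≫ Hom.page (freeDesc g) k = g :=
  RBC.hom_ext_apply fun _ x => freeDescX_unit g x

variable (A L) in
/-- The universal property of the free linear witness book. -/
noncomputable def freeEquiv : (free A ⟶ L) ≃ (A ⟶ (pageFunctor R k).obj L) where
  toFun f := freeUnit A ≫ Hom.page f k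
  invFun g := freeDesc g
  left_inv _ := free_hom_ext (freeUnit_desc _)
  right_inv g := freeUnit_desc g

lemma freeEquiv_naturality (A : RBC R k) (L L' : LWB R) (f : L ⟶ L') (h : free A ⟶ L) :
    freeEquiv A L' (h ≫ f) = freeEquiv A L h ≫ (pageFunctor R k).map f :=
  (Category.assoc (freeUnit A) (Hom.page h k) (Hom.page f k)).symm

variable (R k) in
/-- The free linear witness book functor. -/
noncomputable def freeFunctor : RBC R k ⥤ LWB R :=
  Adjunction.leftAdjointOfEquiv freeEquiv freeEquiv_naturality

variable (R k) in
/-- The free linear witness book functor is left adjoint to the functor which takes a linear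
witness book to its `k`-page. -/
noncomputable def freeAdj : freeFunctor R k ⊣ pageFunctor R k :=
  Adjunction.adjunctionOfEquivLeft freeEquiv freeEquiv_naturality

lemma freeAdj_homEquiv (f : (freeFunctor R k).obj A ⟶ L) :
    (freeAdj R k).homEquiv A L f = freeUnit A ≫ Hom.page (K := free A) f k := by
  simp only [freeAdj, Adjunction.adjunctionOfEquivLeft]
  rfl

end LWB

/-! ### The model structures on linear witness books and bigraded complexes -/

namespace RBC

variable {R : Type u} [CommRing R] {k : ℕ}

/-- The components of the acyclic complex `RBC.cover`: an element of bidegree `i` consists of a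
chain of `B` of bidegree `i` and a chain of `B` whose differential lies in bidegree `i`. -/
abbrev CoverX (B : RBC R k) (i : ℤ × ℤ) : Type u :=
  ∀ j : {j // j = i ∨ (pageShape k).Rel j i}, B.X j.1

open Classical in
/-- The direct sum over all bidegrees `i` of the disks on the modules `B.X i`: the differential
maps the copy of `B.X i` in bidegree `i` identically to the copy in the next bidegree. -/
noncomputable def cover (B : RBC R k) : RBC R k where
  X i := ModuleCat.of R (CoverX B i)
  d i i' := ModuleCat.ofHom
    { toFun := fun x j => if h : (pageShape k).Rel i i' ∧ j.1 = i then x ⟨j.1, Or.inl h.2⟩ else 0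
      map_add' := fun x y => funext fun j => by
        by_cases h : (pageShape k).Rel i i' ∧ j.1 = i
        · simp only [dif_pos h, Pi.add_apply]
        · simp only [dif_neg h, Pi.add_apply, add_zero]
      map_smul' := fun c x => funext fun j => by
        by_cases h : (pageShape k).Rel i i' ∧ j.1 = i
        · simp only [dif_pos h, Pi.smul_apply, RingHom.id_apply]
        · simp only [dif_neg h, Pi.smul_apply, smul_zero] }
  shape i i' h := ModuleCat.hom_ext (LinearMap.ext fun x => funext fun j =>
    dif_neg fun h' => h h'.1)
  d_comp_d' i i' i'' hi hi' := ModuleCat.hom_ext (LinearMap.ext fun x => funext fun j => by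
    by_cases h : (pageShape k).Rel i' i'' ∧ j.1 = i'
    · exact (dif_pos h).trans (dif_neg fun h' => rel_ne hi (h'.2.symm.trans h.2))
    · exact dif_neg h)

/-- The differential of an element of `B.cover`. -/
noncomputable def coverD (B : RBC R k) {i : ℤ × ℤ} (i' : ℤ × ℤ) (x : CoverX B i) : CoverX B i' :=
  B.cover.d i i' x

lemma coverD_of_eq (B : RBC R k) {i i' : ℤ × ℤ} (h : (pageShape k).Rel i i') (x : CoverX B i) :
    coverD B i' x ⟨i, Or.inr h⟩ = x ⟨i, Or.inl rfl⟩ := dif_pos ⟨h, rfl⟩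

lemma coverD_of_ne (B : RBC R k) {i i' : ℤ × ℤ} (x : CoverX B i)
    (j : {j // j = i' ∨ (pageShape k).Rel j i'}) (h : j.1 ≠ i) :
    coverD B i' x j = 0 := dif_neg fun h' => h h'.2

/-- The complex `B.cover` is acyclic. -/
lemma cover_isBdry (B : RBC R k) (i : ℤ × ℤ) (x : B.cover.X i) (hx : B.cover.IsCycle i x) :
    B.cover.IsBdry i x := by
  classical
  let x' : CoverX B i := x
  have h0 : x' ⟨i, Or.inl rfl⟩ = 0 :=
    (coverD_of_eq B (rel_succDeg i) x').symm.trans (congr_fun (hx (succDeg k i)) _)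
  let y : CoverX B (predDeg k i) := fun j =>
    if h : j.1 = predDeg k i then x' ⟨j.1, Or.inr (by rw [h]; exact predDeg_rel i)⟩ else 0
  refine ⟨predDeg k i, y, funext ?_⟩
  rintro ⟨j, hj⟩
  by_cases h : j = predDeg k i
  · subst h
    exact (coverD_of_eq B (predDeg_rel i) y).trans (dif_pos rfl)
  · refine (coverD_of_ne B y _ h).trans ?_
    obtain rfl | hj' := hj
    · exact h0.symm
    · exact absurd ((pageShape k).prev_eq hj' (predDeg_rel i)) h

/-- The canonical surjection from an acyclic complex onto `B`. -/
noncomputable def coverπ (B : RBC R k) : B.cover ⟶ B where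
  f i := ModuleCat.ofHom
    { toFun := fun x : CoverX B i =>
        (x ⟨i, Or.inl rfl⟩ + B.d (predDeg k i) i (x ⟨predDeg k i, Or.inr (predDeg_rel i)⟩) : B.X i)
      map_add' := fun x y => by
        simp only [Pi.add_apply, map_add]
        abel
      map_smul' := fun c x => by
        have : ∀ z, B.d (predDeg k i) i (c • z) = c • B.d (predDeg k i) i z :=
          map_smul (B.d (predDeg k i) i).hom c
        simp only [Pi.smul_apply, this, smul_add, RingHom.id_apply] }
  comm' i i' hi := by
    refine ModuleCat.hom_ext (LinearMap.ext fun (x : CoverX B i) => ?_)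
    change B.d i i' (x ⟨i, Or.inl rfl⟩ + B.d (predDeg k i) i (x ⟨_, _⟩)) =
      coverD B i' x ⟨i', Or.inl rfl⟩ +
        B.d (predDeg k i') i' (coverD B i' x ⟨predDeg k i', Or.inr (predDeg_rel i')⟩)
    obtain rfl := (pageShape k).prev_eq hi (predDeg_rel i')
    rw [map_add, d_d_apply, add_zero, coverD_of_eq _ hi, coverD_of_ne _ _ _ (rel_ne hi).symm, zero_add]

lemma coverπ_surj (B : RBC R k) : Surj B.coverπ := fun i b => by
  classical
  let x : CoverX B i := fun j => if h : i = j.1 then B.castX h b else 0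
  have h₁ : x ⟨i, Or.inl rfl⟩ = b := dif_pos rfl
  have h₂ : x ⟨predDeg k i, Or.inr (predDeg_rel i)⟩ = 0 := dif_neg (rel_ne (predDeg_rel i)).symm
  refine ⟨x, ?_⟩
  change x ⟨i, _⟩ + B.d (predDeg k i) i (x ⟨predDeg k i, _⟩) = b
  rw [h₁, h₂, map_zero, add_zero]

end RBC

namespace LWB

variable {R : Type u} [CommRing R]

section Sum

variable (K L : LWB R)

/-- The direct sum of two linear witness books. -/
def sum : LWB R where
  page n :=
    { X := fun i => ModuleCat.of R ((K.page n).X i × (L.page n).X i)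
      d := fun i j => ModuleCat.ofHom (((K.page n).d i j).hom.prodMap ((L.page n).d i j).hom)
      shape := fun _ _ h => by
        rw [(K.page n).shape _ _ h, (L.page n).shape _ _ h]
        rfl
      d_comp_d' := fun i j l _ _ => ModuleCat.hom_ext (LinearMap.ext fun x =>
        Prod.ext ((K.page n).d_d_apply i j l x.1) ((L.page n).d_d_apply i j l x.2)) }
  w n i := ModuleCat.ofHom ((K.w n i).hom.prodMap (L.w n i).hom)
  s n i := ModuleCat.ofHom ((K.s n i).hom.prodMap (L.s n i).hom)
  s_w n i := ModuleCat.hom_ext (LinearMap.ext fun x =>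
    Prod.ext (K.w_s_apply n i x.1) (L.w_s_apply n i x.2))
  w_s n i := ModuleCat.hom_ext (LinearMap.ext fun x =>
    Prod.ext (K.s_w_apply n i x.1) (L.s_w_apply n i x.2))
  s_d_w n i j := ModuleCat.hom_ext (LinearMap.ext fun x =>
    Prod.ext (K.w_d_s n i j x.1).symm (L.w_d_s n i j x.2).symm)

/-- The inclusion of the first summand. -/
def sumInl : K ⟶ K.sum L where
  page n :=
    { f := fun _ => ModuleCat.ofHom (LinearMap.inl R _ _)
      comm' := fun i j _ => ModuleCat.hom_ext (LinearMap.ext fun _ =>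
        Prod.ext rfl (map_zero ((L.page n).d i j).hom)) }
  comm_w n i := ModuleCat.hom_ext (LinearMap.ext fun _ =>
    Prod.ext rfl (map_zero (L.w n i).hom).symm)
  comm_s n i := ModuleCat.hom_ext (LinearMap.ext fun _ =>
    Prod.ext rfl (map_zero (L.s n i).hom).symm)

variable {K L} {M : LWB R} (f : K ⟶ M) (g : L ⟶ M)

/-- The map out of a direct sum given by maps out of the summands. -/
def sumDesc : K.sum L ⟶ M where
  page n :=
    { f := fun i => ModuleCat.ofHom
        (((Hom.page f n).f i).hom.coprod ((Hom.page g n).f i).hom)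
      comm' := fun i j _ => ModuleCat.hom_ext (LinearMap.ext fun x => by
        change (M.page n).d i j ((Hom.page f n).f i x.1 + (Hom.page g n).f i x.2) =
          (Hom.page f n).f j ((K.page n).d i j x.1) + (Hom.page g n).f j ((L.page n).d i j x.2)
        rw [map_add, RBC.comm_apply, RBC.comm_apply]) }
  comm_w n i := ModuleCat.hom_ext (LinearMap.ext fun x => by
    change (Hom.page f n).f i (K.w n i x.1) + (Hom.page g n).f i (L.w n i x.2) =
      M.w n i ((Hom.page f (n + 1)).f i x.1 + (Hom.page g (n + 1)).f i x.2)
    rw [map_add, map_w, map_w])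
  comm_s n i := ModuleCat.hom_ext (LinearMap.ext fun x => by
    change (Hom.page f (n + 1)).f _ (K.s n i x.1) + (Hom.page g (n + 1)).f _ (L.s n i x.2) =
      M.s n i ((Hom.page f n).f i x.1 + (Hom.page g n).f i x.2)
    rw [map_add, map_s, map_s])

lemma sumInl_desc : sumInl K L ≫ sumDesc f g = f := hom_ext_apply fun n i x => by
  change (Hom.page f n).f i x + (Hom.page g n).f i 0 = _
  rw [map_zero, add_zero]

lemma surj_sumDesc_left {n : ℕ} (h : RBC.Surj (Hom.page f n)) :
    RBC.Surj (Hom.page (sumDesc f g) n) := fun i y => by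
  obtain ⟨x, rfl⟩ := h i y
  refine ⟨(x, 0), ?_⟩
  change (Hom.page f n).f i x + (Hom.page g n).f i 0 = _
  rw [map_zero, add_zero]

lemma surj_sumDesc_right {n : ℕ} (h : RBC.Surj (Hom.page g n)) :
    RBC.Surj (Hom.page (sumDesc f g) n) := fun i y => by
  obtain ⟨x, rfl⟩ := h i y
  refine ⟨(0, x), ?_⟩
  change (Hom.page f n).f i 0 + (Hom.page g n).f i x = _
  rw [map_zero, zero_add]

lemma weq_sumInl {n : ℕ} (h : ∀ i x, (L.page n).IsCycle i x → (L.page n).IsBdry i x) :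
    weq R n (sumInl K L) := by
  refine (RBC.weq_iff _).2 ⟨?_, ?_⟩
  · intro i (b : (K.page n).X i × (L.page n).X i) hb
    have hb' (j) : (K.page n).d i j b.1 = 0 ∧ (L.page n).d i j b.2 = 0 := Prod.ext_iff.1 (hb j)
    obtain ⟨j, y, hy⟩ := h i b.2 fun j => (hb' j).2
    refine ⟨b.1, fun j => (hb' j).1, j, ((0 : (K.page n).X j), -y), Prod.ext ?_ ?_⟩
    · change (K.page n).d j i 0 = b.1 - b.1
      rw [map_zero, sub_self]
    · change (L.page n).d j i (-y) = 0 - b.2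
      rw [map_neg, hy, zero_sub]
  · rintro i a ha ⟨j, y, hy⟩
    exact ⟨j, Prod.fst (α := (K.page n).X j) (β := (L.page n).X j) y, congr_arg Prod.fst hy⟩

end Sum

/-- Every element of the image of the degeneracy map to page `r` which is a cycle is the boundary
of an element of that image (a void condition for `r = 0`). This is what is needed in order to
compute the homology of page `r` of the associated extended spectral sequence. -/
def IsDegenerateExact (L : LWB R) (r : ℕ) : Prop :=
  ∀ n, n + 1 = r → ∀ i x, (L.page (n + 1)).IsCycle (i + (1, 1)) (L.s n i x) →
    ∃ y, (L.page (n + 1)).d (RBC.predDeg n (i + (1, 1)) + (1, 1)) (i + (1, 1)) (L.s n _ y) =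
      L.s n i x

lemma IsDegenerateExact.sum {K L : LWB R} {r : ℕ} (hK : K.IsDegenerateExact r)
    (hL : L.IsDegenerateExact r) : (K.sum L).IsDegenerateExact r := by
  intro n hn i (x : (K.page n).X i × (L.page n).X i) hx
  have hx' (j) : (K.page (n + 1)).d _ j (K.s n i x.1) = 0 ∧
      (L.page (n + 1)).d _ j (L.s n i x.2) = 0 := Prod.ext_iff.1 (hx j)
  obtain ⟨y, hy⟩ := hK n hn i x.1 fun j => (hx' j).1
  obtain ⟨z, hz⟩ := hL n hn i x.2 fun j => (hx' j).2
  exact ⟨(y, z), Prod.ext hy hz⟩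

lemma IsDegenerateExact.of_retract {K L : LWB R} {r : ℕ} (hK : K.IsDegenerateExact r)
    {i : L ⟶ K} {p : K ⟶ L} (h : i ≫ p = 𝟙 L) : L.IsDegenerateExact r := by
  intro n hn j x hx
  have h' (y : (L.page n).X j) : (Hom.page p n).f j ((Hom.page i n).f j y) = y :=
    ConcreteCategory.congr_hom (HomologicalComplex.congr_hom
      (congr_arg (fun f => Hom.page (K := L) (L := L) f n) h) j) y
  have h'' := map_s p n j ((Hom.page i n).f j x)
  rw [h'] at h''
  rw [← h'']
  obtain ⟨y, hy⟩ := hK n hn j ((Hom.page i n).f j x) (by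
    rw [← map_s]
    exact hx.map _)
  refine ⟨(Hom.page p n).f _ y, ?_⟩
  rw [← hy, RBC.comm_apply, map_s]

section Free

variable {k : ℕ} (A : RBC R k)

/-- In a free linear witness book, no nonzero degeneracy is a cycle: on the pages `n > k` the
differential is injective on the iterated degeneracies of the generators. -/
lemma free_s_eq_zero {n : ℕ} {i : ℤ × ℤ} (x : ((free A).page n).X i)
    (hx : ((free A).page (n + 1)).IsCycle (i + (1, 1)) ((free A).s n i x)) :
    (free A).s n i x = 0 := by
  have hx' := (toFreeX_d A (RBC.rel_succDeg _) _).symm.trans (hx _)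
  refine freeX_ext (fun _ => rfl) (fun h j hj => ?_) fun _ _ _ => rfl
  exact congr_fun (congr_arg (fun t => t.2.2) hx')
    ⟨j, h, rel_of_isShift (RBC.rel_succDeg _) hj⟩

lemma free_isDegenerateExact (r : ℕ) : (free A).IsDegenerateExact r := fun n _ i x hx => by
  exact ⟨0, by rw [free_s_eq_zero A x hx, map_zero, map_zero]⟩

/-- The free linear witness book on an acyclic complex is acyclic on the pages `n ≥ k`. -/
lemma free_isBdry (hA : ∀ i x, A.IsCycle i x → A.IsBdry i x) {n : ℕ} (hn : k ≤ n) (i : ℤ × ℤ)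
    (x : ((free A).page n).X i) (hx : ((free A).page n).IsCycle i x) :
    ((free A).page n).IsBdry i x := by
  obtain rfl | hn := hn.eq_or_lt
  · have hinv : freeUnit A ≫ inv (freeUnit A) = 𝟙 A := IsIso.hom_inv_id _
    have hinv' : inv (freeUnit A) ≫ freeUnit A = 𝟙 _ := IsIso.inv_hom_id _
    have := (hA i _ (hx.map (inv (freeUnit A)))).map (freeUnit A)
    rwa [← RBC.comp_f_apply, hinv'] at this
  · obtain ⟨x, y, rfl⟩ := exists_eq_sIter A hn x
    have h : (free A).sIter hn.le (isShift_shiftDeg k n i) ((freeUnit A).f _ x) = 0 := by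
      obtain ⟨n, rfl⟩ : ∃ m, n = m + 1 := ⟨n - 1, by omega⟩
      obtain ⟨i, rfl, hi⟩ := (isShift_shiftDeg k (n + 1) i).exists_eq
      rw [← s_sIter _ (Nat.lt_succ_iff.1 hn) hi] at hx ⊢
      refine free_s_eq_zero A _ fun j => ?_
      have := hx j
      rwa [map_add, RBC.d_d_apply, add_zero] at this
    rw [h, zero_add]
    exact RBC.isBdry_d _

end Free

/-- Every map of linear witness books factors as a weak equivalence followed by a fibration, and
the middle object has exact degeneracies if the source has. -/
lemma exists_factorization (r : ℕ) {K L : LWB R} (f : K ⟶ L) :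
    ∃ (Z : LWB R) (j : K ⟶ Z) (p : Z ⟶ L), j ≫ p = f ∧ weq R r j ∧ fib R r p ∧
      (K.IsDegenerateExact r → Z.IsDegenerateExact r) := by
  suffices ∀ m ≤ r + 1, ∃ (Z : LWB R) (j : K ⟶ Z) (p : Z ⟶ L), j ≫ p = f ∧ weq R r j ∧
      (∀ k < m, RBC.Surj (Hom.page p k)) ∧ (K.IsDegenerateExact r → Z.IsDegenerateExact r) by
    obtain ⟨Z, j, p, h₁, h₂, h₃, h₄⟩ := this (r + 1) le_rfl
    exact ⟨Z, j, p, h₁, h₂, fun k hk => h₃ k (Nat.lt_succ_iff.2 hk), h₄⟩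
  intro m hm
  induction m with
  | zero =>
    exact ⟨K, 𝟙 K, f, Category.id_comp f, RBC.weq_of_isIso (𝟙 (K.page r)), fun k hk => absurd hk k.not_lt_zero,
      id⟩
  | succ m ih =>
    obtain ⟨Z, j, p, h₁, h₂, h₃, h₄⟩ := ih (by omega)
    -- add a free linear witness book which covers page `m` of `L`
    refine ⟨Z.sum (free (L.page m).cover), j ≫ sumInl _ _,
      sumDesc p (freeDesc (L.page m).coverπ), ?_, ?_, ?_, ?_⟩
    · rw [Category.assoc, sumInl_desc, h₁]
    · exact (RBC.weq R r).comp_mem _ _ h₂ (weq_sumInl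
        (free_isBdry _ (RBC.cover_isBdry _) (Nat.lt_succ_iff.1 hm)))
    · intro k hk
      obtain hk | rfl := Nat.lt_succ_iff_lt_or_eq.1 hk
      · exact surj_sumDesc_left _ _ (h₃ k hk)
      · refine surj_sumDesc_right _ _ fun i y => ?_
        obtain ⟨x, rfl⟩ := RBC.coverπ_surj _ i y
        exact ⟨_, freeDescX_unit _ x⟩
    · exact fun h => (h₄ h).sum (free_isDegenerateExact _ r)

section SubBook

variable (L : LWB R) (r : ℕ)

/-- The elements which are killed by the degeneracy maps out of the pages `k < r`. -/
def degenKer (k : ℕ) (i : ℤ × ℤ) : Submodule R ((L.page k).X i) where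
  carrier := {x | k < r → L.s k i x = 0}
  zero_mem' _ := map_zero _
  add_mem' hx hy h := by rw [map_add, hx h, hy h, add_zero]
  smul_mem' c x hx h := by
    have : L.s k i (c • x) = c • L.s k i x := map_smul (L.s k i).hom c x
    rw [this, hx h, smul_zero]

/-- The sub-book of the elements which are killed by the degeneracy maps out of the pages
`k < r`. -/
def degenKerBook : LWB R where
  page k :=
    { X := fun i => ModuleCat.of R (L.degenKer r k i)
      d := fun i j => ModuleCat.ofHom (((L.page k).d i j).hom.restrict
        fun x _ _ => L.s_d k i j x)
      shape := fun i j h => ModuleCat.hom_ext (LinearMap.ext fun x =>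
        Subtype.ext ((L.page k).d_apply_of_not_rel h x.1))
      d_comp_d' := fun i j l _ _ => ModuleCat.hom_ext (LinearMap.ext fun x =>
        Subtype.ext ((L.page k).d_d_apply i j l x.1)) }
  w k i := ModuleCat.ofHom ((L.w k i).hom.restrict fun x _ _ => L.s_w_apply k i x)
  s k i := ModuleCat.ofHom ((L.s k i).hom.restrict fun x hx hk => by
    change L.s (k + 1) _ (L.s k i x) = 0
    rw [hx (by omega), map_zero])
  s_w k i := ModuleCat.hom_ext (LinearMap.ext fun x => Subtype.ext (L.w_s_apply k i x.1))
  w_s k i := ModuleCat.hom_ext (LinearMap.ext fun x => Subtype.ext (L.s_w_apply k i x.1))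
  s_d_w k i j := ModuleCat.hom_ext (LinearMap.ext fun x => Subtype.ext (L.w_d_s k i j x.1).symm)

/-- The inclusion of `degenKerBook`. -/
def degenKerι : L.degenKerBook r ⟶ L where
  page k := { f := fun i => ModuleCat.ofHom (L.degenKer r k i).subtype }
  comm_w _ _ := rfl
  comm_s _ _ := rfl

/-- The degeneracies of `degenKerBook` vanish on the pages `k < r`. -/
lemma isDegenerateExact_degenKerBook : (L.degenKerBook r).IsDegenerateExact r :=
  fun n hn i x _ => by
    have : (L.degenKerBook r).s n i x = 0 :=
      Subtype.ext ((Subtype.property (p := (· ∈ L.degenKer r n i)) x) (by omega))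
    exact ⟨0, by rw [this, map_zero, map_zero]⟩

/-- The inclusion is an isomorphism on page `r`. -/
lemma weq_degenKerι : weq R r (L.degenKerι r) := by
  have : ∀ i, IsIso ((Hom.page (L.degenKerι r) r).f i) := fun i => by
    rw [ConcreteCategory.isIso_iff_bijective]
    exact ⟨Subtype.val_injective, fun y => ⟨⟨y, fun h => absurd h (lt_irrefl r)⟩, rfl⟩⟩
  have : IsIso (Hom.page (L.degenKerι r) r) := HomologicalComplex.Hom.isIso_of_components _
  exact RBC.weq_of_isIso _

end SubBook

/-- If `L` has the left lifting property with respect to trivial fibrations with target `L`, then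
it is a retract of a linear witness book with exact degeneracies, so that its degeneracies are
exact. -/
lemma isDegenerateExact_of_exists_section (r : ℕ) (L : LWB R)
    (h : ∀ (Z : LWB R) (p : Z ⟶ L), fib R r p → weq R r p → ∃ i : L ⟶ Z, i ≫ p = 𝟙 L) :
    L.IsDegenerateExact r := by
  obtain ⟨Z, j, p, h₁, h₂, h₃, h₄⟩ := exists_factorization r (L.degenKerι r)
  obtain ⟨i, hi⟩ := h Z p h₃ ((RBC.weq R r).of_precomp (Hom.page j r) (Hom.page p r) h₂ (by
    have := L.weq_degenKerι r
    rwa [← h₁] at this))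
  exact (h₄ (L.isDegenerateExact_degenKerBook r)).of_retract hi

/-- The model structure on linear witness books. -/
lemma exists_modelCategory (R : Type u) [CommRing R] (r : ℕ) :
    ∃ _ : ModelCategory (LWB R), IsCofibrantlyGenerated (LWB R) ∧
      fibrations (LWB R) = fib R r ∧ weakEquivalences (LWB R) = weq R r := by
  obtain ⟨h, h₁, h₂, h₃⟩ := exists_modelCategory_of_adjunctions (ι := Fin (r + 1)) (fun a => a.1)
    (fun a => pageFunctor R a.1) (fun a => freeFunctor R a.1) (fun a => freeAdj R a.1)
    (Fin.last r)
    (fun J _ _ G c hc i x hx => RBC.exists_rep_of_isCycle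
      (isColimitOfPreserves (pageFunctor R r) hc) hx)
    (fun J _ _ G c hc i j x y hxy => RBC.exists_map_eq
      (isColimitOfPreserves (pageFunctor R r) hc) hxy)
    (fun X Y f => by
      obtain ⟨Z, j, p, h₁, h₂, h₃, -⟩ := exists_factorization r f
      exact ⟨Z, j, p, h₁, h₂, fun a => h₃ a (Nat.lt_succ_iff.1 a.2)⟩)
  refine ⟨h, h₁, h₂.trans ?_, h₃⟩
  ext K L f
  exact ⟨fun hf k hk => hf ⟨k, Nat.lt_succ_iff.2 hk⟩, fun hf a => hf a (Nat.lt_succ_iff.1 a.2)⟩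

end LWB

/-- The projective model structure on bigraded complexes. -/
lemma RBC.exists_modelCategory (R : Type u) [CommRing R] (r : ℕ) :
    ∃ _ : ModelCategory (RBC R r), IsCofibrantlyGenerated (RBC R r) ∧
      fibrations (RBC R r) = fib R r ∧ weakEquivalences (RBC R r) = weq R r := by
  have : HasLimits (RBC R r) := ⟨fun _ _ => inferInstance⟩
  have : HasColimits (RBC R r) := ⟨fun _ _ => inferInstance⟩
  obtain ⟨h, h₁, h₂, h₃⟩ := exists_modelCategory_of_adjunctions (ι := Unit) (fun _ => r)
    (fun _ => 𝟭 (RBC R r)) (fun _ => 𝟭 _) (fun _ => Adjunction.id) ()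
    (fun J _ _ G c hc i x hx => RBC.exists_rep_of_isCycle hc hx)
    (fun J _ _ G c hc i j x y hxy => RBC.exists_map_eq hc hxy)
    -- a factorization is obtained on page `r` of one of the map of free linear witness books
    (fun X Y f => by
      obtain ⟨Z, j, p, h₁, h₂, h₃, -⟩ :=
        LWB.exists_factorization r (LWB.freeDesc (f ≫ LWB.freeUnit Y))
      refine ⟨Z.page r, LWB.freeUnit X ≫ LWB.Hom.page j r,
        LWB.Hom.page p r ≫ inv (LWB.freeUnit Y), ?_, ?_, ?_⟩
      · have h := LWB.freeUnit_desc (f ≫ LWB.freeUnit Y)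
        rw [← h₁, LWB.comp_page] at h
        rw [Category.assoc, ← Category.assoc (LWB.Hom.page j r), ← Category.assoc, h,
          Category.assoc, IsIso.hom_inv_id, Category.comp_id]
      · exact (RBC.weq R r).comp_mem _ _ (RBC.weq_of_isIso (LWB.freeUnit X)) h₂
      · rintro - i y
        obtain ⟨x, hx⟩ := h₃ r le_rfl i ((LWB.freeUnit Y).f i y)
        refine ⟨x, ?_⟩
        change (inv (LWB.freeUnit Y)).f i ((LWB.Hom.page p r).f i x) = y
        rw [hx, ← RBC.comp_f_apply, IsIso.hom_inv_id]
        rfl)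
  exact ⟨h, h₁, h₂.trans (by ext; exact ⟨fun hf => hf (), fun hf _ => hf⟩), h₃⟩

/-! ### Compatible sequences -/

namespace ESpSe

variable {R : Type u} [CommRing R] {X Y : ESpSe R}

lemma isWitness_iff {k : ℕ} {i : ℤ × ℤ} {a : (X.page (k + 1)).X i} {b : (X.page k).X i} :
    X.IsWitness k i a b ↔ ∃ h : (X.page k).IsCycle i b, RBC.cls b h = X.φ k i a := by
  constructor
  · rintro ⟨z, rfl, hz⟩
    exact ⟨RBC.isCycle_iCycles z, (RBC.homologyπ_eq_cls z).symm.trans hz⟩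
  · rintro ⟨h, hz⟩
    exact ⟨h.exists_cycles.choose, h.exists_cycles.choose_spec, hz⟩

lemma exists_isWitness {k : ℕ} {i : ℤ × ℤ} (a : (X.page (k + 1)).X i) :
    ∃ b, X.IsWitness k i a b := by
  obtain ⟨b, hb, h⟩ := RBC.exists_cls (X.φ k i a)
  exact ⟨b, isWitness_iff.2 ⟨hb, h⟩⟩

lemma IsWitness.isBdry_sub {k : ℕ} {i : ℤ × ℤ} {a : (X.page (k + 1)).X i} {b b' : (X.page k).X i}
    (h : X.IsWitness k i a b) (h' : X.IsWitness k i a b') : (X.page k).IsBdry i (b - b') := by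
  obtain ⟨h₁, h₂⟩ := isWitness_iff.1 h
  obtain ⟨h₁', h₂'⟩ := isWitness_iff.1 h'
  exact (RBC.cls_eq_iff h₁ h₁').1 (h₂.trans h₂'.symm)

/-- The witnesses of zero are the boundaries. -/
lemma isWitness_zero_iff {k : ℕ} {i : ℤ × ℤ} {b : (X.page k).X i} :
    X.IsWitness k i 0 b ↔ (X.page k).IsBdry i b := by
  rw [isWitness_iff, map_zero]
  exact ⟨fun ⟨h, h'⟩ => (RBC.cls_eq_zero_iff h).1 h',
    fun h => ⟨h.isCycle, (RBC.cls_eq_zero_iff h.isCycle).2 h⟩⟩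

lemma IsWitness.add_isBdry {k : ℕ} {i : ℤ × ℤ} {a : (X.page (k + 1)).X i} {b c : (X.page k).X i}
    (h : X.IsWitness k i a b) (hc : (X.page k).IsBdry i c) : X.IsWitness k i a (b + c) := by
  simpa using h.add (isWitness_zero_iff.2 hc)

/-- Compatibility with the characteristic maps in terms of witnesses. -/
lemma IsWitness.homologyMap_φ {k : ℕ} {i : ℤ × ℤ} {a : (X.page (k + 1)).X i} {b : (X.page k).X i}
    (h : X.IsWitness k i a b) (f : X.page k ⟶ Y.page k) (g : X.page (k + 1) ⟶ Y.page (k + 1))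
    (h' : Y.IsWitness k i (g.f i a) (f.f i b)) :
    HomologicalComplex.homologyMap f i (X.φ k i a) = Y.φ k i (g.f i a) := by
  obtain ⟨h₁, h₂⟩ := isWitness_iff.1 h
  obtain ⟨h₁', h₂'⟩ := isWitness_iff.1 h'
  rw [← h₂, ← h₂', RBC.homologyMap_cls]

lemma IsCompatible.congr {k : ℕ} {i : ℤ × ℤ} {x y : ∀ l, (X.page l).X i} (h : X.IsCompatible k i x)
    (hxy : ∀ l ≤ k, x l = y l) : X.IsCompatible k i y := fun l hl => by
  rw [← hxy l hl.le, ← hxy (l + 1) hl]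
  exact h l hl

lemma IsCompatible.mono {k l : ℕ} {i : ℤ × ℤ} {x : ∀ l, (X.page l).X i} (h : X.IsCompatible k i x)
    (hl : l ≤ k) : X.IsCompatible l i x := fun m hm => h m (hm.trans_le hl)

/-- A compatible sequence can be prolonged by an element whose witness is its last element. -/
lemma IsCompatible.update {k : ℕ} {i : ℤ × ℤ} {x : ∀ l, (X.page l).X i} (h : X.IsCompatible k i x)
    {a : (X.page (k + 1)).X i} (ha : X.IsWitness k i a (x k)) :
    X.IsCompatible (k + 1) i (Function.update x (k + 1) a) := by
  intro l hl
  obtain hl | rfl := Nat.lt_succ_iff_lt_or_eq.1 hl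
  · rw [Function.update_of_ne (by omega), Function.update_of_ne (by omega)]
    exact h l hl
  · rw [Function.update_self, Function.update_of_ne (by omega)]
    exact ha

/-- Compatible sequences are constructed by descending induction, starting from the last
element. -/
lemma exists_isCompatible {i : ℤ × ℤ} (P : ∀ k, (X.page k).X i → Prop) (k : ℕ)
    (hP : ∀ l < k, ∀ a, P (l + 1) a → ∃ b, P l b ∧ X.IsWitness l i a b)
    (a : (X.page k).X i) (ha : P k a) :
    ∃ x, X.IsCompatible k i x ∧ x k = a ∧ (∀ l, k < l → x l = 0) ∧ ∀ l ≤ k, P l (x l) := by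
  induction k with
  | zero =>
    refine ⟨Function.update (fun l => (0 : (X.page l).X i)) 0 a, fun l hl => absurd hl l.not_lt_zero,
      Function.update_self _ _ _, fun l hl => Function.update_of_ne hl.ne' _ _, fun l hl => ?_⟩
    obtain rfl := Nat.le_zero.1 hl
    rwa [Function.update_self]
  | succ k ih =>
    obtain ⟨b, hb, hab⟩ := hP k k.lt_succ_self a ha
    obtain ⟨x, h₁, rfl, h₃, h₄⟩ := ih (fun l hl => hP l (hl.trans k.lt_succ_self)) b hb
    refine ⟨Function.update x (k + 1) a, h₁.update hab, Function.update_self _ _ _, fun l hl => ?_,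
      fun l hl => ?_⟩
    · rw [Function.update_of_ne hl.ne']
      exact h₃ l (by omega)
    · obtain rfl | hl := hl.eq_or_lt
      · rwa [Function.update_self]
      · rw [Function.update_of_ne hl.ne]
        exact h₄ l (Nat.lt_succ_iff.1 hl)

/-- Every element is the last element of a compatible sequence. -/
lemma exists_isCompatible_of_top {i : ℤ × ℤ} (k : ℕ) (a : (X.page k).X i) :
    ∃ x, X.IsCompatible k i x ∧ x k = a ∧ ∀ l, k < l → x l = 0 := by
  obtain ⟨x, h₁, h₂, h₃, -⟩ := exists_isCompatible (X := X) (i := i) (fun _ _ => True) k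
    (fun l _ a _ => (exists_isWitness a).imp fun b hb => ⟨trivial, hb⟩) a trivial
  exact ⟨x, h₁, h₂, h₃⟩

/-- A lift of the last element of a compatible sequence along a fibration can be completed to a
lift of the sequence. -/
lemma exists_isCompatible_of_surj (f : X ⟶ Y) {i : ℤ × ℤ} (k : ℕ)
    (hf : ∀ l < k, RBC.Surj (Hom.page f l)) {y : ∀ l, (Y.page l).X i} (hy : Y.IsCompatible k i y)
    (a : (X.page k).X i) (ha : (Hom.page f k).f i a = y k) :
    ∃ x, X.IsCompatible k i x ∧ x k = a ∧ (∀ l, k < l → x l = 0) ∧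
      ∀ l ≤ k, (Hom.page f l).f i (x l) = y l := by
  refine exists_isCompatible (fun l b => (Hom.page f l).f i b = y l) k (fun l hl b hb => ?_) a ha
  obtain ⟨c, hc⟩ := exists_isWitness b
  have h' : Y.IsWitness l i (y (l + 1)) ((Hom.page f l).f i c) := hb ▸ hc.map f
  obtain ⟨j, e, he⟩ := (hy l hl).isBdry_sub h'
  obtain ⟨e, rfl⟩ := hf l hl _ e
  refine ⟨c + (X.page l).d j i e, ?_, hc.add_isBdry (RBC.isBdry_d e)⟩
  dsimp only
  rw [map_add, RBC.comm_apply, he, add_sub_cancel]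

/-! ### Pages and homology of the nerve -/

/-- An element of a page of the nerve, as a pair of compatible sequences. -/
def toNerve {k : ℕ} {i : ℤ × ℤ} (p : (X.nerve.page k).X i) : X.nerveModule k i := p

lemma nervePage_d (X : ESpSe R) {k : ℕ} {i j : ℤ × ℤ} (h : (pageShape k).Rel i j)
    (p : X.nerveModule k i) : (X.nervePage k).d i j p = X.nerveD k i j h p :=
  ConcreteCategory.congr_hom (dif_pos h : (X.nervePage k).d i j = _) p

lemma nervePage_d_fst (X : ESpSe R) {k : ℕ} {i j : ℤ × ℤ} (h : (pageShape k).Rel i j)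
    (p : X.nerveModule k i) (l : ℕ) :
    (toNerve ((X.nervePage k).d i j p)).1.1 l = p.1.2 ⟨j, h⟩ l := by
  rw [nervePage_d X h]
  rfl

/-- Elements of the nerve with prescribed compatible sequences. -/
lemma exists_nerve {k : ℕ} {i j : ℤ × ℤ} (h : (pageShape k).Rel i j) {x : ∀ l, (X.page l).X i}
    {y : ∀ l, (X.page l).X j} (hx : X.IsCompatible k i x) (hx' : ∀ l, k < l → x l = 0)
    (hy : X.IsCompatible k j y) (hy' : ∀ l, k < l → y l = 0)
    (hxy : (X.page k).d i j (x k) = y k) :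
    ∃ p : X.nerveModule k i, p.1.1 = x ∧ p.1.2 ⟨j, h⟩ = y := by
  have huniq (j' : {j' // (pageShape k).Rel i j'}) : ⟨j, h⟩ = j' :=
    Subtype.ext ((pageShape k).next_eq h j'.2)
  refine ⟨⟨(x, fun j' l => (huniq j' ▸ y : ∀ l, (X.page l).X j'.1) l), hx', ?_, hx, ?_, ?_⟩, rfl, rfl⟩
  all_goals
    intro j'
    obtain rfl := huniq j'
    assumption

/-- It suffices to compare the components up to the index of the page, and the second sequence
at the one bidegree `j` which occurs. -/
lemma nerve_ext_of_rel {k : ℕ} {i j : ℤ × ℤ} (h : (pageShape k).Rel i j)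
    {p q : X.nerveModule k i} (h₁ : ∀ l ≤ k, p.1.1 l = q.1.1 l)
    (h₂ : ∀ l ≤ k, p.1.2 ⟨j, h⟩ l = q.1.2 ⟨j, h⟩ l) : p = q := by
  refine nerve_ext (fun l => ?_) fun j' l => ?_
  · obtain hl | hl := le_or_gt l k
    · exact h₁ l hl
    · rw [p.2.1 l hl, q.2.1 l hl]
  · obtain rfl : ⟨j, h⟩ = j' := Subtype.ext ((pageShape k).next_eq h j'.2)
    obtain hl | hl := le_or_gt l k
    · exact h₂ l hl
    · rw [p.2.2.1 _ l hl, q.2.2.1 _ l hl]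

/-- The map `N(X)_k ⟶ X_k` which takes a pair of compatible sequences to the last element of the
first one. -/
noncomputable def nerveπ (X : ESpSe R) (k : ℕ) : X.nervePage k ⟶ X.page k where
  f i := ModuleCat.ofHom
    (LinearMap.proj k ∘ₗ LinearMap.fst R _ _ ∘ₗ (X.nerveModule k i).subtype)
  comm' i j h := by
    refine ModuleCat.hom_ext (LinearMap.ext fun (p : X.nerveModule k i) => ?_)
    exact (p.2.2.2.2.2 ⟨j, h⟩).trans (nervePage_d_fst X h p k).symm

lemma nerveπ_surj (X : ESpSe R) (k : ℕ) : RBC.Surj (X.nerveπ k) := fun i a => by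
  obtain ⟨x, h₁, h₂, h₃⟩ := exists_isCompatible_of_top k a
  obtain ⟨y, h₁', h₂', h₃'⟩ := exists_isCompatible_of_top k ((X.page k).d i (RBC.succDeg k i) a)
  obtain ⟨p, hp, -⟩ := exists_nerve (RBC.rel_succDeg i) h₁ h₃ h₁' h₃' (by rw [h₂, h₂'])
  exact ⟨p, (congr_fun hp k).trans h₂⟩

/-- The nerve does not change the homology of the pages. -/
lemma weq_nerveπ (X : ESpSe R) (k : ℕ) : RBC.weq R k (X.nerveπ k) := by
  rw [RBC.weq_iff_of_surj (X.nerveπ_surj k)]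
  intro i j h (p : X.nerveModule k j) b hp hb
  obtain ⟨x, h₁, h₂, h₃⟩ := exists_isCompatible_of_top k b
  obtain ⟨q, hq, hq'⟩ := exists_nerve h h₁ h₃ p.2.2.2.1 p.2.1 (by rw [h₂, hb]; rfl)
  refine ⟨q, nerve_ext_of_rel (RBC.rel_succDeg j) (fun l _ => ?_) (fun l _ => ?_),
    (congr_fun hq k).trans h₂⟩
  · exact (nervePage_d_fst X h q l).trans (congr_fun hq' l)
  · have h' := congr_arg (fun t : X.nerveModule k _ => t.1.1 l) (hp (RBC.succDeg k j))
    refine Eq.trans ?_ (h'.symm.trans (nervePage_d_fst X (RBC.rel_succDeg j) p l))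
    change (toNerve ((X.nervePage k).d i j q)).1.2 _ l = _
    rw [nervePage_d X h]
    rfl

lemma nerveπ_naturality (f : X ⟶ Y) (k : ℕ) :
    nervePageMap f k ≫ Y.nerveπ k = X.nerveπ k ≫ Hom.page f k := rfl

/-- The nerve preserves and reflects weak equivalences, as it does not change the homology. -/
lemma weq_iff_nerve (r : ℕ) (f : X ⟶ Y) :
    weq R r f ↔ LWB.weq R r ((nerveFunctor R).map f) := by
  change RBC.weq R r (Hom.page f r) ↔ RBC.weq R r (nervePageMap f r)
  rw [← (RBC.weq R r).precomp_iff (X.nerveπ r) _ (X.weq_nerveπ r), ← nerveπ_naturality,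
    (RBC.weq R r).postcomp_iff _ (Y.nerveπ r) (Y.weq_nerveπ r)]

/-- The nerve preserves and reflects fibrations: compatible sequences lift along fibrations, and
`nerveπ` is surjective. -/
lemma fib_iff_nerve (r : ℕ) (f : X ⟶ Y) :
    fib R r f ↔ LWB.fib R r ((nerveFunctor R).map f) := by
  constructor
  · intro hf k hk i (p : Y.nerveModule k i)
    have hf' : ∀ l < k, RBC.Surj (Hom.page f l) := fun l hl => hf l (hl.le.trans hk)
    have hij := RBC.rel_succDeg (k := k) i
    obtain ⟨a, ha⟩ := hf k hk i (p.1.1 k)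
    obtain ⟨x, h₁, h₂, h₃, h₄⟩ := exists_isCompatible_of_surj f k hf' p.2.2.2.1 a ha
    obtain ⟨y, h₁', h₂', h₃', h₄'⟩ := exists_isCompatible_of_surj f k hf'
      (p.2.2.2.2.1 ⟨RBC.succDeg k i, hij⟩) ((X.page k).d i _ a) (by
        rw [RBC.comm_apply, ha]
        exact p.2.2.2.2.2 ⟨RBC.succDeg k i, hij⟩)
    obtain ⟨q, rfl, rfl⟩ := exists_nerve hij h₁ h₃ h₁' h₃' (by rw [h₂, h₂'])
    exact ⟨q, nerve_ext_of_rel hij h₄ h₄'⟩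
  · intro hf k hk i b
    obtain ⟨p, rfl⟩ := Y.nerveπ_surj k i b
    obtain ⟨q, rfl⟩ := hf k hk i p
    exact ⟨(X.nerveπ k).f i q, rfl⟩

/-- In a nerve, no nonzero degeneracy is a cycle, since the differential takes `(0; y)` to
`(y; 0)`. -/
lemma nerve_isDegenerateExact (X : ESpSe R) (r : ℕ) : X.nerve.IsDegenerateExact r := by
  intro n _ i (p : X.nerveModule n i) hp
  have : X.nerve.s n i p = 0 := by
    refine nerve_ext_of_rel (RBC.rel_succDeg (i + (1, 1))) (fun _ _ => rfl) fun l _ => ?_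
    have h := congr_arg (fun t : X.nerveModule (n + 1) _ => t.1.1 l)
      (hp (RBC.succDeg (n + 1) (i + (1, 1))))
    exact (nervePage_d_fst X (RBC.rel_succDeg _) (X.nerveS n i p) l).symm.trans h
  exact ⟨0, by rw [this, map_zero, map_zero]⟩

lemma toNerve_wIter {k n : ℕ} (h : n ≤ k) {i : ℤ × ℤ} (p : (X.nerve.page k).X i) {l : ℕ}
    (hl : l ≤ n) : (toNerve (X.nerve.wIter h i p)).1.1 l = (toNerve p).1.1 l := by
  induction h with
  | refl => rw [LWB.wIter_self]
  | step h ih =>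
    rw [LWB.wIter_succ _ h]
    exact (ih (X.nerve.w _ i p)).trans (if_pos (hl.trans h))

end ESpSe

/-! ### The left adjoint of the nerve -/

namespace LWB

variable {R : Type u} [CommRing R] (L : LWB R)

/-- The subcomplex of page `k` which is generated by the image of the degeneracy map. The bidegree
`i` is written as `(i - (1, 1)) + (1, 1)`, and `predDeg n i + (1, 1)` is the source of the
differential into bidegree `i` on page `n + 1`. -/
noncomputable def degen : ∀ (k : ℕ) (i : ℤ × ℤ), Submodule R ((L.page k).X i)
  | 0, _ => ⊥
  | n + 1, i =>
    LinearMap.range ((L.page (n + 1)).castX (sub_add_cancel i (1, 1)) ∘ₗ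
      (L.s n (i - (1, 1))).hom) ⊔
    LinearMap.range (((L.page (n + 1)).d (RBC.predDeg n i + (1, 1)) i).hom ∘ₗ
      (L.s n (RBC.predDeg n i)).hom)

/-- The degeneracy maps commute with transport of bidegrees. -/
lemma castX_s (n : ℕ) {i j : ℤ × ℤ} (h : j = i) (h' : j + (1, 1) = i + (1, 1))
    (x : (L.page n).X j) :
    (L.page (n + 1)).castX h' (L.s n j x) = L.s n i ((L.page n).castX h x) := by
  subst h
  rfl

lemma mem_degen_succ {n : ℕ} {i : ℤ × ℤ} {z : (L.page (n + 1)).X (i + (1, 1))} :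
    z ∈ L.degen (n + 1) (i + (1, 1)) ↔ ∃ x y, L.s n i x +
      (L.page (n + 1)).d (RBC.predDeg n (i + (1, 1)) + (1, 1)) (i + (1, 1)) (L.s n _ y) = z := by
  rw [degen, Submodule.mem_sup]
  constructor
  · rintro ⟨_, ⟨x, rfl⟩, _, ⟨y, rfl⟩, rfl⟩
    refine ⟨(L.page n).castX (add_sub_cancel_right i _) x, y, ?_⟩
    rw [← castX_s L n (add_sub_cancel_right i (1, 1)) (sub_add_cancel (i + (1, 1)) (1, 1))]
    rfl
  · rintro ⟨x, y, rfl⟩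
    refine ⟨_, ⟨(L.page n).castX (add_sub_cancel_right i _).symm x, rfl⟩, _, ⟨y, rfl⟩, ?_⟩
    refine congr_arg₂ (· + ·) ?_ rfl
    refine (castX_s L n (add_sub_cancel_right i (1, 1)) (sub_add_cancel (i + (1, 1)) (1, 1)) _).trans
      (congr_arg _ ?_)
    have : ∀ (j : ℤ × ℤ) (h : i = j) (h' : j = i),
        (L.page n).castX h' ((L.page n).castX h x) = x := by
      rintro _ rfl _
      rfl
    exact this _ _ _

lemma degen_induction {P : ∀ k i, (L.page k).X i → Prop} (h₀ : ∀ k i, P k i 0)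
    (h : ∀ n i x y, P (n + 1) (i + (1, 1)) (L.s n i x +
      (L.page (n + 1)).d (RBC.predDeg n (i + (1, 1)) + (1, 1)) (i + (1, 1)) (L.s n _ y))) :
    ∀ {k i}, ∀ z ∈ L.degen k i, P k i z := by
  intro k i z hz
  obtain _ | n := k
  · obtain rfl := (Submodule.mem_bot R).1 hz
    exact h₀ 0 i
  · obtain ⟨i, rfl⟩ : ∃ i', i = i' + (1, 1) := ⟨i - (1, 1), (sub_add_cancel _ _).symm⟩
    obtain ⟨x, y, rfl⟩ := L.mem_degen_succ.1 hz
    exact h n i x y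

lemma s_mem_degen (n : ℕ) (i : ℤ × ℤ) (x : (L.page n).X i) :
    L.s n i x ∈ L.degen (n + 1) (i + (1, 1)) :=
  L.mem_degen_succ.2 ⟨x, 0, by rw [map_zero, map_zero, add_zero]⟩

lemma d_s_mem_degen (n : ℕ) (i j : ℤ × ℤ) (x : (L.page n).X i) :
    (L.page (n + 1)).d (i + (1, 1)) j (L.s n i x) ∈ L.degen (n + 1) j := by
  by_cases h : (pageShape (n + 1)).Rel (i + (1, 1)) j
  · obtain rfl := (pageShape n).prev_eq (ESpSe.rel_of_rel_succ h) (RBC.predDeg_rel j)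
    exact Submodule.mem_sup_right ⟨x, rfl⟩
  · rw [RBC.d_apply_of_not_rel _ h]
    exact Submodule.zero_mem _

lemma d_mem_degen {k : ℕ} {i : ℤ × ℤ} (j : ℤ × ℤ) :
    ∀ z ∈ L.degen k i, (L.page k).d i j z ∈ L.degen k j := by
  refine L.degen_induction (P := fun k i z => (L.page k).d i j z ∈ L.degen k j)
    (fun k i => ?_) fun n i x y => ?_
  · rw [map_zero]
    exact Submodule.zero_mem _
  · rw [map_add, RBC.d_d_apply, add_zero]
    exact L.d_s_mem_degen n i j x

/-- The pages of the extended spectral sequence associated with a linear witness book. -/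
noncomputable def quotPage (k : ℕ) : RBC R k where
  X i := ModuleCat.of R ((L.page k).X i ⧸ L.degen k i)
  d i j := ModuleCat.ofHom (Submodule.mapQ _ _ ((L.page k).d i j).hom (L.d_mem_degen j))
  shape i j h := ModuleCat.hom_ext (Submodule.linearMap_qext _ (LinearMap.ext fun x => by
    change Submodule.Quotient.mk ((L.page k).d i j x) = 0
    rw [RBC.d_apply_of_not_rel _ h]
    rfl))
  d_comp_d' i j l _ _ := ModuleCat.hom_ext (Submodule.linearMap_qext _ (LinearMap.ext fun x => by
    change Submodule.Quotient.mk ((L.page k).d j l ((L.page k).d i j x)) = 0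
    rw [RBC.d_d_apply]
    rfl))

/-- The projection to the pages of the associated extended spectral sequence. -/
noncomputable def quotπ (k : ℕ) : L.page k ⟶ L.quotPage k where
  f i := ModuleCat.ofHom (L.degen k i).mkQ
  comm' _ _ _ := rfl

lemma quotπ_surj (k : ℕ) : RBC.Surj (L.quotπ k) := fun _ => Submodule.mkQ_surjective _

lemma quotπ_eq_zero_iff {k : ℕ} {i : ℤ × ℤ} {x : (L.page k).X i} :
    (L.quotπ k).f i x = 0 ↔ x ∈ L.degen k i := Submodule.Quotient.mk_eq_zero _

lemma isCycle_quotπ_w (k : ℕ) (i : ℤ × ℤ) (x : (L.page (k + 1)).X i) :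
    (L.page k).IsCycle i (L.w k i x) := fun j => L.d_w k i j x

/-- The characteristic maps of the associated extended spectral sequence, before passing to the
quotient: they take an element to the class of its witness. -/
noncomputable def preφ (k : ℕ) (i : ℤ × ℤ) :
    (L.page (k + 1)).X i ⟶ (L.quotPage k).homology i :=
  (L.quotPage k).liftCycles (L.w k i ≫ (L.quotπ k).f i) _ rfl (by
    refine ConcreteCategory.hom_ext _ _ fun x => ?_
    exact ((L.isCycle_quotπ_w k i x).map (L.quotπ k)) _) ≫ (L.quotPage k).homologyπ i

lemma preφ_apply (k : ℕ) (i : ℤ × ℤ) (x : (L.page (k + 1)).X i) :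
    L.preφ k i x = RBC.cls ((L.quotπ k).f i (L.w k i x))
      ((L.isCycle_quotπ_w k i x).map (L.quotπ k)) := by
  rw [preφ, ConcreteCategory.comp_apply, RBC.homologyπ_eq_cls]
  congr 1
  rw [← ConcreteCategory.comp_apply, HomologicalComplex.liftCycles_i]
  rfl

/-- The extended spectral sequence associated with a linear witness book. -/
noncomputable def quot : ESpSe R where
  page := L.quotPage
  φ k i := ModuleCat.ofHom (Submodule.liftQ _ (L.preφ k i).hom (by
    intro z hz
    obtain ⟨i, rfl⟩ : ∃ i', i = i' + (1, 1) := ⟨i - (1, 1), (sub_add_cancel _ _).symm⟩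
    obtain ⟨x, y, rfl⟩ := L.mem_degen_succ.1 hz
    change L.preφ k _ (_ + _) = 0
    rw [preφ_apply, RBC.cls_eq_zero_iff, map_add, w_s_apply, w_d_s, zero_add, RBC.comm_apply]
    exact RBC.isBdry_d _))

lemma quot_isWitness (k : ℕ) (i : ℤ × ℤ) (x : (L.page (k + 1)).X i) :
    L.quot.IsWitness k i ((L.quotπ (k + 1)).f i x) ((L.quotπ k).f i (L.w k i x)) :=
  ESpSe.isWitness_iff.2 ⟨(L.isCycle_quotπ_w k i x).map (L.quotπ k), (L.preφ_apply k i x).symm⟩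

/-- The sequence of the classes of the iterated witnesses of `x`. -/
noncomputable def quotSeq (k : ℕ) (i : ℤ × ℤ) :
    (L.page k).X i →ₗ[R] ∀ l : ℕ, (L.quotPage l).X i :=
  LinearMap.pi fun l => if h : l ≤ k then ((L.quotπ l).f i).hom ∘ₗ L.wIter h i else 0

lemma quotSeq_of_le {k l : ℕ} (h : l ≤ k) {i : ℤ × ℤ} (x : (L.page k).X i) :
    L.quotSeq k i x l = (L.quotπ l).f i (L.wIter h i x) := by
  change (dite (l ≤ k) _ _ : _ →ₗ[R] _) x = _
  rw [dif_pos h]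
  rfl

lemma quotSeq_self {k : ℕ} {i : ℤ × ℤ} (x : (L.page k).X i) :
    L.quotSeq k i x k = (L.quotπ k).f i x := by
  rw [quotSeq_of_le L le_rfl, wIter_self]

lemma quotSeq_of_lt {k l : ℕ} (h : k < l) {i : ℤ × ℤ} (x : (L.page k).X i) :
    L.quotSeq k i x l = 0 := by
  change (dite (l ≤ k) _ _ : _ →ₗ[R] _) x = _
  rw [dif_neg (not_le.2 h)]
  rfl

lemma quotSeq_w {k l : ℕ} (h : l ≤ k) {i : ℤ × ℤ} (x : (L.page (k + 1)).X i) :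
    L.quotSeq k i (L.w k i x) l = L.quotSeq (k + 1) i x l := by
  rw [quotSeq_of_le L h, quotSeq_of_le L (h.trans k.le_succ), wIter_succ]

lemma isCompatible_quotSeq {k : ℕ} {i : ℤ × ℤ} (x : (L.page k).X i) :
    L.quot.IsCompatible k i (L.quotSeq k i x) := fun l hl => by
  rw [quotSeq_of_le L hl, quotSeq_of_le L hl.le, ← w_wIter _ hl]
  exact L.quot_isWitness l i _

/-- The unit of the adjunction between linear witness books and extended spectral sequences, on
elements. -/
noncomputable def quotUnitX (k : ℕ) (i : ℤ × ℤ) : (L.page k).X i →ₗ[R] L.quot.nerveModule k i where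
  toFun x := ⟨(L.quotSeq k i x, fun j => L.quotSeq k j ((L.page k).d i j x)),
    fun _ hl => L.quotSeq_of_lt hl x, fun _ _ hl => L.quotSeq_of_lt hl _,
    L.isCompatible_quotSeq x, fun _ => L.isCompatible_quotSeq _, fun j => by
      change (L.quotPage k).d i j (L.quotSeq k i x k) =
        L.quotSeq k j ((L.page k).d i j x) k
      rw [quotSeq_self, quotSeq_self, RBC.comm_apply]⟩
  map_add' x y := ESpSe.nerve_ext (fun l => congr_fun (map_add (L.quotSeq k i) x y) l) fun j l => by
    change L.quotSeq k j ((L.page k).d i j (x + y)) l = _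
    rw [map_add, map_add]
    rfl
  map_smul' c x := ESpSe.nerve_ext (fun l => congr_fun (map_smul (L.quotSeq k i) c x) l)
    fun j l => congr_fun (map_smul (L.quotSeq k j ∘ₗ ((L.page k).d i j).hom) c x) l

/-- The unit of the adjunction between linear witness books and extended spectral sequences. -/
noncomputable def quotUnit : L ⟶ L.quot.nerve where
  page k :=
    { f := fun i => ModuleCat.ofHom (L.quotUnitX k i)
      comm' := fun i j h => by
        refine ModuleCat.hom_ext (LinearMap.ext fun x => ?_)
        change (L.quot.nervePage k).d i j (L.quotUnitX k i x) =
          L.quotUnitX k j ((L.page k).d i j x)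
        rw [ESpSe.nervePage_d _ h]
        refine ESpSe.nerve_ext (fun _ => rfl) fun j' l => ?_
        change 0 = L.quotSeq k j' ((L.page k).d j j' ((L.page k).d i j x)) l
        rw [RBC.d_d_apply, map_zero]
        rfl }
  comm_w k i := by
    refine ModuleCat.hom_ext (LinearMap.ext fun x => ?_)
    change L.quotUnitX k i (L.w k i x) = L.quot.nerveW k i (L.quotUnitX (k + 1) i x)
    refine ESpSe.nerve_ext (fun l => ?_) fun j l => ?_
    · change L.quotSeq k i (L.w k i x) l = if l ≤ k then L.quotSeq (k + 1) i x l else 0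
      split_ifs with h
      · exact L.quotSeq_w h x
      · exact L.quotSeq_of_lt (not_le.1 h) _
    · change L.quotSeq k j ((L.page k).d i j (L.w k i x)) l = 0
      rw [d_w, map_zero]
      rfl
  comm_s k i := by
    refine ModuleCat.hom_ext (LinearMap.ext fun x => ?_)
    change L.quotUnitX (k + 1) _ (L.s k i x) = L.quot.nerveS k i (L.quotUnitX k i x)
    refine ESpSe.nerve_ext (fun l => ?_) fun j l => ?_
    · change L.quotSeq (k + 1) _ (L.s k i x) l = 0
      obtain hl | hl := le_or_gt l (k + 1)
      · rw [quotSeq_of_le L hl]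
        obtain rfl | hl := hl.eq_or_lt
        · rw [wIter_self, quotπ_eq_zero_iff]
          exact L.s_mem_degen k i x
        · rw [wIter_succ _ (Nat.lt_succ_iff.1 hl), w_s_apply, map_zero, map_zero]
      · exact L.quotSeq_of_lt hl _
    · change L.quotSeq (k + 1) j ((L.page (k + 1)).d _ j (L.s k i x)) l =
        L.quotSeq k j ((L.page k).d i j x) l
      obtain hl | hl := le_or_gt l k
      · rw [← quotSeq_w L hl, w_d_s]
      · rw [L.quotSeq_of_lt hl]
        obtain rfl | hl := (Nat.succ_le_of_lt hl).eq_or_lt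
        · rw [quotSeq_self, quotπ_eq_zero_iff]
          exact L.d_s_mem_degen k i j x
        · exact L.quotSeq_of_lt hl _

lemma quotUnit_nerveπ (k : ℕ) : Hom.page L.quotUnit k ≫ L.quot.nerveπ k = L.quotπ k :=
  RBC.hom_ext_apply fun _ x => L.quotSeq_self x

variable {L} {X : ESpSe R}

/-- The page `k` of the map out of the associated extended spectral sequence given by a map to a
nerve. -/
noncomputable def quotDescPage (f : L ⟶ X.nerve) (k : ℕ) : L.quotPage k ⟶ X.page k where
  f i := ModuleCat.ofHom (Submodule.liftQ _ ((Hom.page f k).f i ≫ (X.nerveπ k).f i).hom (by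
    refine L.degen_induction
      (P := fun k i z => (X.nerveπ k).f i ((Hom.page f k).f i z) = 0)
      (fun k i => (congr_arg _ (map_zero _)).trans (map_zero _)) fun n i x y => ?_
    let g : L.page (n + 1) ⟶ X.page (n + 1) := Hom.page f (n + 1) ≫ X.nerveπ (n + 1)
    have hs (j) (z : (L.page n).X j) : g.f _ (L.s n j z) = 0 :=
      congr_arg ((X.nerveπ (n + 1)).f _) (map_s f n j z)
    change g.f _ (_ + _) = 0
    rw [map_add, RBC.comm_apply, hs, hs, map_zero, add_zero]))
  comm' i j _ := by
    refine ModuleCat.hom_ext (Submodule.linearMap_qext _ (LinearMap.ext fun x => ?_))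
    exact (RBC.comm_apply (Hom.page f k ≫ X.nerveπ k) i j x).symm

/-- The map out of the associated extended spectral sequence given by a map to a nerve. -/
noncomputable def quotDesc (f : L ⟶ X.nerve) : L.quot ⟶ X where
  page := quotDescPage f
  comm k i := by
    refine ConcreteCategory.hom_ext _ _ fun x => ?_
    obtain ⟨x, rfl⟩ := L.quotπ_surj (k + 1) i x
    refine (L.quot_isWitness k i x).homologyMap_φ (quotDescPage f k) (quotDescPage f (k + 1)) ?_
    have h : (X.nerveπ k).f i ((Hom.page f k).f i (L.w k i x)) =
        (ESpSe.toNerve ((Hom.page f (k + 1)).f i x)).1.1 k := by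
      rw [map_w]
      exact if_pos le_rfl
    have h' := (ESpSe.toNerve ((Hom.page f (k + 1)).f i x)).2.2.2.1 k k.lt_succ_self
    rw [← h] at h'
    exact h'

lemma quotDesc_π (f : L ⟶ X.nerve) (k : ℕ) (i : ℤ × ℤ) (x : (L.page k).X i) :
    (ESpSe.Hom.page (quotDesc f) k).f i ((L.quotπ k).f i x) =
      (ESpSe.toNerve ((Hom.page f k).f i x)).1.1 k := rfl

lemma quot_hom_ext {f g : L.quot ⟶ X}
    (h : ∀ k i x, (ESpSe.Hom.page f k).f i ((L.quotπ k).f i x) =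
      (ESpSe.Hom.page g k).f i ((L.quotπ k).f i x)) : f = g :=
  ESpSe.Hom.ext (funext fun k => RBC.hom_ext_apply fun i x => by
    obtain ⟨x, rfl⟩ := L.quotπ_surj k i x
    exact h k i x)

lemma quotUnit_desc (f : L ⟶ X.nerve) :
    L.quotUnit ≫ (ESpSe.nerveFunctor R).map (quotDesc f) = f := by
  have aux {k l : ℕ} (h : l ≤ k) (i : ℤ × ℤ) (x : (L.page k).X i) :
      (ESpSe.Hom.page (quotDesc f) l).f i (L.quotSeq k i x l) =
        (ESpSe.toNerve ((Hom.page f k).f i x)).1.1 l := by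
    rw [quotSeq_of_le L h]
    refine (quotDesc_π f l i _).trans ?_
    rw [map_wIter, ESpSe.toNerve_wIter h _ le_rfl]
  refine hom_ext_apply fun k i x => ?_
  refine ESpSe.nerve_ext_of_rel (RBC.rel_succDeg i) (fun l hl => aux hl i x) fun l hl => ?_
  refine (aux hl _ _).trans ?_
  rw [RBC.comm_apply]
  exact ESpSe.nervePage_d_fst X (RBC.rel_succDeg i) _ l

variable (L X) in
/-- The universal property of the associated extended spectral sequence. -/
noncomputable def quotEquiv : (L.quot ⟶ X) ≃ (L ⟶ (ESpSe.nerveFunctor R).obj X) where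
  toFun g := L.quotUnit ≫ (ESpSe.nerveFunctor R).map g
  invFun f := quotDesc f
  left_inv g := quot_hom_ext fun k i x => by
    refine (quotDesc_π _ k i x).trans ?_
    exact congr_arg ((ESpSe.Hom.page g k).f i) (L.quotSeq_self x)
  right_inv f := quotUnit_desc f

lemma quotEquiv_naturality (L : LWB R) (X Y : ESpSe R) (f : X ⟶ Y) (h : L.quot ⟶ X) :
    quotEquiv L Y (h ≫ f) = quotEquiv L X h ≫ (ESpSe.nerveFunctor R).map f :=
  (congr_arg (L.quotUnit ≫ ·) (Functor.map_comp _ _ _)).trans (Category.assoc _ _ _).symm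

variable (R) in
/-- The functor which takes a linear witness book to the associated extended spectral sequence. -/
noncomputable def quotFunctor : LWB R ⥤ ESpSe R :=
  Adjunction.leftAdjointOfEquiv quotEquiv quotEquiv_naturality

variable (R) in
/-- The associated extended spectral sequence is left adjoint to the nerve. -/
noncomputable def quotAdj : quotFunctor R ⊣ ESpSe.nerveFunctor R :=
  Adjunction.adjunctionOfEquivLeft quotEquiv quotEquiv_naturality

lemma quotAdj_homEquiv (f : (quotFunctor R).obj L ⟶ X) :
    (quotAdj R).homEquiv L X f = L.quotUnit ≫ (ESpSe.nerveFunctor R).map f := by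
  simp only [quotAdj, Adjunction.adjunctionOfEquivLeft]
  rfl

lemma quotAdj_counit_app (X : ESpSe R) : (quotAdj R).counit.app X = quotDesc (𝟙 X.nerve) := by
  apply ((quotAdj R).homEquiv _ _).injective
  refine Eq.trans ?_ (quotUnit_desc (𝟙 X.nerve)).symm
  exact ((quotAdj R).homEquiv_unit _ _ _).trans ((quotAdj R).right_triangle_components X)

/-- The homology of a linear witness book with exact degeneracies is the homology of the
associated extended spectral sequence. -/
lemma IsDegenerateExact.weq_quotπ {r : ℕ} (h : L.IsDegenerateExact r) :
    RBC.weq R r (L.quotπ r) := by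
  rw [RBC.weq_iff_of_surj (L.quotπ_surj r)]
  intro i j hij x y hx hy
  obtain ⟨y, rfl⟩ := L.quotπ_surj r i y
  rw [← RBC.comm_apply, ← sub_eq_zero, ← map_sub, quotπ_eq_zero_iff] at hy
  obtain _ | n := r
  · refine ⟨y, sub_eq_zero.1 ((Submodule.mem_bot R).1 hy), rfl⟩
  obtain ⟨j, rfl⟩ : ∃ j', j = j' + (1, 1) := ⟨j - (1, 1), (sub_add_cancel _ _).symm⟩
  obtain ⟨a, b, hab⟩ := L.mem_degen_succ.1 hy
  obtain ⟨i, rfl⟩ : ∃ i', i = i' + (1, 1) := ⟨i - (1, 1), (sub_add_cancel _ _).symm⟩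
  obtain rfl := (pageShape n).prev_eq (ESpSe.rel_of_rel_succ hij) (RBC.predDeg_rel _)
  have ha : L.s n j a = (L.page (n + 1)).d _ (j + (1, 1)) y - x -
      (L.page (n + 1)).d _ (j + (1, 1)) (L.s n _ b) := by
    rw [← hab, add_sub_cancel_right]
  obtain ⟨c, hc⟩ := h n rfl j a (by
    rw [ha]
    exact ((RBC.isBdry_d y).isCycle.sub hx).sub (RBC.isBdry_d _).isCycle)
  refine ⟨y - L.s n _ b - L.s n _ c, ?_, ?_⟩
  · rw [map_sub, map_sub, hc, ha]
    abel
  · rw [map_sub, map_sub, L.quotπ_eq_zero_iff.2 (L.s_mem_degen _ _ b),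
      L.quotπ_eq_zero_iff.2 (L.s_mem_degen _ _ c), sub_zero, sub_zero]

/-- The unit is a weak equivalence at a linear witness book with exact degeneracies. -/
lemma IsDegenerateExact.weq_quotUnit {r : ℕ} (h : L.IsDegenerateExact r) :
    weq R r L.quotUnit := by
  refine (RBC.weq R r).of_postcomp (Hom.page L.quotUnit r) (L.quot.nerveπ r)
    (L.quot.weq_nerveπ r) ?_
  rw [quotUnit_nerveπ]
  exact h.weq_quotπ

end LWB

namespace ESpSe

variable {R : Type u} [CommRing R] {X Y : ESpSe R}

/-- A compatible sequence `(y 0, …, y n, 0)` is the second component of an element of page `n` of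
the nerve, since `y n` is a boundary. -/
lemma exists_nerveS {n : ℕ} {i : ℤ × ℤ} (j : ℤ × ℤ) (h : (pageShape n).Rel i j)
    {y : ∀ l, (X.page l).X j}
    (hy : X.IsCompatible (n + 1) j y) (hy' : ∀ l, n < l → y l = 0) :
    ∃ p : X.nerveModule n i, p.1.2 ⟨j, h⟩ = y := by
  have hw := hy n n.lt_succ_self
  rw [hy' (n + 1) n.lt_succ_self, isWitness_zero_iff] at hw
  obtain ⟨a, ha⟩ := hw.exists_of_rel h
  obtain ⟨x, h₁, rfl, h₃⟩ := exists_isCompatible_of_top n a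
  obtain ⟨p, -, hp⟩ := exists_nerve h h₁ h₃ (hy.mono n.le_succ) hy' ha
  exact ⟨p, hp⟩

/-- The kernel of `nerveπ` is generated by degeneracies: if `x` and `y` end with zero, then
`(x; y) = s (a; y) + d s (b; x)` for suitable `a` and `b`. -/
lemma ker_nerveπ_le (X : ESpSe R) {k : ℕ} {i : ℤ × ℤ} (p : X.nerveModule k i) (hp : p.1.1 k = 0) :
    p ∈ X.nerve.degen k i := by
  have hy : p.1.2 ⟨_, RBC.rel_succDeg i⟩ k = 0 := by
    rw [← p.2.2.2.2.2, hp, map_zero]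
  obtain _ | n := k
  · rw [LWB.degen]
    refine nerve_ext_of_rel (q := 0) (RBC.rel_succDeg i) (fun l hl => ?_) fun l hl => ?_
    · obtain rfl := Nat.le_zero.1 hl
      exact hp
    · obtain rfl := Nat.le_zero.1 hl
      exact hy
  · obtain ⟨i, rfl⟩ : ∃ i', i = i' + (1, 1) := ⟨i - (1, 1), (sub_add_cancel _ _).symm⟩
    have hzero {j : ℤ × ℤ} {y : ∀ l, (X.page l).X j} (h₀ : y (n + 1) = 0)
        (h : ∀ l, n + 1 < l → y l = 0) (l : ℕ) (hl : n < l) : y l = 0 := by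
      obtain rfl | hl := (Nat.succ_le_of_lt hl).eq_or_lt
      · exact h₀
      · exact h l hl
    have hi := RBC.rel_succDeg (k := n + 1) (i + (1, 1))
    obtain ⟨a, ha⟩ := exists_nerveS (X := X) _ (rel_of_rel_succ hi) (p.2.2.2.2.1 ⟨_, hi⟩)
      (hzero hy (p.2.2.1 ⟨_, hi⟩))
    obtain ⟨b, hb⟩ := exists_nerveS (X := X) _ (RBC.predDeg_rel _) p.2.2.2.1 (hzero hp p.2.1)
    refine X.nerve.mem_degen_succ.2 ⟨a, b, ?_⟩
    have hb' : (pageShape (n + 1)).Rel (RBC.predDeg n (i + (1, 1)) + (1, 1)) (i + (1, 1)) := by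
      rw [RBC.rel_iff]
      simp only [Prod.fst_sub, Prod.snd_sub, Prod.fst_add, Prod.snd_add]
      push_cast
      omega
    refine (congr_arg (fun t => X.nerveS n i a + t)
      (nervePage_d X hb' (X.nerveS n _ b))).trans (nerve_ext_of_rel hi (fun l _ => ?_) fun l _ => ?_)
    · exact (zero_add _).trans (congr_fun hb l)
    · exact (add_zero _).trans (congr_fun ha l)

/-- The counit of the adjunction is an isomorphism, so that the nerve is fully faithful. -/
lemma isIso_quotDesc (X : ESpSe R) : IsIso (LWB.quotDesc (𝟙 X.nerve)) := by
  have h : ∀ k, IsIso (Hom.page (LWB.quotDesc (𝟙 X.nerve)) k) := fun k => by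
    have : ∀ i, IsIso ((Hom.page (LWB.quotDesc (𝟙 X.nerve)) k).f i) := fun i => by
      rw [ConcreteCategory.isIso_iff_bijective]
      constructor
      · rw [injective_iff_map_eq_zero]
        intro x hx
        obtain ⟨p, rfl⟩ := X.nerve.quotπ_surj k i x
        exact X.nerve.quotπ_eq_zero_iff.2 (X.ker_nerveπ_le p hx)
      · intro y
        obtain ⟨p, rfl⟩ := X.nerveπ_surj k i y
        exact ⟨(X.nerve.quotπ k).f i p, rfl⟩
    exact HomologicalComplex.Hom.isIso_of_components _
  refine ⟨{ page := fun k => inv (Hom.page (LWB.quotDesc (𝟙 X.nerve)) k), comm := fun k i => ?_ },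
    Hom.ext (funext fun k => IsIso.hom_inv_id _), Hom.ext (funext fun k => IsIso.inv_hom_id _)⟩
  have hc := Hom.comm (LWB.quotDesc (𝟙 X.nerve)) k i
  have h₁ := HomologicalComplex.congr_hom
    (IsIso.inv_hom_id (Hom.page (LWB.quotDesc (𝟙 X.nerve)) (k + 1))) i
  have h₂ : HomologicalComplex.homologyMap (Hom.page (LWB.quotDesc (𝟙 X.nerve)) k) i ≫
      HomologicalComplex.homologyMap (inv (Hom.page (LWB.quotDesc (𝟙 X.nerve)) k)) i = 𝟙 _ := by
    rw [← HomologicalComplex.homologyMap_comp, IsIso.hom_inv_id,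
      HomologicalComplex.homologyMap_id]
  rw [HomologicalComplex.comp_f, HomologicalComplex.id_f] at h₁
  rw [← Category.id_comp (X.φ k i), ← h₁, Category.assoc, Category.assoc, ← reassoc_of% hc, h₂,
    Category.comp_id]

instance : IsIso (LWB.quotAdj R).counit := by
  have : ∀ X, IsIso ((LWB.quotAdj R).counit.app X) := fun X => by
    rw [LWB.quotAdj_counit_app]
    exact isIso_quotDesc X
  exact NatIso.isIso_of_isIso_app _

noncomputable instance : Reflective (nerveFunctor R) where
  toFull := (LWB.quotAdj R).fullyFaithfulROfIsIsoCounit.full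
  toFaithful := (LWB.quotAdj R).fullyFaithfulROfIsIsoCounit.faithful
  L := LWB.quotFunctor R
  adj := LWB.quotAdj R

instance : HasLimits (ESpSe R) := hasLimits_of_reflective (nerveFunctor R)

end ESpSe

/-! ### Colimits and the model structure of extended spectral sequences -/

namespace ESpSe

variable {R : Type u} [CommRing R]

variable (R) in
/-- The functor which takes an extended spectral sequence to its `k`-page. -/
def pageFunctor (k : ℕ) : ESpSe R ⥤ RBC R k where
  obj X := X.page k
  map f := Hom.page f k

variable (R) in
/-- The characteristic maps, as natural transformations. -/
noncomputable def φNatTrans (k : ℕ) (i : ℤ × ℤ) :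
    pageFunctor R (k + 1) ⋙ HomologicalComplex.eval (ModuleCat.{u} R) (pageShape (k + 1)) i ⟶
      pageFunctor R k ⋙ HomologicalComplex.homologyFunctor (ModuleCat.{u} R) (pageShape k) i where
  app X := X.φ k i
  naturality _ _ f := (Hom.comm f k i).symm

section Colimits

variable {J : Type u} [SmallCategory J] (F : J ⥤ ESpSe R)

/-- The pages of a colimit of extended spectral sequences. -/
noncomputable def colimitPage (k : ℕ) : RBC R k := colimit (F ⋙ pageFunctor R k)

/-- The maps to the pages of a colimit of extended spectral sequences. -/
noncomputable def colimitPageι (k : ℕ) (j : J) : (F.obj j).page k ⟶ colimitPage F k :=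
  colimit.ι (F ⋙ pageFunctor R k) j

/-- The pages of the map from a colimit of extended spectral sequences given by a cocone. -/
noncomputable def colimitPageDesc (c : Cocone F) (k : ℕ) : colimitPage F k ⟶ c.pt.page k :=
  colimit.desc _ ((pageFunctor R k).mapCocone c)

lemma ι_colimitPageDesc (c : Cocone F) (k : ℕ) (j : J) :
    colimitPageι F k j ≫ colimitPageDesc F c k =
      Hom.page (X := F.obj j) (Y := c.pt) (c.ι.app j) k :=
  colimit.ι_desc ((pageFunctor R k).mapCocone c) j

/-- The characteristic maps of a colimit of extended spectral sequences. -/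
noncomputable def colimitφ (k : ℕ) (i : ℤ × ℤ) :
    (colimitPage F (k + 1)).X i ⟶ (colimitPage F k).homology i :=
  IsColimit.map (RBC.isColimitEval (colimit.isColimit (F ⋙ pageFunctor R (k + 1))) i)
    ((HomologicalComplex.homologyFunctor (ModuleCat.{u} R) (pageShape k) i).mapCocone
      (colimit.cocone (F ⋙ pageFunctor R k))) (Functor.whiskerLeft F (φNatTrans R k i))

lemma ι_colimitφ (k : ℕ) (i : ℤ × ℤ) (j : J) :
    (colimitPageι F (k + 1) j).f i ≫ colimitφ F k i =
      (F.obj j).φ k i ≫ HomologicalComplex.homologyMap (colimitPageι F k j) i :=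
  IsColimit.ι_map (RBC.isColimitEval (colimit.isColimit (F ⋙ pageFunctor R (k + 1))) i) _ _ j

lemma colimit_hom_ext {k : ℕ} {i : ℤ × ℤ} {M : ModuleCat.{u} R}
    {f g : (colimitPage F k).X i ⟶ M}
    (h : ∀ j, (colimitPageι F k j).f i ≫ f = (colimitPageι F k j).f i ≫ g) : f = g :=
  (RBC.isColimitEval (colimit.isColimit (F ⋙ pageFunctor R k)) i).hom_ext h

/-- The colimit of a diagram of extended spectral sequences. -/
noncomputable def colimitObj : ESpSe R where
  page := colimitPage F
  φ := colimitφ F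

/-- The colimit cocone of a diagram of extended spectral sequences. -/
noncomputable def colimitCocone : Cocone F where
  pt := colimitObj F
  ι :=
    { app j :=
        { page := fun k => colimitPageι F k j
          comm := fun k i => (ι_colimitφ F k i j).symm }
      naturality := fun j j' f => by
        refine Hom.ext (funext fun k => ?_)
        exact (colimit.w (F ⋙ pageFunctor R k) f).trans (Category.comp_id _).symm }

/-- Colimits of extended spectral sequences are computed on each page. -/
noncomputable def isColimitColimitCocone : IsColimit (colimitCocone F) where
  desc c :=
    { page := colimitPageDesc F c
      comm := fun k i => colimit_hom_ext F fun j => by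
        change (colimitPageι F (k + 1) j).f i ≫ colimitφ F k i ≫
          HomologicalComplex.homologyMap (K := colimitPage F k) (colimitPageDesc F c k) i =
            _ ≫ (colimitPageDesc F c (k + 1)).f i ≫ _
        rw [reassoc_of% ι_colimitφ F, ← HomologicalComplex.homologyMap_comp, ι_colimitPageDesc,
          ← HomologicalComplex.comp_f_assoc, ι_colimitPageDesc]
        exact Hom.comm (c.ι.app j) k i }
  fac c j := Hom.ext (funext fun k => ι_colimitPageDesc F c k j)
  uniq c m hm := Hom.ext (funext fun k => colimit.hom_ext fun j => by
    exact (congr_arg (fun f => Hom.page f k) (hm j)).trans (ι_colimitPageDesc F c k j).symm)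

instance : HasColimits (ESpSe R) where
  has_colimits_of_shape _ _ := ⟨fun F => ⟨⟨_, isColimitColimitCocone F⟩⟩⟩

instance (k : ℕ) : PreservesColimitsOfShape J (pageFunctor R k) where
  preservesColimit {F} := preservesColimit_of_preserves_colimit_cocone (isColimitColimitCocone F)
    (colimit.isColimit (F ⋙ pageFunctor R k))

end Colimits

section Filtered

variable {J : Type u} [SmallCategory J] {G : J ⥤ ESpSe R} {c : Cocone G}

/-- The action of a transition map of a diagram on elements. -/
def stageMap (G : J ⥤ ESpSe R) {j j' : J} (f : j ⟶ j') (k : ℕ) (i : ℤ × ℤ) :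
    ((G.obj j).page k).X i →ₗ[R] ((G.obj j').page k).X i :=
  ((Hom.page (X := G.obj j) (Y := G.obj j') (G.map f) k).f i).hom

/-- The action of a map of a cocone on elements. -/
def leg (c : Cocone G) (j : J) (k : ℕ) (i : ℤ × ℤ) :
    ((G.obj j).page k).X i →ₗ[R] (c.pt.page k).X i :=
  ((Hom.page (X := G.obj j) (Y := c.pt) (c.ι.app j) k).f i).hom

lemma stageMap_comp {j j' j'' : J} (f : j ⟶ j') (g : j' ⟶ j'') (k : ℕ) (i : ℤ × ℤ)
    (x : ((G.obj j).page k).X i) : stageMap G (f ≫ g) k i x = stageMap G g k i (stageMap G f k i x) := by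
  have h : Hom.page (X := G.obj j) (Y := G.obj j'') (G.map (f ≫ g)) k =
      Hom.page (X := G.obj j) (Y := G.obj j') (G.map f) k ≫
        Hom.page (X := G.obj j') (Y := G.obj j'') (G.map g) k := by
    rw [G.map_comp]
    rfl
  exact ConcreteCategory.congr_hom (HomologicalComplex.congr_hom h i) x

lemma leg_stageMap (c : Cocone G) {j j' : J} (f : j ⟶ j') (k : ℕ) (i : ℤ × ℤ)
    (x : ((G.obj j).page k).X i) : leg c j' k i (stageMap G f k i x) = leg c j k i x := by
  have h : Hom.page (X := G.obj j) (Y := G.obj j') (G.map f) k ≫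
      Hom.page (X := G.obj j') (Y := c.pt) (c.ι.app j') k =
        Hom.page (X := G.obj j) (Y := c.pt) (c.ι.app j) k := by
    rw [← c.w f]
    rfl
  exact ConcreteCategory.congr_hom (HomologicalComplex.congr_hom h i) x

lemma stageMap_d {j j' : J} (f : j ⟶ j') (k : ℕ) (i i' : ℤ × ℤ) (x : ((G.obj j).page k).X i) :
    stageMap G f k i' (((G.obj j).page k).d i i' x) = ((G.obj j').page k).d i i' (stageMap G f k i x) :=
  RBC.comm_apply _ _ _ x

lemma leg_d (j : J) (k : ℕ) (i i' : ℤ × ℤ) (x : ((G.obj j).page k).X i) :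
    leg c j k i' (((G.obj j).page k).d i i' x) = (c.pt.page k).d i i' (leg c j k i x) :=
  RBC.comm_apply _ _ _ x

lemma IsWitness.stageMap {j j' : J} (f : j ⟶ j') {k : ℕ} {i : ℤ × ℤ}
    {a : ((G.obj j).page (k + 1)).X i} {b : ((G.obj j).page k).X i}
    (h : (G.obj j).IsWitness k i a b) :
    (G.obj j').IsWitness k i (stageMap G f (k + 1) i a) (stageMap G f k i b) := h.map (G.map f)

variable [IsFiltered J]

lemma exists_leg (hc : IsColimit c) {k : ℕ} {i : ℤ × ℤ} (x : (c.pt.page k).X i) :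
    ∃ j y, leg c j k i y = x :=
  RBC.exists_rep (isColimitOfPreserves (pageFunctor R k) hc) x

lemma exists_stageMap_eq (hc : IsColimit c) {k : ℕ} {i : ℤ × ℤ} {j : J}
    {x y : ((G.obj j).page k).X i} (h : leg c j k i x = leg c j k i y) :
    ∃ (j' : J) (f : j ⟶ j'), stageMap G f k i x = stageMap G f k i y :=
  RBC.exists_map_eq (isColimitOfPreserves (pageFunctor R k) hc) h

/-- A boundary in a filtered colimit is a boundary at some stage. -/
lemma exists_isBdry_stageMap (hc : IsColimit c) {k : ℕ} {i : ℤ × ℤ} {j : J}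
    {x : ((G.obj j).page k).X i} (hx : (c.pt.page k).IsBdry i (leg c j k i x)) :
    ∃ (j' : J) (f : j ⟶ j'), ((G.obj j').page k).IsBdry i (stageMap G f k i x) := by
  obtain ⟨i', y, hy⟩ := hx
  obtain ⟨j₁, y, rfl⟩ := exists_leg hc y
  have h : leg c (IsFiltered.max j j₁) k i (stageMap G (IsFiltered.leftToMax j j₁) k i x) =
      leg c _ k i (((G.obj (IsFiltered.max j j₁)).page k).d i' i
        (stageMap G (IsFiltered.rightToMax j j₁) k i' y)) := by
    rw [leg_stageMap, leg_d, leg_stageMap, hy]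
  obtain ⟨j₂, f, hf⟩ := exists_stageMap_eq hc h
  refine ⟨j₂, IsFiltered.leftToMax j j₁ ≫ f, i',
    stageMap G f k i' (stageMap G (IsFiltered.rightToMax j j₁) k i' y), ?_⟩
  rw [stageMap_comp, hf, stageMap_d]

/-- A witness relation in a filtered colimit holds at some stage. -/
lemma exists_isWitness_stageMap (hc : IsColimit c) {k : ℕ} {i : ℤ × ℤ} {j : J}
    {a : ((G.obj j).page (k + 1)).X i} {b : ((G.obj j).page k).X i}
    (h : c.pt.IsWitness k i (leg c j (k + 1) i a) (leg c j k i b)) :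
    ∃ (j' : J) (f : j ⟶ j'),
      (G.obj j').IsWitness k i (stageMap G f (k + 1) i a) (stageMap G f k i b) := by
  obtain ⟨b', hb'⟩ := exists_isWitness a
  have h' : (c.pt.page k).IsBdry i (leg c j k i (b - b')) := by
    rw [map_sub]
    exact h.isBdry_sub (hb'.map (c.ι.app j))
  obtain ⟨j', f, hf⟩ := exists_isBdry_stageMap hc h'
  refine ⟨j', f, ?_⟩
  rw [map_sub] at hf
  simpa using (hb'.stageMap f).add_isBdry hf

/-- Compatible sequences in a filtered colimit come from some stage. -/
lemma exists_isCompatible_leg (hc : IsColimit c) {i : ℤ × ℤ} (n : ℕ) {x : ∀ k, (c.pt.page k).X i}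
    (hx : c.pt.IsCompatible n i x) :
    ∃ (j : J) (y : ∀ k, ((G.obj j).page k).X i), (G.obj j).IsCompatible n i y ∧
      ∀ k ≤ n, leg c j k i (y k) = x k := by
  induction n with
  | zero =>
    obtain ⟨j, y, hy⟩ := exists_leg hc (x 0)
    refine ⟨j, Function.update 0 0 y, fun l hl => absurd hl l.not_lt_zero, fun k hk => ?_⟩
    obtain rfl := Nat.le_zero.1 hk
    rw [Function.update_self, hy]
  | succ n ih =>
    obtain ⟨j, y, hy, hy'⟩ := ih (hx.mono n.le_succ)
    obtain ⟨j₁, a, ha⟩ := exists_leg hc (x (n + 1))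
    obtain ⟨j₂, f, hf⟩ := exists_isWitness_stageMap hc
      (a := stageMap G (IsFiltered.rightToMax j j₁) (n + 1) i a)
      (b := stageMap G (IsFiltered.leftToMax j j₁) n i (y n)) (by
        rw [leg_stageMap, leg_stageMap, ha, hy' n le_rfl]
        exact hx n n.lt_succ_self)
    rw [← stageMap_comp, ← stageMap_comp] at hf
    have hy₂ : (G.obj j₂).IsCompatible n i
        fun k => stageMap G (IsFiltered.leftToMax j j₁ ≫ f) k i (y k) :=
      fun l hl => (hy l hl).stageMap _
    refine ⟨j₂, _, hy₂.update hf, fun k hk => ?_⟩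
    obtain rfl | hk := hk.eq_or_lt
    · rw [Function.update_self, leg_stageMap, ha]
    · rw [Function.update_of_ne hk.ne, leg_stageMap, hy' k (Nat.lt_succ_iff.1 hk)]

/-- Finite sequences which become equal in a filtered colimit become equal at some stage. -/
lemma exists_stageMap_eq_seq (hc : IsColimit c) {i : ℤ × ℤ} (n : ℕ) {j : J}
    {x y : ∀ k, ((G.obj j).page k).X i}
    (h : ∀ k ≤ n, leg c j k i (x k) = leg c j k i (y k)) :
    ∃ (j' : J) (f : j ⟶ j'), ∀ k ≤ n, stageMap G f k i (x k) = stageMap G f k i (y k) := by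
  induction n with
  | zero =>
    obtain ⟨j', f, hf⟩ := exists_stageMap_eq hc (h 0 le_rfl)
    refine ⟨j', f, fun k hk => ?_⟩
    obtain rfl := Nat.le_zero.1 hk
    exact hf
  | succ n ih =>
    obtain ⟨j₁, f, hf⟩ := ih fun k hk => h k (hk.trans n.le_succ)
    obtain ⟨j₂, g, hg⟩ := exists_stageMap_eq hc (x := stageMap G f (n + 1) i (x (n + 1)))
      (y := stageMap G f (n + 1) i (y (n + 1))) (by rw [leg_stageMap, leg_stageMap, h _ le_rfl])
    refine ⟨j₂, f ≫ g, fun k hk => ?_⟩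
    rw [stageMap_comp, stageMap_comp]
    obtain rfl | hk := hk.eq_or_lt
    · exact hg
    · rw [hf k (Nat.lt_succ_iff.1 hk)]

/-- Elements of a page of a nerve which become equal in a filtered colimit become equal at some
stage. -/
lemma exists_nerveModuleMap_eq (hc : IsColimit c) {r : ℕ} {i : ℤ × ℤ} {j : J}
    {p q : (G.obj j).nerveModule r i}
    (h : nerveModuleMap (Y := c.pt) (c.ι.app j) r i p = nerveModuleMap (c.ι.app j) r i q) :
    ∃ (j' : J) (f : j ⟶ j'), nerveModuleMap (G.map f) r i p = nerveModuleMap (G.map f) r i q := by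
  have hi := RBC.rel_succDeg (k := r) i
  obtain ⟨j₁, f, hf⟩ := exists_stageMap_eq_seq hc r (x := p.1.1) (y := q.1.1)
    fun k _ => congr_arg (fun t : c.pt.nerveModule r i => t.1.1 k) h
  obtain ⟨j₂, g, hg⟩ := exists_stageMap_eq_seq hc r (x := fun k => stageMap G f k _ (p.1.2 ⟨_, hi⟩ k))
    (y := fun k => stageMap G f k _ (q.1.2 ⟨_, hi⟩ k)) fun k _ => by
      rw [leg_stageMap, leg_stageMap]
      exact congr_arg (fun t : c.pt.nerveModule r i => t.1.2 ⟨_, hi⟩ k) h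
  refine ⟨j₂, f ≫ g, nerve_ext_of_rel hi (fun l hl => ?_) fun l hl => ?_⟩
  · change stageMap G (f ≫ g) l i (p.1.1 l) = stageMap G (f ≫ g) l i (q.1.1 l)
    rw [stageMap_comp, stageMap_comp, hf l hl]
  · change stageMap G (f ≫ g) l _ (p.1.2 ⟨_, hi⟩ l) = stageMap G (f ≫ g) l _ (q.1.2 ⟨_, hi⟩ l)
    rw [stageMap_comp, stageMap_comp, hg l hl]

/-- Cycles on a page of the nerve of a filtered colimit come from some stage. -/
lemma exists_nerveModuleMap_eq_of_isCycle (hc : IsColimit c) {r : ℕ} {i : ℤ × ℤ}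
    {p : c.pt.nerveModule r i} (hp : (c.pt.nervePage r).IsCycle i p) :
    ∃ (j : J) (q : (G.obj j).nerveModule r i), ((G.obj j).nervePage r).IsCycle i q ∧
      nerveModuleMap (c.ι.app j) r i q = p := by
  have hi := RBC.rel_succDeg (k := r) i
  have hp' (l : ℕ) : p.1.2 ⟨_, hi⟩ l = 0 :=
    (nervePage_d_fst c.pt hi p l).symm.trans
      (congr_arg (fun t : c.pt.nerveModule r _ => t.1.1 l) (hp _))
  obtain ⟨j, x, hx, hx'⟩ := exists_isCompatible_leg hc r p.2.2.2.1
  obtain ⟨j', f, hf⟩ := exists_stageMap_eq hc (x := ((G.obj j).page r).d i (RBC.succDeg r i) (x r))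
    (y := 0) (by
      rw [leg_d, hx' r le_rfl, map_zero]
      exact (p.2.2.2.2.2 ⟨_, hi⟩).trans (hp' r))
  obtain ⟨y, hy⟩ : ∃ y : ∀ l, ((G.obj j').page l).X i,
      y = fun l => if l ≤ r then stageMap G f l i (x l) else 0 := ⟨_, rfl⟩
  have hy₁ (l) (hl : l ≤ r) : y l = stageMap G f l i (x l) := by rw [hy]; exact if_pos hl
  have hy₂ (l) (hl : r < l) : y l = 0 := by rw [hy]; exact if_neg (not_le.2 hl)
  have hyc : (G.obj j').IsCompatible r i fun l => stageMap G f l i (x l) :=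
    fun l hl => (hx l hl).stageMap f
  obtain ⟨q, hq, hq'⟩ := exists_nerve (X := G.obj j') hi (y := 0)
    (hyc.congr fun l hl => (hy₁ l hl).symm) hy₂ (fun l _ => IsWitness.zero _ _ _)
    (fun _ _ => rfl) (by
      rw [hy₁ r le_rfl, ← stageMap_d, hf, map_zero]
      rfl)
  refine ⟨j', q, RBC.isCycle_of_rel hi ?_, nerve_ext_of_rel hi (fun l hl => ?_) fun l hl => ?_⟩
  · refine (nervePage_d _ hi q).trans (nerve_ext (fun l => ?_) fun _ _ => rfl)
    exact congr_fun hq' l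
  · change leg c j' l i (q.1.1 l) = _
    rw [hq, hy₁ l hl, leg_stageMap, hx' l hl]
  · change leg c j' l _ (q.1.2 ⟨_, hi⟩ l) = _
    rw [hq', hp' l]
    exact map_zero _

end Filtered

/-- Every map of extended spectral sequences factors as a weak equivalence followed by a
fibration: one applies the left adjoint of the nerve to a factorization of the map of nerves. -/
lemma exists_factorization (r : ℕ) {X Y : ESpSe R} (f : X ⟶ Y) :
    ∃ (Z : ESpSe R) (j : X ⟶ Z) (p : Z ⟶ Y), j ≫ p = f ∧ weq R r j ∧ fib R r p := by
  obtain ⟨Z, j, p, h₁, h₂, h₃, h₄⟩ :=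
    LWB.exists_factorization r (K := X.nerve) (L := Y.nerve) ((nerveFunctor R).map f)
  have := isIso_quotDesc X
  let e : X.nerve.quot ⟶ X := LWB.quotDesc (𝟙 X.nerve)
  let j' : X.nerve.quot ⟶ Z.quot := LWB.quotDesc (j ≫ Z.quotUnit)
  have hj' (k : ℕ) : X.nerve.quotπ k ≫ Hom.page j' k = LWB.Hom.page j k ≫ Z.quotπ k :=
    RBC.hom_ext_apply fun i x => Z.quotSeq_self ((LWB.Hom.page j k).f i x)
  refine ⟨Z.quot, inv e ≫ j', LWB.quotDesc p, ?_, ?_, ?_⟩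
  · rw [Category.assoc, IsIso.inv_comp_eq]
    refine LWB.quot_hom_ext fun k i x => ?_
    have hx := ConcreteCategory.congr_hom (HomologicalComplex.congr_hom (hj' k) i) x
    refine (congr_arg ((Hom.page (LWB.quotDesc p) k).f i) hx).trans ?_
    refine (LWB.quotDesc_π p k i _).trans ?_
    have := congr_arg (fun g => LWB.Hom.page (K := X.nerve) (L := Y.nerve) g k) h₁
    exact congr_arg (fun t => (toNerve t).1.1 k)
      (ConcreteCategory.congr_hom (HomologicalComplex.congr_hom this i) x)
  · have h₅ : RBC.weq R r (Hom.page j' r) := by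
      refine (RBC.weq R r).of_precomp (X.nerve.quotπ r) _
        (X.nerve_isDegenerateExact r).weq_quotπ ?_
      rw [hj']
      exact (RBC.weq R r).comp_mem _ _ h₂ (h₄ (X.nerve_isDegenerateExact r)).weq_quotπ
    have : IsIso (Hom.page (inv e) r) := inferInstanceAs (IsIso ((pageFunctor R r).map (inv e)))
    exact (RBC.weq R r).comp_mem _ _ (RBC.weq_of_isIso (Hom.page (inv e) r)) h₅
  · intro k hk i y
    obtain ⟨y, rfl⟩ := Y.nerveπ_surj k i y
    obtain ⟨z, rfl⟩ := h₃ k hk i y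
    exact ⟨(Z.quotπ k).f i z, rfl⟩

/-- The model structure on extended spectral sequences. -/
lemma exists_modelCategory (R : Type u) [CommRing R] (r : ℕ) :
    ∃ _ : ModelCategory (ESpSe R), IsCofibrantlyGenerated (ESpSe R) ∧
      fibrations (ESpSe R) = fib R r ∧ weakEquivalences (ESpSe R) = weq R r := by
  obtain ⟨h, h₁, h₂, h₃⟩ := exists_modelCategory_of_adjunctions (ι := Fin (r + 1)) (fun a => a.1)
    (fun a => nerveFunctor R ⋙ LWB.pageFunctor R a.1)
    (fun a => LWB.freeFunctor R a.1 ⋙ LWB.quotFunctor R)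
    (fun a => (LWB.freeAdj R a.1).comp (LWB.quotAdj R)) (Fin.last r)
    (fun J _ _ G c hc i x hx => exists_nerveModuleMap_eq_of_isCycle hc hx)
    (fun J _ _ G c hc i j x y hxy => exists_nerveModuleMap_eq hc hxy)
    (fun X Y f => by
      obtain ⟨Z, j, p, h₁, h₂, h₃⟩ := exists_factorization r f
      exact ⟨Z, j, p, h₁, (weq_iff_nerve r j).1 h₂,
        fun a => (fib_iff_nerve r p).1 h₃ a (Nat.lt_succ_iff.1 a.2)⟩)
  refine ⟨h, h₁, h₂.trans ?_, h₃.trans ?_⟩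
  · ext X Y f
    rw [fib_iff_nerve]
    exact ⟨fun hf k hk => hf ⟨k, Nat.lt_succ_iff.2 hk⟩, fun hf a => hf a (Nat.lt_succ_iff.1 a.2)⟩
  · ext X Y f
    exact (weq_iff_nerve r f).symm

end ESpSe

/-! ### Quillen equivalences -/

section QuillenEquivalences

variable {C : Type u} [Category.{v} C] [ModelCategory C]

/-- Trivial fibrations onto a cofibrant object have sections. -/
lemma exists_section_of_isCofibrant {L Z : C} (hL : IsCofibrant L) (p : Z ⟶ L)
    (hp : trivialFibrations C p) : ∃ i : L ⟶ Z, i ≫ p = 𝟙 L := by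
  have : Fibration p := ⟨hp.1⟩
  have : WeakEquivalence p := ⟨hp.2⟩
  have sq : CommSq (initial.to Z) (initial.to L) p (𝟙 L) := ⟨initial.hom_ext _ _⟩
  exact ⟨sq.lift, sq.fac_right⟩

/-- If the right adjoint preserves fibrations, preserves and reflects weak equivalences, and the
unit at cofibrant objects is a weak equivalence, then the adjunction is a Quillen equivalence. -/
lemma IsQuillenEquivalence.of_unit {D : Type u'} [Category.{v'} D] [ModelCategory D] {F : C ⥤ D}
    {G : D ⥤ C} (adj : F ⊣ G)
    (hfib : ∀ {X Y : D} (f : X ⟶ Y), fibrations D f → fibrations C (G.map f))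
    (hweq : ∀ {X Y : D} (f : X ⟶ Y), weakEquivalences D f ↔ weakEquivalences C (G.map f))
    (hunit : ∀ X : C, IsCofibrant X → weakEquivalences C (adj.unit.app X)) :
    IsQuillenEquivalence adj where
  fibration_map f hf := hfib f hf
  trivialFibration_map f hf := ⟨hfib f hf.1, (hweq f).1 hf.2⟩
  weakEquivalence_iff {X Y} f hX _ := by
    rw [adj.homEquiv_unit, hweq]
    exact ((weakEquivalences C).precomp_iff _ _ (hunit X hX)).symm

end QuillenEquivalences

theorem theoremT (R : Type u) [CommRing R] (r : ℕ) :
    -- the projective model structure on `r`-bigraded complexes, the model structure `lwb_r` on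
    -- linear witness books, and the model structure `espse_r` on extended spectral sequences
    ∃ (_ : ModelCategory (RBC R r)) (_ : ModelCategory (LWB R)) (_ : ModelCategory (ESpSe R)),
      (IsCofibrantlyGenerated (RBC R r) ∧
        fibrations (RBC R r) = RBC.fib R r ∧ weakEquivalences (RBC R r) = RBC.weq R r) ∧
      (IsCofibrantlyGenerated (LWB R) ∧
        fibrations (LWB R) = LWB.fib R r ∧ weakEquivalences (LWB R) = LWB.weq R r) ∧
      (IsCofibrantlyGenerated (ESpSe R) ∧
        fibrations (ESpSe R) = ESpSe.fib R r ∧ weakEquivalences (ESpSe R) = ESpSe.weq R r) ∧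
      -- `espse_r` is right-transferred from `lwb_r` along `N`
      (fibrations (ESpSe R) = (fibrations (LWB R)).inverseImage (ESpSe.nerveFunctor R) ∧
        weakEquivalences (ESpSe R) =
          (weakEquivalences (LWB R)).inverseImage (ESpSe.nerveFunctor R)) ∧
      -- the Quillen equivalences with `lwb_r` and with `r`-bigraded complexes
      ∃ (Q : LWB R ⥤ ESpSe R) (adjQ : Q ⊣ ESpSe.nerveFunctor R)
        (F : RBC R r ⥤ LWB R) (adjF : F ⊣ LWB.pageFunctor R r),
        IsQuillenEquivalence adjQ ∧ IsQuillenEquivalence adjF ∧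
          IsQuillenEquivalence (adjF.comp adjQ) := by
  obtain ⟨m₁, g₁, hf₁, hw₁⟩ := RBC.exists_modelCategory R r
  obtain ⟨m₂, g₂, hf₂, hw₂⟩ := LWB.exists_modelCategory R r
  obtain ⟨m₃, g₃, hf₃, hw₃⟩ := ESpSe.exists_modelCategory R r
  have hfN {X Y : ESpSe R} (f : X ⟶ Y) :
      fibrations (ESpSe R) f ↔ fibrations (LWB R) ((ESpSe.nerveFunctor R).map f) := by
    rw [hf₃, hf₂]
    exact ESpSe.fib_iff_nerve r f
  have hwN {X Y : ESpSe R} (f : X ⟶ Y) :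
      weakEquivalences (ESpSe R) f ↔ weakEquivalences (LWB R) ((ESpSe.nerveFunctor R).map f) := by
    rw [hw₃, hw₂]
    exact ESpSe.weq_iff_nerve r f
  have hfU {K L : LWB R} (f : K ⟶ L) (hf : fibrations (LWB R) f) :
      fibrations (RBC R r) ((LWB.pageFunctor R r).map f) := by
    rw [hf₂] at hf
    rw [hf₁]
    exact hf r le_rfl
  have hwU {K L : LWB R} (f : K ⟶ L) :
      weakEquivalences (LWB R) f ↔ weakEquivalences (RBC R r) ((LWB.pageFunctor R r).map f) := by
    rw [hw₂, hw₁]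
    rfl
  have hQ (L : LWB R) (hL : L.IsDegenerateExact r) :
      weakEquivalences (LWB R) ((LWB.quotAdj R).unit.app L) := by
    have : (LWB.quotAdj R).unit.app L = L.quotUnit := by
      rw [← (LWB.quotAdj R).homEquiv_id, LWB.quotAdj_homEquiv]
      exact (congr_arg (L.quotUnit ≫ ·) ((ESpSe.nerveFunctor R).map_id _)).trans
        (Category.comp_id _)
    rw [hw₂, this]
    exact hL.weq_quotUnit
  have hF (A : RBC R r) : weakEquivalences (RBC R r) ((LWB.freeAdj R r).unit.app A) := by
    have : (LWB.freeAdj R r).unit.app A = LWB.freeUnit A := by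
      rw [← (LWB.freeAdj R r).homEquiv_id, LWB.freeAdj_homEquiv]
      exact Category.comp_id _
    rw [hw₁, this]
    exact RBC.weq_of_isIso (LWB.freeUnit A)
  refine ⟨m₁, m₂, m₃, ⟨g₁, hf₁, hw₁⟩, ⟨g₂, hf₂, hw₂⟩, ⟨g₃, hf₃, hw₃⟩,
    ⟨by ext; exact hfN _, by ext; exact hwN _⟩, LWB.quotFunctor R, LWB.quotAdj R,
    LWB.freeFunctor R r, LWB.freeAdj R r,
    .of_unit _ (fun f => (hfN f).1) hwN fun L hL => hQ L ?_,
    .of_unit _ hfU hwU fun A _ => hF A,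
    .of_unit _ (fun f hf => hfU _ ((hfN f).1 hf)) (fun f => (hwN f).trans (hwU _)) fun A _ => ?_⟩
  · refine LWB.isDegenerateExact_of_exists_section r L fun Z p hp hp' =>
      exists_section_of_isCofibrant hL p ⟨?_, ?_⟩
    · rwa [hf₂]
    · rwa [hw₂]
  · -- the unit of the composite is the composite of the units, and free linear witness books have
    -- exact degeneracies
    rw [Adjunction.comp_unit_app]
    exact (weakEquivalences (RBC R r)).comp_mem _ _ (hF A)
      ((hwU _).1 (hQ _ (LWB.free_isDegenerateExact A r)))
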